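/- Let $\Sigma$ be a compact smooth $3$-dimensional manifold (Hausdorff, without boundary) with a Riemannian metric $h$ of regularity $C^{1,1}$ (i.e. with continuously differentiable components in charts whose first derivatives are locally Lipschitz; this includes every metric of H\"older or Zygmund class $C^\tau$, $\tau>2$), let $m>0$, and let $M=\mathbb R\times\Sigma$ carry the ultrastatic Lorentzian metric $dt^2-h$. Let $A=-\Delta_h+m^2$ be the self-adjoint operator on $L^2(\Sigma,\sqrt h\,dx)$ defined by the closure of the form $\int_\Sigma (h^{ij}\,\overline{\partial_i f}\,\partial_j g+m^2\bar f g)\sqrt h\,dx$ on $C^\infty(\Sigma)$. Let $K_G\in\mathcal D'(M\times M)$ be the kernel of the causal propagator $G=-A^{-1/2}\sin(A^{1/2}(t-s))$ of the Klein--Gordon operator $\partial_t^2+A$, that is, for $w\in C_c^\infty(M\times M)$, $$K_G(w)=-\sum_k\int_{\mathbb R}\int_{\mathbb R}\int_\Sigma\int_\Sigma \bigl(A^{-1/2}\sin(A^{1/2}(t-s))\,b_k\bigr)(x)\,\overline{b_k(y)}\,w(t,x;s,y)\,\sqrt{h(y)}\,dy\,\sqrt{h(x)}\,dx\,ds\,dt,$$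 where $(b_k)$ is an orthonormal basis of $L^2(\Sigma,\sqrt h\,dx)$ (any one); for real eigenfunctions $b_k=\phi_k$, $A\phi_k=\lambda_k^2\phi_k$ with $\lambda_k>0$, this is the kernel $-\sum_k\lambda_k^{-1}\sin(\lambda_k(t-s))\phi_k(x)\phi_k(y)$. For $\tilde y\in M$ let $J(\tilde y)=J^+(\tilde y)\cup J^-(\tilde y)$, where $J^{+}(\tilde y)$ (resp. $J^-(\tilde y)$) consists of $\tilde y$ and of all points that can be reached from $\tilde y$ (resp. from which $\tilde y$ can be reached) by a future directed causal curve, i.e. a locally Lipschitz curve whose velocity is almost everywhere causal and future directed. If $\tilde x,\tilde y\in M$ are not causally related, i.e. $\tilde x\notin J(\tilde y)$, then $(\tilde x,\tilde y)\notin\operatorname{supp}K_G$; that is, $(\tilde x,\tilde y)$ has an open neighbourhood $W$ in $M\times M$ such that $K_G(w)=0$ for every $w\in C_c^\infty(M\times M)$ with support in $W$. -/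

import Mathlib

open MeasureTheory Set Filter Topology Bundle
open scoped Manifold ContDiff ComplexConjugate

noncomputable section

namespace Ultrastatic

/-- The model space `ℝ³` of the spatial slices. -/
abbrev E3 : Type := EuclideanSpace ℝ (Fin 3)

/-- The standard basis of `ℝ³`. -/
abbrev e3 (i : Fin 3) : E3 := EuclideanSpace.single i 1

section LinearAlgebra

/-- The form `h^{ij} conj(αᵢ) βⱼ` for the inverse `h^{ij}` of a matrix. -/
def invForm (H : Matrix (Fin 3) (Fin 3) ℝ) (a b : Fin 3 → ℂ) : ℂ :=
  ∑ i, ∑ j, ((H⁻¹ i j : ℝ) : ℂ) * conj (a i) * b j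

theorem invForm_eq (H : Matrix (Fin 3) (Fin 3) ℝ) (a b : Fin 3 → ℂ) :
    invForm H a b = (star a) ⬝ᵥ (((H⁻¹).map Complex.ofRealHom).mulVec b) := by
  simp only [invForm, dotProduct, Matrix.mulVec, Matrix.map_apply, Finset.mul_sum]
  refine Finset.sum_congr rfl fun i _ => Finset.sum_congr rfl fun j _ => ?_
  simp only [Complex.ofRealHom_eq_coe, Pi.star_apply, RCLike.star_def]
  ring

theorem invForm_congr (H Q : Matrix (Fin 3) (Fin 3) ℝ) (hQ : IsUnit Q.det) (a b : Fin 3 → ℂ) :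
    invForm (Q.transpose * H * Q) ((Q.map Complex.ofRealHom).transpose.mulVec a)
      ((Q.map Complex.ofRealHom).transpose.mulVec b) = invForm H a b := by
  have hQ' : IsUnit (Q.map Complex.ofRealHom).det := by
    rw [← RingHom.mapMatrix_apply, ← RingHom.map_det]; exact hQ.map _
  have h1 : Q * (Q.transpose * H * Q)⁻¹ * Q.transpose = H⁻¹ := by
    rw [Matrix.mul_inv_rev, Matrix.mul_inv_rev, ← Matrix.mul_assoc, Matrix.mul_nonsing_inv _ hQ,
      Matrix.one_mul, Matrix.mul_assoc, Matrix.nonsing_inv_mul _ (by rwa [Matrix.det_transpose]),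
      Matrix.mul_one]
  have h2 : star ((Q.map Complex.ofRealHom).transpose.mulVec a)
      = Matrix.vecMul (star a) (Q.map Complex.ofRealHom) := by
    rw [Matrix.star_mulVec]
    congr 1
    ext i j
    simp [Matrix.conjTranspose]
  rw [invForm_eq, invForm_eq, h2, ← Matrix.dotProduct_mulVec, Matrix.mulVec_mulVec,
    Matrix.mulVec_mulVec, ← h1]
  simp only [Matrix.map_mul, Matrix.transpose_map, Matrix.mul_assoc]

theorem invForm_symm {H : Matrix (Fin 3) (Fin 3) ℝ} (hH : H.PosDef) (a b : Fin 3 → ℂ) :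
    conj (invForm H b a) = invForm H a b := by
  have hs : ∀ i j, H⁻¹ i j = H⁻¹ j i := fun i j => by
    simpa using (hH.inv.isHermitian.apply i j).symm
  simp only [invForm, map_sum, map_mul, Complex.conj_ofReal, Complex.conj_conj]
  rw [Finset.sum_comm]
  refine Finset.sum_congr rfl fun i _ => Finset.sum_congr rfl fun j _ => ?_
  rw [hs]; ring

theorem invForm_self_nonneg {H : Matrix (Fin 3) (Fin 3) ℝ} (hH : H.PosDef) (a : Fin 3 → ℂ) :
    0 ≤ (invForm H a a).re := by
  have key : (invForm H a a).re = star (fun i => (a i).re) ⬝ᵥ (H⁻¹.mulVec fun i => (a i).re)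
      + star (fun i => (a i).im) ⬝ᵥ (H⁻¹.mulVec fun i => (a i).im) := by
    simp only [invForm, Complex.re_sum, dotProduct, Matrix.mulVec, Finset.mul_sum,
      ← Finset.sum_add_distrib]
    refine Finset.sum_congr rfl fun i _ => Finset.sum_congr rfl fun j _ => ?_
    simp [Complex.mul_re]
    ring
  rw [key]
  exact add_nonneg (hH.inv.posSemidef.dotProduct_mulVec_nonneg _)
    (hH.inv.posSemidef.dotProduct_mulVec_nonneg _)

theorem sum_smul_e3 (x : Fin 3 → ℝ) (j : Fin 3) : (∑ i, x i • e3 i : E3) j = x j := by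
  simp [Pi.single_apply]

theorem posDef_of_bilin (B : E3 →L[ℝ] E3 →L[ℝ] ℝ) (hs : ∀ v w, B v w = B w v)
    (hp : ∀ v, v ≠ 0 → 0 < B v v) : (Matrix.of fun i j => B (e3 i) (e3 j)).PosDef := by
  refine Matrix.PosDef.of_dotProduct_mulVec_pos ?_ ?_
  · ext i j; simpa using hs _ _
  · intro x hx
    have hx' : (∑ i, x i • e3 i : E3) ≠ 0 := by
      intro h0
      apply hx
      ext j
      have := congrArg (fun v : E3 => v j) h0
      rw [sum_smul_e3] at this
      simpa using this
    have := hp _ hx'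
    simp only [map_sum, map_smul, _root_.sum_apply, _root_.smul_apply, smul_eq_mul, Finset.mul_sum] at this
    simp only [dotProduct, Matrix.mulVec, Matrix.of_apply, Finset.mul_sum, star_trivial]
    rw [Finset.sum_comm] at this
    refine this.trans_eq (Finset.sum_congr rfl fun i _ => Finset.sum_congr rfl fun j _ => ?_)
    ring

theorem posDef_of_bilin_frame (B : E3 →L[ℝ] E3 →L[ℝ] ℝ) (L : E3 ≃L[ℝ] E3)
    (hs : ∀ v w, B v w = B w v) (hp : ∀ v, v ≠ 0 → 0 < B v v) :
    (Matrix.of fun i j => B (L (e3 i)) (L (e3 j))).PosDef :=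
  posDef_of_bilin (B.bilinearComp (L : E3 →L[ℝ] E3) (L : E3 →L[ℝ] E3))
    (fun _ _ => hs _ _) fun _ hv => hp _ fun h0 => hv (L.map_eq_zero_iff.1 h0)

theorem frame_change (B : E3 →L[ℝ] E3 →L[ℝ] ℝ) (L : E3 ≃L[ℝ] E3) (α β : E3 →L[ℝ] ℂ) :
    invForm (Matrix.of fun i j => B (L (e3 i)) (L (e3 j))) (fun i => α (L (e3 i)))
      (fun i => β (L (e3 i)))
      = invForm (Matrix.of fun i j => B (e3 i) (e3 j)) (fun i => α (e3 i)) (fun i => β (e3 i)) := by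
  set Q : Matrix (Fin 3) (Fin 3) ℝ := Matrix.of fun i j => L (e3 j) i with hQd
  have hexp : ∀ v : E3, v = ∑ i, v i • e3 i := fun v => by
    ext j; rw [sum_smul_e3]
  have hQ : IsUnit Q.det := by
    set P : Matrix (Fin 3) (Fin 3) ℝ := Matrix.of fun i j => L.symm (e3 j) i with hP
    have : Q * P = 1 := by
      ext i j
      have h1 : L (L.symm (e3 j)) = e3 j := L.apply_symm_apply _
      rw [hexp (L.symm (e3 j))] at h1
      simp only [map_sum, map_smul] at h1
      have := congrArg (fun v : E3 => v i) h1
      simp only [WithLp.ofLp_sum, Finset.sum_apply, PiLp.smul_apply, smul_eq_mul] at this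
      simp only [Matrix.mul_apply, hQd, hP, Matrix.of_apply, Matrix.one_apply]
      simp only [mul_comm (L _ i)]
      simpa using this
    exact Matrix.isUnit_det_of_right_inverse this
  have hv : ∀ γ : E3 →L[ℝ] ℂ, (fun i => γ (L (e3 i))) =
      (Q.map Complex.ofRealHom).transpose.mulVec fun i => γ (e3 i) := by
    intro γ
    ext j
    conv_lhs => rw [hexp (L (e3 j))]
    simp [Matrix.mulVec, dotProduct, hQd]
  have hB : (Matrix.of fun i j => B (L (e3 i)) (L (e3 j))) =
      Q.transpose * (Matrix.of fun i j => B (e3 i) (e3 j)) * Q := by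
    ext i j
    rw [Matrix.of_apply, hexp (L (e3 i)), hexp (L (e3 j))]
    simp only [map_sum, map_smul, _root_.sum_apply, _root_.smul_apply, smul_eq_mul,
      Matrix.mul_apply, Matrix.transpose_apply, hQd, Matrix.of_apply, Finset.mul_sum,
      Finset.sum_mul]
    refine Finset.sum_congr rfl fun k _ => Finset.sum_congr rfl fun l _ => ?_
    ring
  rw [hv α, hv β, hB, invForm_congr _ Q hQ]

end LinearAlgebra

section Metric

variable {S : Type*} [TopologicalSpace S] [ChartedSpace E3 S] [IsManifold (𝓡 3) ∞ S]

/-- The coordinate vector field `∂ᵢ` of the chart around `c`, at the point with coordinates `z`. -/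
def coordVec (c : S) (z : E3) (i : Fin 3) : TangentSpace (𝓡 3) ((extChartAt (𝓡 3) c).symm z) :=
  mfderiv 𝓘(ℝ, E3) (𝓡 3) (extChartAt (𝓡 3) c).symm z (e3 i)

/-- The matrix `(h_ij)` of a Riemannian metric in the chart around `c`. -/
def coordMatrix (h : ContinuousRiemannianMetric E3 (fun x : S => TangentSpace (𝓡 3) x))
    (c : S) (z : E3) : Matrix (Fin 3) (Fin 3) ℝ :=
  Matrix.of fun i j => h.inner ((extChartAt (𝓡 3) c).symm z) (coordVec c z i) (coordVec c z j)

variable (S) in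
/-- A Riemannian metric of regularity `C^{1,1}` on `S`: its components in the charts are
continuously differentiable, with locally Lipschitz derivatives. -/
structure C11Metric extends ContinuousRiemannianMetric E3 (fun x : S => TangentSpace (𝓡 3) x) where
  contDiffOn_coord (c : S) (i j : Fin 3) :
    ContDiffOn ℝ 1 (fun z => coordMatrix toContinuousRiemannianMetric c z i j)
      (extChartAt (𝓡 3) c).target
  locallyLipschitzOn_fderiv_coord (c : S) (i j : Fin 3) :
    LocallyLipschitzOn (extChartAt (𝓡 3) c).target
      (fderiv ℝ fun z => coordMatrix toContinuousRiemannianMetric c z i j)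

/-- The components `h_ij` at `x`, in the standard basis of the tangent space at `x`. -/
def gram (h : C11Metric S) (x : S) : Matrix (Fin 3) (Fin 3) ℝ :=
  Matrix.of fun i j => h.inner x (e3 i) (e3 j)

/-- The (sesquilinear) inner product `h^{ij} conj(αᵢ) βⱼ` of complex covectors at `x`. -/
def cometric (h : C11Metric S) (x : S) (α β : TangentSpace (𝓡 3) x →L[ℝ] ℂ) : ℂ :=
  invForm (gram h x) (fun i => α (e3 i)) (fun i => β (e3 i))

end Metric

section Volume

variable {S : Type*} [TopologicalSpace S] [ChartedSpace E3 S] [IsManifold (𝓡 3) ∞ S]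
  [T2Space S] [CompactSpace S]

variable (S) in
/-- A smooth partition of unity subordinate to the charts. -/
def chartPartition : SmoothPartitionOfUnity S (𝓡 3) S univ :=
  Classical.choose (SmoothPartitionOfUnity.exists_isSubordinate_chartAt_source (𝓡 3) S)

variable [MeasurableSpace S]

/-- The part of the Riemannian measure seen by the chart around `c`: the image on `S` of
`ρ_c √det(h_ij) dz`. -/
def volPiece (h : C11Metric S) (c : S) : Measure S :=
  ((volume.restrict (extChartAt (𝓡 3) c).target).withDensity fun z =>
    ENNReal.ofReal (chartPartition S c ((extChartAt (𝓡 3) c).symm z) *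
      √(coordMatrix h.toContinuousRiemannianMetric c z).det)).map (extChartAt (𝓡 3) c).symm

/-- The Riemannian measure `√h dx` of `(S, h)`. -/
def vol (h : C11Metric S) : Measure S := Measure.sum (volPiece h)

end Volume


section Facts

variable {S : Type*} [TopologicalSpace S] [ChartedSpace E3 S] [IsManifold (𝓡 3) ∞ S]

theorem continuousOn_coordMatrix (h : C11Metric S) (c : S) :
    ContinuousOn (coordMatrix h.toContinuousRiemannianMetric c) (extChartAt (𝓡 3) c).target :=
  continuousOn_pi.2 fun i => continuousOn_pi.2 fun j => (h.contDiffOn_coord c i j).continuousOn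

theorem gram_posDef (h : C11Metric S) (x : S) : (gram h x).PosDef :=
  posDef_of_bilin (h.inner x) (h.symm x) (h.pos x)

theorem cometric_eq_coord (h : C11Metric S) {f g : S → ℂ}
    (hf : ContMDiff (𝓡 3) 𝓘(ℝ, ℂ) ∞ f) (hg : ContMDiff (𝓡 3) 𝓘(ℝ, ℂ) ∞ g) (c : S) {z : E3}
    (hz : z ∈ (extChartAt (𝓡 3) c).target) :
    (coordMatrix h.toContinuousRiemannianMetric c z).PosDef ∧
    cometric h ((extChartAt (𝓡 3) c).symm z)
      (mfderiv (𝓡 3) 𝓘(ℝ, ℂ) f ((extChartAt (𝓡 3) c).symm z))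
      (mfderiv (𝓡 3) 𝓘(ℝ, ℂ) g ((extChartAt (𝓡 3) c).symm z)) =
    invForm (coordMatrix h.toContinuousRiemannianMetric c z)
      (fun i => fderiv ℝ (f ∘ (extChartAt (𝓡 3) c).symm) z (e3 i))
      (fun i => fderiv ℝ (g ∘ (extChartAt (𝓡 3) c).symm) z (e3 i)) := by
  obtain ⟨L, hL⟩ := isInvertible_mfderivWithin_extChartAt_symm (I := 𝓡 3) hz
  rw [ModelWithCorners.range_eq_univ, mfderivWithin_univ] at hL
  have hd : MDifferentiableAt 𝓘(ℝ, E3) (𝓡 3) (extChartAt (𝓡 3) c).symm z := by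
    have := mdifferentiableWithinAt_extChartAt_symm (I := 𝓡 3) hz
    rwa [ModelWithCorners.range_eq_univ, mdifferentiableWithinAt_univ] at this
  have hchain : ∀ {f : S → ℂ}, ContMDiff (𝓡 3) 𝓘(ℝ, ℂ) ∞ f → ∀ v : E3,
      fderiv ℝ (f ∘ (extChartAt (𝓡 3) c).symm) z v =
        mfderiv (𝓡 3) 𝓘(ℝ, ℂ) f ((extChartAt (𝓡 3) c).symm z) (L v) := by
    intro f hf v
    rw [← mfderiv_eq_fderiv, mfderiv_comp z (hf.mdifferentiableAt (by simp)) hd, ← hL]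
    rfl
  have hM : coordMatrix h.toContinuousRiemannianMetric c z =
      Matrix.of fun i j => h.inner ((extChartAt (𝓡 3) c).symm z) (L (e3 i)) (L (e3 j)) := by
    ext i j
    simp only [coordMatrix, coordVec, ← hL]
    rfl
  constructor
  · rw [hM]
    exact posDef_of_bilin_frame (h.inner ((extChartAt (𝓡 3) c).symm z)) L (h.symm _) (h.pos _)
  · simp only [hchain hf, hchain hg, hM]
    exact (frame_change (h.inner ((extChartAt (𝓡 3) c).symm z)) L _ _).symm

theorem continuous_cometric (h : C11Metric S) {f g : S → ℂ}
    (hf : ContMDiff (𝓡 3) 𝓘(ℝ, ℂ) ∞ f) (hg : ContMDiff (𝓡 3) 𝓘(ℝ, ℂ) ∞ g) :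
    Continuous fun x => cometric h x (mfderiv (𝓡 3) 𝓘(ℝ, ℂ) f x)
      (mfderiv (𝓡 3) 𝓘(ℝ, ℂ) g x) := by
  rw [continuous_iff_continuousAt]
  intro c
  have hopen : IsOpen (extChartAt (𝓡 3) c).target := isOpen_extChartAt_target c
  have hderiv : ∀ {f : S → ℂ}, ContMDiff (𝓡 3) 𝓘(ℝ, ℂ) ∞ f → ∀ i,
      ContinuousOn (fun z => fderiv ℝ (f ∘ (extChartAt (𝓡 3) c).symm) z (e3 i))
        (extChartAt (𝓡 3) c).target := by
    intro f hf i
    have h1 : ContDiffOn ℝ ∞ (f ∘ (extChartAt (𝓡 3) c).symm) (extChartAt (𝓡 3) c).target :=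
      (hf.comp_contMDiffOn (contMDiffOn_extChartAt_symm c)).contDiffOn
    exact (h1.continuousOn_fderiv_of_isOpen hopen (by simp)).clm_apply continuousOn_const
  have hinv : ∀ i j, ContinuousOn
      (fun z => (coordMatrix h.toContinuousRiemannianMetric c z)⁻¹ i j)
      (extChartAt (𝓡 3) c).target := by
    intro i j
    simp only [Matrix.inv_def, Matrix.smul_apply, Ring.inverse_eq_inv', smul_eq_mul]
    have hdet : ContinuousOn (fun z => (coordMatrix h.toContinuousRiemannianMetric c z).det)
        (extChartAt (𝓡 3) c).target :=
      (continuous_id.matrix_det).comp_continuousOn (continuousOn_coordMatrix h c)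
    have hadj : ContinuousOn
        (fun z => (coordMatrix h.toContinuousRiemannianMetric c z).adjugate i j)
        (extChartAt (𝓡 3) c).target :=
      ((continuous_id.matrix_adjugate).matrix_elem i j).comp_continuousOn
        (continuousOn_coordMatrix h c)
    exact (hdet.inv₀ fun z hz => (cometric_eq_coord h hf hg c hz).1.det_pos.ne').mul hadj
  have hF : ContinuousOn (fun z => invForm (coordMatrix h.toContinuousRiemannianMetric c z)
      (fun i => fderiv ℝ (f ∘ (extChartAt (𝓡 3) c).symm) z (e3 i))
      (fun i => fderiv ℝ (g ∘ (extChartAt (𝓡 3) c).symm) z (e3 i)))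
      (extChartAt (𝓡 3) c).target := by
    unfold invForm
    refine continuousOn_finsetSum _ fun i _ => continuousOn_finsetSum _ fun j _ => ?_
    exact ((Complex.continuous_ofReal.comp_continuousOn (hinv i j)).mul
      (Complex.continuous_conj.comp_continuousOn (hderiv hf i))).mul (hderiv hg j)
  have hc : ContinuousOn (fun x => cometric h x (mfderiv (𝓡 3) 𝓘(ℝ, ℂ) f x)
      (mfderiv (𝓡 3) 𝓘(ℝ, ℂ) g x)) (extChartAt (𝓡 3) c).source := by
    refine (hF.comp (continuousOn_extChartAt c) (extChartAt (𝓡 3) c).mapsTo).congr ?_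
    intro x hx
    have h1 := (cometric_eq_coord h hf hg c ((extChartAt (𝓡 3) c).map_source hx)).2
    rw [(extChartAt (𝓡 3) c).left_inv hx] at h1
    exact h1
  exact hc.continuousAt (extChartAt_source_mem_nhds c)

variable [T2Space S] [CompactSpace S]

theorem chartPartition_subordinate (c : S) :
    tsupport (chartPartition S c) ⊆ (extChartAt (𝓡 3) c).source := by
  rw [extChartAt_source]
  exact Classical.choose_spec
    (SmoothPartitionOfUnity.exists_isSubordinate_chartAt_source (𝓡 3) S) c

variable [MeasurableSpace S]

instance (h : C11Metric S) (c : S) : IsFiniteMeasure (volPiece h c) := by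
  set φ := extChartAt (𝓡 3) c with hφ
  set F : E3 → ℝ := fun z => chartPartition S c (φ.symm z) *
    √(coordMatrix h.toContinuousRiemannianMetric c z).det with hFdef
  have hK : IsCompact (φ '' tsupport (chartPartition S c)) :=
    ((isClosed_tsupport _).isCompact).image_of_continuousOn
      ((continuousOn_extChartAt c).mono (chartPartition_subordinate c))
  have hKt : φ '' tsupport (chartPartition S c) ⊆ φ.target := by
    rintro _ ⟨x, hx, rfl⟩
    exact φ.map_source (chartPartition_subordinate c hx)
  have hcont : ContinuousOn F φ.target := by
    refine ContinuousOn.mul ((chartPartition S c).contMDiff.continuous.comp_continuousOn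
      (continuousOn_extChartAt_symm c)) ?_
    exact Real.continuous_sqrt.comp_continuousOn
      ((continuous_id.matrix_det).comp_continuousOn (continuousOn_coordMatrix h c))
  have hint : IntegrableOn F φ.target := by
    refine IntegrableOn.of_forall_sdiff_eq_zero
      ((hcont.mono hKt).integrableOn_compact hK) (isOpen_extChartAt_target c).measurableSet ?_
    intro z hz
    have : chartPartition S c (φ.symm z) = 0 := by
      by_contra h0
      exact hz.2 ⟨φ.symm z, subset_tsupport _ h0, φ.right_inv hz.1⟩
    simp [hFdef, this]
  have := isFiniteMeasure_withDensity_ofReal hint.2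
  unfold volPiece
  infer_instance

instance (h : C11Metric S) : IsFiniteMeasure (vol h) := by
  refine ⟨?_⟩
  have hfin : {c : S | (Function.support (chartPartition S c)).Nonempty}.Finite :=
    (chartPartition S).locallyFinite.finite_nonempty_of_compact
  rw [vol, Measure.sum_apply _ MeasurableSet.univ, tsum_eq_sum (s := hfin.toFinset)]
  · exact ENNReal.sum_lt_top.2 fun c _ => measure_lt_top _ _
  · intro c hc
    have h0 : ∀ x, chartPartition S c x = 0 := by
      intro x
      by_contra hx
      exact hc (hfin.mem_toFinset.2 ⟨x, hx⟩)
    simp [volPiece, h0]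

end Facts

section Operator

variable {S : Type*} [TopologicalSpace S] [ChartedSpace E3 S] [IsManifold (𝓡 3) ∞ S]

variable (S) in
/-- The complex valued smooth functions on `S`. -/
def smoothFun : Submodule ℂ (S → ℂ) where
  carrier := {f | ContMDiff (𝓡 3) 𝓘(ℝ, ℂ) ∞ f}
  add_mem' hf hg := hf.add hg
  zero_mem' := contMDiff_const
  smul_mem' a _ hf := (ContinuousLinearMap.mul ℝ ℂ a).contMDiff.comp hf

/-- The smooth functions on `S`, to be normed by the quadratic form of `-Δ_h + m²`. -/
def FormCore (_ : C11Metric S) (_ : ℝ) : Type _ := smoothFun S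

variable (h : C11Metric S) (m : ℝ)

instance : AddCommGroup (FormCore h m) := inferInstanceAs (AddCommGroup (smoothFun S))

instance : Module ℂ (FormCore h m) := inferInstanceAs (Module ℂ (smoothFun S))

variable {h m}

/-- The underlying function. -/
def FormCore.fn (f : FormCore h m) : S → ℂ := f.1

theorem FormCore.contMDiff (f : FormCore h m) : ContMDiff (𝓡 3) 𝓘(ℝ, ℂ) ∞ f.fn := f.2

/-- The differential. -/
def FormCore.d (f : FormCore h m) (x : S) : TangentSpace (𝓡 3) x →L[ℝ] ℂ :=
  mfderiv (𝓡 3) 𝓘(ℝ, ℂ) f.fn x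

theorem FormCore.d_add (f g : FormCore h m) (x : S) (v : TangentSpace (𝓡 3) x) :
    (f + g).d x v = f.d x v + g.d x v := by
  have := mfderiv_add (f.contMDiff.mdifferentiableAt (x := x) (by simp))
    (g.contMDiff.mdifferentiableAt (x := x) (by simp))
  exact congrArg (fun T : E3 →L[ℝ] ℂ => T v) this

theorem FormCore.d_smul (a : ℂ) (f : FormCore h m) (x : S) (v : TangentSpace (𝓡 3) x) :
    (a • f).d x v = a * f.d x v := by
  have h1 : MDifferentiableAt (𝓡 3) 𝓘(ℝ, ℂ) f.fn x := f.contMDiff.mdifferentiableAt (by simp)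
  have := ((ContinuousLinearMap.mul ℝ ℂ a).hasMFDerivAt (x := f.fn x)).comp x h1.hasMFDerivAt
  exact congrArg (fun T : E3 →L[ℝ] ℂ => T v) this.mfderiv

/-- The integrand `⟨df, dg⟩ + m² conj(f) g` of the form of `-Δ_h + m²`. -/
def formDensity (f g : FormCore h m) (x : S) : ℂ :=
  cometric h x (f.d x) (g.d x) + (m : ℂ) ^ 2 * (conj (f.fn x) * g.fn x)

theorem continuous_formDensity (f g : FormCore h m) : Continuous (formDensity f g) :=
  (continuous_cometric h f.contMDiff g.contMDiff).add (continuous_const.mul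
    ((Complex.continuous_conj.comp f.contMDiff.continuous).mul g.contMDiff.continuous))

theorem formDensity_self_re (f : FormCore h m) (x : S) :
    m ^ 2 * ‖f.fn x‖ ^ 2 ≤ (formDensity f f x).re := by
  have h1 := invForm_self_nonneg (gram_posDef h x) (fun i => f.d x (e3 i))
  have h2 : ((m : ℂ) ^ 2 * (conj (f.fn x) * f.fn x)).re = m ^ 2 * ‖f.fn x‖ ^ 2 := by
    rw [Complex.conj_mul']
    norm_cast
  rw [formDensity, Complex.add_re, h2]
  exact le_add_of_nonneg_left h1

variable [T2Space S] [CompactSpace S] [MeasurableSpace S] [BorelSpace S]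

theorem integrable_formDensity (f g : FormCore h m) : Integrable (formDensity f g) (vol h) :=
  (continuous_formDensity f g).integrable_of_hasCompactSupport (HasCompactSupport.of_compactSpace _)

variable (h m) in
/-- The sesquilinear form of `-Δ_h + m²` on smooth functions. -/
@[reducible]
def formCore : PreInnerProductSpace.Core ℂ (FormCore h m) where
  inner f g := ∫ x, formDensity f g x ∂(vol h)
  conj_inner_symm f g := by
    rw [← integral_conj]
    refine integral_congr_ae (ae_of_all _ fun x => ?_)
    simp only [formDensity, map_add, cometric, invForm_symm (gram_posDef h x), map_mul, map_pow,
      Complex.conj_ofReal, Complex.conj_conj]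
    ring
  re_inner_nonneg f := by
    have : RCLike.re (∫ x, formDensity f f x ∂(vol h)) =
        ∫ x, RCLike.re (formDensity f f x) ∂(vol h) := (integral_re (integrable_formDensity f f)).symm
    rw [this]
    exact integral_nonneg fun x => le_trans (by positivity) (formDensity_self_re f x)
  add_left f g k := by
    rw [← integral_add (integrable_formDensity f k) (integrable_formDensity g k)]
    refine integral_congr_ae (ae_of_all _ fun x => ?_)
    have : (f + g).fn x = f.fn x + g.fn x := rfl
    have hd : ∀ i, (f + g).d x (e3 i) = f.d x (e3 i) + g.d x (e3 i) :=
      fun i => FormCore.d_add f g x (e3 i)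
    simp only [formDensity, cometric, invForm, hd, map_add, this, mul_add, add_mul,
      Finset.sum_add_distrib]
    ring
  smul_left f g a := by
    rw [← integral_const_mul]
    refine integral_congr_ae (ae_of_all _ fun x => ?_)
    have : (a • f).fn x = a * f.fn x := rfl
    have hd : ∀ i, (a • f).d x (e3 i) = a * f.d x (e3 i) :=
      fun i => FormCore.d_smul a f x (e3 i)
    simp only [formDensity, cometric, invForm, hd, map_mul, this, mul_add,
      Finset.mul_sum]
    congr 1
    · refine Finset.sum_congr rfl fun i _ => Finset.sum_congr rfl fun j _ => ?_
      ring
    · ring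

instance : SeminormedAddCommGroup (FormCore h m) :=
  @InnerProductSpace.Core.toSeminormedAddCommGroup ℂ _ _ _ _ (formCore h m)

instance : InnerProductSpace ℂ (FormCore h m) := InnerProductSpace.ofCore (formCore h m)

theorem FormCore.norm_sq (f : FormCore h m) :
    ‖f‖ ^ 2 = ∫ x, (formDensity f f x).re ∂(vol h) := by
  rw [← inner_self_eq_norm_sq (𝕜 := ℂ) f]
  exact (integral_re (integrable_formDensity f f)).symm

variable (h) in
/-- The Hilbert space `L²(S, √h dx)` of complex valued functions. -/
abbrev L2 : Type _ := Lp ℂ 2 (vol h)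

variable (h) in
/-- The class in `L²` of a smooth function. -/
def toL2Lin (m : ℝ) : FormCore h m →ₗ[ℂ] L2 h where
  toFun f := ContinuousMap.toLp 2 (vol h) ℂ ⟨f.fn, f.contMDiff.continuous⟩
  map_add' f g := (ContinuousMap.toLp 2 (vol h) ℂ).map_add ⟨f.fn, f.contMDiff.continuous⟩
    ⟨g.fn, g.contMDiff.continuous⟩
  map_smul' a f := (ContinuousMap.toLp 2 (vol h) ℂ).map_smul a ⟨f.fn, f.contMDiff.continuous⟩

theorem norm_toL2Lin_le (hm : 0 < m) (f : FormCore h m) : ‖toL2Lin h m f‖ ≤ m⁻¹ * ‖f‖ := by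
  rw [← div_eq_inv_mul, le_div_iff₀ hm, mul_comm]
  refine le_of_sq_le_sq ?_ (norm_nonneg f)
  have h1 : ‖toL2Lin h m f‖ ^ 2 = ∫ x, ‖f.fn x‖ ^ 2 ∂(vol h) := by
    rw [← inner_self_eq_norm_sq (𝕜 := ℂ)]
    have h2 : inner ℂ (toL2Lin h m f) (toL2Lin h m f) = ∫ x, f.fn x * conj (f.fn x) ∂(vol h) :=
      ContinuousMap.inner_toLp (vol h) _ _
    rw [h2]
    have h3 : ∀ x, f.fn x * conj (f.fn x) = ((‖f.fn x‖ ^ 2 : ℝ) : ℂ) := fun x => by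
      rw [Complex.mul_conj']; norm_cast
    simp only [h3]
    rw [integral_complex_ofReal]
    simp
  rw [mul_pow, h1, f.norm_sq, ← integral_const_mul]
  refine integral_mono_of_nonneg (ae_of_all _ fun x => by positivity) (integrable_formDensity f f).re
    (ae_of_all _ fun x => formDensity_self_re f x)

variable (h m) in
/-- The form domain `H¹(S)`: the completion of the smooth functions in the form norm. -/
abbrev FormDomain : Type _ := UniformSpace.Completion (FormCore h m)

variable (h) in
/-- The inclusion of the form domain in `L²`. -/
def inclL2 (hm : 0 < m) : FormDomain h m →L[ℂ] L2 h :=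
  ((toL2Lin h m).mkContinuous m⁻¹ (norm_toL2Lin_le hm)).extend UniformSpace.Completion.toComplL

variable (h) in
/-- The inverse `A⁻¹` of the self-adjoint operator `A = -Δ_h + m²` on `L²(S)`, which is `ι ι*` for
the inclusion `ι` of the form domain in `L²(S)`: by definition of the adjoint, `u = ι* f` is the weak
solution of `A u = f`, i.e. `∫ (⟨du, dψ⟩ + m² conj(u) ψ) = ∫ conj(f) ψ` for all smooth `ψ`. -/
def invA (hm : 0 < m) : L2 h →L[ℂ] L2 h :=
  (inclL2 h hm).comp (ContinuousLinearMap.adjoint (inclL2 h hm))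

/-- The operator `A^{-1/2} sin(τ A^{1/2})`, as the continuous function `√r sin(τ/√r)` (with value
`0` at `r = 0`) of the bounded self-adjoint operator `R = A⁻¹`. -/
def sinOfInv {H : Type*} [NormedAddCommGroup H] [InnerProductSpace ℂ H] [CompleteSpace H]
    (R : H →L[ℂ] H) (τ : ℝ) : H →L[ℂ] H :=
  cfc (fun r : ℝ => √r * Real.sin (τ / √r)) R

variable (h) in
/-- The operator `A^{-1/2} sin(τ A^{1/2})` on `L²(S)`, for `A = -Δ_h + m²`. -/
def sinOp (hm : 0 < m) (τ : ℝ) : L2 h →L[ℂ] L2 h := sinOfInv (invA h hm) τ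

end Operator

section Kernel

/-- The model with corners of the spacetime `ℝ × S`. -/
abbrev IM : ModelWithCorners ℝ (ℝ × E3) (ModelProd ℝ E3) := 𝓘(ℝ, ℝ).prod (𝓡 3)

/-- Test functions on a manifold: smooth, complex valued, of compact support. -/
structure IsTest {E H N : Type*} [NormedAddCommGroup E] [NormedSpace ℝ E] [TopologicalSpace H]
    (I : ModelWithCorners ℝ E H) [TopologicalSpace N] [ChartedSpace H N] (w : N → ℂ) : Prop where
  contMDiff : ContMDiff I 𝓘(ℝ, ℂ) ∞ w
  hasCompactSupport : HasCompactSupport w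

/-- The support of a functional `T` on test functions: the complement of the largest open set on
which `T` vanishes. -/
def distSupport {E H N : Type*} [NormedAddCommGroup E] [NormedSpace ℝ E] [TopologicalSpace H]
    (I : ModelWithCorners ℝ E H) [TopologicalSpace N] [ChartedSpace H N] (T : (N → ℂ) → ℂ) :
    Set N :=
  (⋃₀ {U : Set N | IsOpen U ∧ ∀ w, IsTest I w → tsupport w ⊆ U → T w = 0})ᶜ

variable {S : Type*} [TopologicalSpace S] [ChartedSpace E3 S] [IsManifold (𝓡 3) ∞ S]
  [T2Space S] [CompactSpace S] [MeasurableSpace S] [BorelSpace S]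

/-- The kernel `K_G` of the causal propagator `G = -A^{-1/2} sin(A^{1/2}(t-s))`, acting on a
function `w` on `M × M`, `M = ℝ × S`: with an orthonormal basis `(b k)` of `L²(S)`,
`K_G(t,x;s,y) = -∑ₖ (A^{-1/2} sin(A^{1/2}(t-s)) bₖ)(x) conj(bₖ(y))`.
For real eigenfunctions `bₖ = φₖ` of `A` with eigenvalues `λₖ²`, this is
`-∑ₖ λₖ⁻¹ sin(λₖ(t-s)) φₖ(x) φₖ(y)`. -/
def causalKernel (h : C11Metric S) {m : ℝ} (hm : 0 < m) {ι : Type*}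
    (b : HilbertBasis ι ℂ (L2 h)) (w : (ℝ × S) × (ℝ × S) → ℂ) : ℂ :=
  -∑' k, ∫ t : ℝ, ∫ s : ℝ, ∫ x, ∫ y,
    sinOp h hm (t - s) (b k) x * conj (b k y) * w ((t, x), (s, y)) ∂(vol h) ∂(vol h)

end Kernel

section Causality

variable {S : Type*} [TopologicalSpace S] [ChartedSpace E3 S] [IsManifold (𝓡 3) ∞ S]

/-- The ultrastatic Lorentzian metric `dt² - h` on `ℝ × S`. -/
def lorentz (h : C11Metric S) (p : ℝ × S) (v w : TangentSpace IM p) : ℝ :=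
  v.1 * w.1 - h.inner p.2 v.2 w.2

/-- The velocity of a curve in `ℝ × S`. -/
def velocity (γ : ℝ → ℝ × S) (σ : ℝ) : TangentSpace IM (γ σ) :=
  mfderiv 𝓘(ℝ, ℝ) IM γ σ (1 : ℝ)

/-- Future directed causal curves on `[a, b]`: (locally) Lipschitz curves with almost everywhere
future directed causal velocity. -/
structure IsFutureCausal (h : C11Metric S) (γ : ℝ → ℝ × S) (a b : ℝ) : Prop where
  continuousOn : ContinuousOn γ (Icc a b)
  lipschitz : ∀ σ ∈ Icc a b, ∃ K, ∃ u ∈ 𝓝[Icc a b] σ, LipschitzOnWith K (extChartAt IM (γ σ) ∘ γ) u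
  causal : ∀ᵐ σ, σ ∈ Icc a b → MDifferentiableAt 𝓘(ℝ, ℝ) IM γ σ ∧
    0 ≤ lorentz h (γ σ) (velocity γ σ) (velocity γ σ) ∧ 0 < (velocity γ σ).1

/-- The causal future `J⁺(p)`. -/
def causalFuture (h : C11Metric S) (p : ℝ × S) : Set (ℝ × S) :=
  {q | q = p ∨ ∃ γ a b, a < b ∧ IsFutureCausal h γ a b ∧ γ a = p ∧ γ b = q}

/-- The causal past `J⁻(p)`. -/
def causalPast (h : C11Metric S) (p : ℝ × S) : Set (ℝ × S) := {q | p ∈ causalFuture h q}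

/-- `J(p) = J⁺(p) ∪ J⁻(p)`. -/
def causalJ (h : C11Metric S) (p : ℝ × S) : Set (ℝ × S) := causalFuture h p ∪ causalPast h p

end Causality

end Ultrastatic

end

/-! The kernel vanishes off the causal relation because waves travel with speed at most one, and
speed is measured here by short functions: smooth `ψ` with `|dψ| ≤ 1` (`IsShort`). An analytic and a
geometric argument meet in the inequality `|t - s| < ψ x - ψ y`.

Analytic half. Let `v = (A + k²)⁻¹ g`. Testing the weak equation for `v` against `e^{2kψ} v` and
completing the square, the weight costs at most `k²` because `|dψ| ≤ 1`, and the spectral parameter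
pays exactly that. Hence `m² ‖e^{kψ} v‖ ≤ ‖e^{kψ} g‖` for every `k` (`norm_expWeight_resolvent_le`),
and matrix elements of the resolvent between functions supported in `ψ ≥ b` and `ψ ≤ a` are
`O(e^{-k(b-a)})`. The resolvent is the Laplace transform of `A^{-1/2} sin(t A^{1/2})`, and a bounded
continuous function whose Laplace transform is `O(e^{-kd})` vanishes on `(0, d)`
(`eq_zero_of_norm_laplace_le`). So the matrix elements of the sine operator vanish for `|t| < b - a`
(`inner_sinOp_eq_zero`).

The kernel acts on test functions that are not products. In a chart for the last variable, a test
function is the integral of its mixed third derivative against indicators of octants, hence a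
superposition of products; Parseval then removes the basis (`causalKernel_eq_integral`), and what
remains is an integral of vanishing matrix elements.

Geometric half. Suppose `|ψ x - ψ y| ≤ T` for all short `ψ`. The least total size of a chain of
jumps of size at most `ε` starting at `y` is `1`-Lipschitz at small scales, so mollifying in charts
and gluing makes it a uniform limit of almost short functions (`IsLocallyShort.exists_approx`). The
assumption therefore bounds it, and chains of total size less than `T + ε` reach `x`. Step functions
through these chains lie in the compact space `ℝ → S`; in the limit there is a curve along which
every short function is `1`-Lipschitz (`exists_isShortCurve`). Such a curve is locally Lipschitz,
differentiable almost everywhere by Rademacher's theorem, and of speed at most one, so with time as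
first component it is causal (`IsShortCurve.isFutureCausal`). Points that are not causally related
are thus separated by a short function. -/

namespace Ultrastatic

set_option linter.unusedSectionVars false

/-! ### Functions with exponentially small Laplace transform. -/

section Laplace

/-- For `y = e^{k(σ-t)}` the left side is a combination of the exponentials `e^{-k(j+1)t}`, while
the right side is a smooth cutoff at `t = σ`, sharp as `k → ∞`. Integrals against the cutoff are
thus controlled by the Laplace transform at real points. -/
theorem hasSum_one_sub_exp_neg (y : ℝ) :
    HasSum (fun j : ℕ => (-1 : ℝ) ^ j / (j + 1).factorial * y ^ (j + 1)) (1 - Real.exp (-y)) := by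
  have h1 : HasSum (fun n : ℕ => (-y) ^ n / n.factorial) (Real.exp (-y)) := by
    rw [Real.exp_eq_exp_ℝ]
    exact NormedSpace.expSeries_div_hasSum_exp (-y)
  have h2 := ((hasSum_nat_add_iff' 1).2 h1).neg
  simp only [Finset.range_one, Finset.sum_singleton, pow_zero, Nat.factorial_zero, Nat.cast_one,
    div_one, neg_sub] at h2
  have h3 : (fun j : ℕ => (-1 : ℝ) ^ j / (j + 1).factorial * y ^ (j + 1)) =
      fun j : ℕ => -((-y) ^ (j + 1) / ((j + 1).factorial : ℝ)) := by
    funext j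
    rw [neg_pow y, pow_succ (-1 : ℝ)]
    ring
  rwa [h3]

theorem hasSum_exp_sub_one (y : ℝ) :
    HasSum (fun j : ℕ => ((j + 1).factorial : ℝ)⁻¹ * y ^ (j + 1)) (Real.exp y - 1) := by
  have h1 : HasSum (fun n : ℕ => y ^ n / n.factorial) (Real.exp y) := by
    rw [Real.exp_eq_exp_ℝ]
    exact NormedSpace.expSeries_div_hasSum_exp y
  have h2 := (hasSum_nat_add_iff' 1).2 h1
  simp only [Finset.range_one, Finset.sum_singleton, pow_zero, Nat.factorial_zero, Nat.cast_one,
    div_one] at h2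
  simpa only [div_eq_inv_mul] using h2

variable {F : ℝ → ℂ} {C B d : ℝ}

theorem integrableOn_exp_smul (hF : Continuous F) (hb : ∀ t, ‖F t‖ ≤ C) {k : ℝ} (hk : 0 < k) :
    IntegrableOn (fun t => Real.exp (-k * t) • F t) (Ioi 0) := by
  refine Integrable.mono' ((integrableOn_exp_mul_Ioi (neg_lt_zero.2 hk) 0).mul_const C)
    (by fun_prop) (ae_of_all _ fun t => ?_)
  rw [norm_smul, Real.norm_eq_abs, Real.abs_exp]
  exact mul_le_mul_of_nonneg_left (hb t) (Real.exp_pos _).le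

/-- The bound on the smoothed primitive of a function whose Laplace transform decays. -/
theorem norm_integral_one_sub_exp_le (hF : Continuous F) (hb : ∀ t, ‖F t‖ ≤ C)
    (hL : ∀ k : ℝ, 0 < k → ‖∫ t in Ioi (0 : ℝ), Real.exp (-k * t) • F t‖ ≤ B * Real.exp (-k * d))
    {k : ℝ} (hk : 0 < k) (σ : ℝ) :
    ‖∫ t in Ioi (0 : ℝ), (1 - Real.exp (-Real.exp (k * (σ - t)))) • F t‖ ≤
      B * (Real.exp (Real.exp (k * (σ - d))) - 1) := by
  have hC : 0 ≤ C := (norm_nonneg _).trans (hb 0)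
  have hB : 0 ≤ B * Real.exp (-1 * d) := (norm_nonneg _).trans (hL 1 one_pos)
  have hkj : ∀ j : ℕ, 0 < k * (j + 1) := fun j => by positivity
  have hpow : ∀ (j : ℕ) (t : ℝ), Real.exp (k * (σ - t)) ^ (j + 1) =
      Real.exp (k * σ) ^ (j + 1) * Real.exp (-(k * (j + 1)) * t) := fun j t => by
    rw [← Real.exp_nat_mul, ← Real.exp_nat_mul, ← Real.exp_add]
    congr 1
    push_cast
    ring
  set a : ℕ → ℝ := fun j => (-1 : ℝ) ^ j / (j + 1).factorial * Real.exp (k * σ) ^ (j + 1) with ha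
  have hterm : ∀ (j : ℕ) (t : ℝ), ((-1 : ℝ) ^ j / (j + 1).factorial *
      Real.exp (k * (σ - t)) ^ (j + 1)) • F t = a j • (Real.exp (-(k * (j + 1)) * t) • F t) := by
    intro j t
    rw [hpow, smul_smul, ha]
    congr 1
    ring
  have hnorm_a : ∀ j, ‖a j‖ = ((j + 1).factorial : ℝ)⁻¹ * Real.exp (k * σ) ^ (j + 1) := by
    intro j
    simp only [ha, norm_mul, norm_div, norm_pow, norm_neg, norm_one, one_pow, one_div,
      Real.norm_eq_abs, Real.abs_exp, Nat.abs_cast]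
  -- Sum and integral may be exchanged, since the norm of the `j`-th term integrates to at most `(C
  -- / k) e^{kσ(j+1)} / (j+1)!`.
  have hsum := hasSum_integral_of_summable_integral_norm (μ := volume.restrict (Ioi (0 : ℝ)))
    (F := fun (j : ℕ) t => a j • (Real.exp (-(k * (j + 1)) * t) • F t))
    (fun j => (integrableOn_exp_smul hF hb (hkj j)).smul (a j)) (by
      refine Summable.of_nonneg_of_le (fun j => integral_nonneg fun t => norm_nonneg _) (fun j => ?_)
        ((hasSum_exp_sub_one (Real.exp (k * σ))).summable.mul_right (C / k))
      have h1 : ∫ t in Ioi (0 : ℝ), ‖a j • (Real.exp (-(k * (j + 1)) * t) • F t)‖ ≤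
          ∫ t in Ioi (0 : ℝ), ‖a j‖ * (Real.exp (-(k * (j + 1)) * t) * C) := by
        refine integral_mono_of_nonneg (ae_of_all _ fun t => norm_nonneg _) ?_
          (ae_of_all _ fun t => ?_)
        · exact ((integrableOn_exp_mul_Ioi (neg_lt_zero.2 (hkj j)) 0).mul_const C).const_mul _
        · simp only [norm_smul, Real.norm_eq_abs, Real.abs_exp]
          gcongr
          exact hb t
      refine h1.trans ?_
      rw [integral_const_mul, integral_mul_const, integral_exp_mul_Ioi (neg_lt_zero.2 (hkj j)),
        hnorm_a]
      gcongr
      rw [mul_zero, Real.exp_zero, neg_div_neg_eq, one_div, inv_mul_eq_div]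
      exact div_le_div_of_nonneg_left hC hk (le_mul_of_one_le_right hk.le (by linarith [j.cast_nonneg (α := ℝ)])))
  have hpt : ∀ t, ∑' j : ℕ, a j • (Real.exp (-(k * (j + 1)) * t) • F t) =
      (1 - Real.exp (-Real.exp (k * (σ - t)))) • F t := by
    intro t
    simp only [← hterm]
    exact ((hasSum_one_sub_exp_neg _).smul_const (F t)).tsum_eq
  simp only [hpt] at hsum
  -- The decay of the transform at `k(j+1)` turns each `e^{kσ(j+1)}` into `e^{k(σ-d)(j+1)}`, and the
  -- series sums again to an exponential.
  refine hsum.norm_le_of_bounded ((hasSum_exp_sub_one (Real.exp (k * (σ - d)))).mul_left B) fun j => ?_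
  rw [integral_smul, norm_smul, hnorm_a, hpow]
  have := hL _ (hkj j)
  calc _ ≤ ((j + 1).factorial : ℝ)⁻¹ * Real.exp (k * σ) ^ (j + 1) *
        (B * Real.exp (-(k * (j + 1)) * d)) := by gcongr
    _ = _ := by ring

/-- A bounded continuous function whose Laplace transform is `O(e^{-kd})` vanishes on `(0, d)`. -/
theorem eq_zero_of_norm_laplace_le (hF : Continuous F) (hb : ∀ t, ‖F t‖ ≤ C)
    (hL : ∀ k : ℝ, 0 < k → ‖∫ t in Ioi (0 : ℝ), Real.exp (-k * t) • F t‖ ≤ B * Real.exp (-k * d))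
    {t : ℝ} (ht : t ∈ Ioo 0 d) : F t = 0 := by
  have hC : 0 ≤ C := (norm_nonneg _).trans (hb 0)
  -- The cutoff integrals tend to the primitive of `F` at `σ`, and also to zero because `σ < d`.
  have key : ∀ σ ∈ Ioo 0 d, ∫ t in (0 : ℝ)..σ, F t = 0 := by
    intro σ hσ
    have hlim : Tendsto (fun n : ℕ => ∫ t in Ioi (0 : ℝ),
        (1 - Real.exp (-Real.exp ((n + 1 : ℝ) * (σ - t)))) • F t) atTop
        (𝓝 (∫ t in Ioi (0 : ℝ), (Ioc 0 σ).indicator F t)) := by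
      -- The majorant `C e^{σ-t}` serves on both sides of `σ`: before it the cutoff is at most `1`,
      -- after it at most `e^{k(σ-t)}` with `k = n + 1 ≥ 1`.
      refine tendsto_integral_of_dominated_convergence (fun t => Real.exp σ * Real.exp (-1 * t) * C)
        (fun n => ?_) ?_ (fun n => ae_of_all _ fun t => ?_) ?_
      · exact Continuous.aestronglyMeasurable (by fun_prop)
      · exact ((integrableOn_exp_mul_Ioi (by norm_num) 0).const_mul _).mul_const C
      · have hy := Real.exp_pos ((n + 1 : ℝ) * (σ - t))
        have h1 : 1 - Real.exp (-Real.exp ((n + 1 : ℝ) * (σ - t))) ≤ 1 := by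
          linarith [Real.exp_pos (-Real.exp ((n + 1 : ℝ) * (σ - t)))]
        have h2 : 1 - Real.exp (-Real.exp ((n + 1 : ℝ) * (σ - t))) ≤
            Real.exp ((n + 1 : ℝ) * (σ - t)) := by
          linarith [Real.add_one_le_exp (-Real.exp ((n + 1 : ℝ) * (σ - t)))]
        have h3 : 0 ≤ 1 - Real.exp (-Real.exp ((n + 1 : ℝ) * (σ - t))) := by
          linarith [Real.exp_le_one_iff.2 (neg_nonpos.2 hy.le)]
        rw [norm_smul, Real.norm_eq_abs, abs_of_nonneg h3]
        refine mul_le_mul ?_ (hb t) (norm_nonneg _) (by positivity)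
        rw [← Real.exp_add]
        rcases le_total t σ with hts | hts
        · exact h1.trans (Real.one_le_exp (by linarith))
        · refine h2.trans (Real.exp_le_exp.2 ?_)
          nlinarith [n.cast_nonneg (α := ℝ)]
      · have hne : ∀ᵐ t ∂(volume.restrict (Ioi (0 : ℝ))), t ≠ σ :=
          ae_restrict_of_ae (by simp [ae_iff, measure_singleton])
        filter_upwards [hne, ae_restrict_mem measurableSet_Ioi] with t htσ ht0
        have hn : Tendsto (fun n : ℕ => (n + 1 : ℝ)) atTop atTop :=
          tendsto_atTop_add_const_right _ _ tendsto_natCast_atTop_atTop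
        rcases lt_or_gt_of_ne htσ with hlt | hgt
        · rw [indicator_of_mem (show t ∈ Ioc 0 σ from ⟨ht0, hlt.le⟩)]
          have h1 : Tendsto (fun n : ℕ => Real.exp (-Real.exp ((n + 1 : ℝ) * (σ - t)))) atTop
              (𝓝 0) :=
            Real.tendsto_exp_neg_atTop_nhds_zero.comp
              (Real.tendsto_exp_atTop.comp (hn.atTop_mul_const (sub_pos.2 hlt)))
          simpa using (h1.const_sub 1).smul_const (F t)
        · rw [indicator_of_notMem (fun hm => absurd hm.2 (not_le.2 hgt))]
          have h1 : Tendsto (fun n : ℕ => Real.exp (-Real.exp ((n + 1 : ℝ) * (σ - t)))) atTop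
              (𝓝 (Real.exp (-0))) := by
            refine (Real.continuous_exp.tendsto _).comp (Tendsto.neg ?_)
            exact Real.tendsto_exp_atBot.comp (hn.atTop_mul_const_of_neg (sub_neg.2 hgt))
          simpa using (h1.const_sub 1).smul_const (F t)
    have hzero : Tendsto (fun n : ℕ => ∫ t in Ioi (0 : ℝ),
        (1 - Real.exp (-Real.exp ((n + 1 : ℝ) * (σ - t)))) • F t) atTop (𝓝 0) := by
      refine squeeze_zero_norm (fun n => norm_integral_one_sub_exp_le hF hb hL
        (k := (n + 1 : ℝ)) (by positivity) σ) ?_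
      have hn : Tendsto (fun n : ℕ => (n + 1 : ℝ)) atTop atTop :=
        tendsto_atTop_add_const_right _ _ tendsto_natCast_atTop_atTop
      have h1 : Tendsto (fun n : ℕ => Real.exp (Real.exp ((n + 1 : ℝ) * (σ - d)))) atTop
          (𝓝 (Real.exp 0)) :=
        (Real.continuous_exp.tendsto _).comp
          (Real.tendsto_exp_atBot.comp (hn.atTop_mul_const_of_neg (sub_neg.2 hσ.2)))
      simpa using (h1.sub_const 1).const_mul B
    have h0 := tendsto_nhds_unique hlim hzero
    rw [setIntegral_indicator measurableSet_Ioc, inter_eq_right.2 Ioc_subset_Ioi_self] at h0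
    rw [intervalIntegral.integral_of_le hσ.1.le, h0]
  have h1 : deriv (fun σ => ∫ t in (0 : ℝ)..σ, F t) t = F t := hF.deriv_integral F 0 t
  have h2 : (fun σ => ∫ t in (0 : ℝ)..σ, F t) =ᶠ[𝓝 t] fun _ => 0 := by
    filter_upwards [isOpen_Ioo.mem_nhds ht] with σ hσ using key σ hσ
  rw [← h1, h2.deriv_eq, deriv_const]

end Laplace

/-! ### The sine operator, its Laplace transform and the resolvent. -/

section SineOperator

/-- The sine is `1`-Lipschitz and the outer `√r` cancels the `1/√r` in its argument, so the bound is
uniform over the spectrum. -/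
theorem abs_sqrt_mul_sin_sub_le (r s t : ℝ) :
    |√r * Real.sin (t / √r) - √r * Real.sin (s / √r)| ≤ |t - s| := by
  rcases (Real.sqrt_nonneg r).eq_or_lt with h0 | h0
  · simp [← h0]
  · rw [← mul_sub, abs_mul, abs_of_pos h0]
    have h1 : |Real.sin (t / √r) - Real.sin (s / √r)| ≤ |t / √r - s / √r| := by
      have := Real.lipschitzWith_sin.dist_le_mul (t / √r) (s / √r)
      simpa [Real.dist_eq] using this
    calc √r * |Real.sin (t / √r) - Real.sin (s / √r)| ≤ √r * |t / √r - s / √r| := by gcongr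
      _ = |t - s| := by
        rw [← sub_div, abs_div, abs_of_pos h0, mul_div_cancel₀ _ h0.ne']

theorem abs_sqrt_mul_sin_le (r t : ℝ) : |√r * Real.sin (t / √r)| ≤ √r := by
  rw [abs_mul, abs_of_nonneg (Real.sqrt_nonneg r)]
  exact mul_le_of_le_one_right (Real.sqrt_nonneg r) (Real.abs_sin_le_one _)

/-- Where `√r = 0` the bound by `√r` gives continuity. Joint continuity is what lets the functional
calculus pass under the time integral. -/
theorem continuous_sqrt_mul_sin : Continuous fun x : ℝ × ℝ => √x.2 * Real.sin (x.1 / √x.2) := by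
  rw [continuous_iff_continuousAt]
  rintro ⟨t, r⟩
  by_cases hr : √r = 0
  · have h1 : Tendsto (fun x : ℝ × ℝ => √x.2) (𝓝 (t, r)) (𝓝 0) := by
      rw [← hr]
      exact (Real.continuous_sqrt.comp continuous_snd).tendsto (t, r)
    have h0 : √(t, r).2 * Real.sin ((t, r).1 / √(t, r).2) = 0 := by simp [hr]
    rw [ContinuousAt, h0]
    exact squeeze_zero_norm (fun x => abs_sqrt_mul_sin_le x.2 x.1) h1
  · have h1 : ContinuousAt (fun x : ℝ × ℝ => √x.2) (t, r) := by fun_prop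
    exact h1.mul (Real.continuous_sin.continuousAt.comp (continuousAt_fst.div h1 hr))

/-- Imaginary part of the integral of `e^{(-k+iw)t}`. -/
theorem integral_exp_mul_sin {k w : ℝ} (hk : 0 < k) :
    ∫ t in Ioi (0 : ℝ), Real.exp (-k * t) * Real.sin (t * w) = w / (k ^ 2 + w ^ 2) := by
  have ha : ((-k : ℂ) + w * Complex.I).re < 0 := by simpa using hk
  have h1 := integral_exp_mul_complex_Ioi ha 0
  have h2 := congrArg Complex.im h1
  have h3 : ∀ t : ℝ, (Complex.exp (((-k : ℂ) + w * Complex.I) * t)).im =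
      Real.exp (-k * t) * Real.sin (t * w) := by
    intro t
    rw [Complex.exp_im]
    simp [mul_comm]
  have h4 := integral_im (integrableOn_exp_mul_complex_Ioi ha 0)
  simp only [RCLike.im_to_complex, h3] at h4
  rw [h4, h2]
  have hn : Complex.normSq ((-k : ℂ) + w * Complex.I) = k ^ 2 + w ^ 2 := by
    simp [Complex.normSq_apply]; ring
  simp [hn, neg_div]

theorem integral_exp_mul_sqrt_mul_sin {k r : ℝ} (hk : 0 < k) (hr : 0 ≤ r) :
    ∫ t in Ioi (0 : ℝ), Real.exp (-k * t) * (√r * Real.sin (t / √r)) = r / (1 + k ^ 2 * r) := by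
  rcases hr.eq_or_lt with rfl | hr
  · simp
  have h0 : 0 < √r := Real.sqrt_pos.2 hr
  have h1 : ∀ t : ℝ, Real.exp (-k * t) * (√r * Real.sin (t / √r)) =
      √r * (Real.exp (-k * t) * Real.sin (t * (√r)⁻¹)) := fun t => by
    rw [div_eq_mul_inv]; ring
  simp only [h1]
  rw [integral_const_mul, integral_exp_mul_sin hk, inv_pow, Real.sq_sqrt hr.le]
  field_simp
  ring

variable {H : Type*} [NormedAddCommGroup H] [InnerProductSpace ℂ H] [CompleteSpace H]
  {R : H →L[ℂ] H}

theorem continuousOn_sqrt_mul_sin (τ : ℝ) (s : Set ℝ) :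
    ContinuousOn (fun r : ℝ => √r * Real.sin (τ / √r)) s :=
  (continuous_sqrt_mul_sin.comp (Continuous.prodMk_right τ)).continuousOn

theorem norm_sinOfInv_sub_le (s t : ℝ) :
    ‖sinOfInv R t - sinOfInv R s‖ ≤ |t - s| := by
  unfold sinOfInv
  rw [← cfc_sub _ _ R (continuousOn_sqrt_mul_sin _ _) (continuousOn_sqrt_mul_sin _ _)]
  exact norm_cfc_le (abs_nonneg _) fun r _ => abs_sqrt_mul_sin_sub_le r s t

theorem continuous_sinOfInv : Continuous (sinOfInv R) := by
  refine (LipschitzWith.of_dist_le_mul (K := 1) fun s t => ?_).continuous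
  rw [dist_eq_norm, NNReal.coe_one, one_mul, Real.dist_eq]
  exact norm_sinOfInv_sub_le t s

theorem sinOfInv_neg (τ : ℝ) : sinOfInv R (-τ) = -sinOfInv R τ := by
  unfold sinOfInv
  rw [← cfc_neg]
  congr 1
  ext r
  rw [neg_div, Real.sin_neg, mul_neg]

theorem sinOfInv_zero : sinOfInv R 0 = 0 := by
  simp [sinOfInv]

theorem exists_norm_sinOfInv_le (R : H →L[ℂ] H) : ∃ C, ∀ τ, ‖sinOfInv R τ‖ ≤ C := by
  refine ⟨√‖R‖, fun τ => norm_cfc_le (Real.sqrt_nonneg _) fun r hr => ?_⟩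
  refine (abs_sqrt_mul_sin_le r τ).trans (Real.sqrt_le_sqrt ?_)
  have h1 : Nontrivial (H →L[ℂ] H) := by
    by_contra h0
    rw [not_nontrivial_iff_subsingleton] at h0
    rw [spectrum.of_subsingleton] at hr
    exact hr
  exact (le_abs_self r).trans (spectrum.norm_le_norm_of_mem hr)

/-- The resolvent `(A + k²)⁻¹` in terms of `R = A⁻¹`. -/
noncomputable def resolventOfInv (R : H →L[ℂ] H) (k : ℝ) : H →L[ℂ] H :=
  cfc (fun r : ℝ => r / (1 + k ^ 2 * r)) R

theorem spectrum_nonneg_of_isPositive (hR : R.IsPositive) {r : ℝ} (hr : r ∈ spectrum ℝ R) :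
    0 ≤ r :=
  spectrum_nonneg_of_nonneg ((ContinuousLinearMap.nonneg_iff_isPositive R).2 hR) hr

/-- With `r = λ⁻²` this is the scalar identity that `λ⁻¹ sin(λt)` has Laplace transform `1/(λ² +
k²)`, carried to operators by the functional calculus. Positivity of `R` puts the spectrum where the
scalar identity holds. -/
theorem integral_inner_sinOfInv (hR : R.IsPositive) {k : ℝ} (hk : 0 < k) (f g : H) :
    ∫ t in Ioi (0 : ℝ), Real.exp (-k * t) • inner ℂ f (sinOfInv R t g) =
      inner ℂ f (resolventOfInv R k g) := by
  have hsa := hR.isSelfAdjoint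
  have hc : ContinuousOn (Function.uncurry fun t r : ℝ =>
      Real.exp (-k * t) * (√r * Real.sin (t / √r))) (Ioi 0 ×ˢ spectrum ℝ R) := by
    have := continuous_sqrt_mul_sin
    have h2 : Continuous fun x : ℝ × ℝ => Real.exp (-k * x.1) := by fun_prop
    exact (h2.mul this).continuousOn
  have hbd : ∀ᵐ t ∂(volume.restrict (Ioi (0 : ℝ))), ∀ r ∈ spectrum ℝ R,
      ‖Real.exp (-k * t) * (√r * Real.sin (t / √r))‖ ≤ Real.exp (-k * t) * √‖R‖ := by
    refine ae_of_all _ fun t r hr => ?_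
    rw [norm_mul, Real.norm_eq_abs, Real.abs_exp]
    gcongr
    refine (abs_sqrt_mul_sin_le r t).trans (Real.sqrt_le_sqrt ?_)
    have h1 : Nontrivial (H →L[ℂ] H) := by
      by_contra h0
      rw [not_nontrivial_iff_subsingleton] at h0
      rw [spectrum.of_subsingleton] at hr
      exact hr
    exact (le_abs_self r).trans (spectrum.norm_le_norm_of_mem hr)
  have hfin : HasFiniteIntegral (fun t => Real.exp (-k * t) * √‖R‖)
      (volume.restrict (Ioi (0 : ℝ))) :=
    ((integrableOn_exp_mul_Ioi (neg_lt_zero.2 hk) 0).mul_const _).2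
  have h1 := cfc_setIntegral (A := H →L[ℂ] H) (μ := volume) measurableSet_Ioi _ _ R hc hbd hfin hsa
  have hInt := integrableOn_cfc (A := H →L[ℂ] H) (μ := volume) measurableSet_Ioi _ _ R hc hbd hfin hsa
  have h2 : cfc (fun r : ℝ => ∫ t in Ioi (0 : ℝ), Real.exp (-k * t) * (√r * Real.sin (t / √r))) R =
      resolventOfInv R k :=
    cfc_congr fun r hr => integral_exp_mul_sqrt_mul_sin hk (spectrum_nonneg_of_isPositive hR hr)
  have h3 : ∀ t : ℝ, cfc (fun r : ℝ => Real.exp (-k * t) * (√r * Real.sin (t / √r))) R =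
      Real.exp (-k * t) • sinOfInv R t := fun t =>
    cfc_const_mul _ _ R (continuousOn_sqrt_mul_sin _ _)
  rw [h2] at h1
  simp only [h3] at h1 hInt
  rw [h1]
  have h4 := ((innerSL ℂ f).comp (ContinuousLinearMap.apply ℂ H g)).integral_comp_comm hInt
  simpa using h4

/-- Since `R = A⁻¹` factors through the form domain, pulling out one factor `R` exhibits the
resolvent as a weak solution, which can be tested. -/
theorem resolventOfInv_eq (hR : R.IsPositive) (k : ℝ) :
    resolventOfInv R k = R * (1 - (k ^ 2) • resolventOfInv R k) := by
  have hsa := hR.isSelfAdjoint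
  have hpos : ∀ r ∈ spectrum ℝ R, 1 + k ^ 2 * r ≠ 0 := fun r hr => by
    have := spectrum_nonneg_of_isPositive hR hr
    positivity
  have hc : ContinuousOn (fun r : ℝ => r / (1 + k ^ 2 * r)) (spectrum ℝ R) :=
    continuousOn_id.div (by fun_prop) hpos
  have h1 : resolventOfInv R k =
      cfc (fun r : ℝ => r * (1 - k ^ 2 * (r / (1 + k ^ 2 * r)))) R := by
    refine cfc_congr fun r hr => ?_
    have := hpos r hr
    change r / (1 + k ^ 2 * r) = r * (1 - k ^ 2 * (r / (1 + k ^ 2 * r)))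
    rw [div_eq_iff this]
    have h2 : r / (1 + k ^ 2 * r) * (1 + k ^ 2 * r) = r := div_mul_cancel₀ _ this
    linear_combination r * k ^ 2 * h2
  conv_lhs => rw [h1, cfc_mul (fun r : ℝ => r) _ R (by fun_prop) (by fun_prop), cfc_id' ℝ R,
    cfc_sub _ _ R (by fun_prop) (by fun_prop), cfc_const_one ℝ R, cfc_const_mul _ _ R hc]
  rfl

/-- Exponential off-diagonal decay of the resolvents implies finite propagation speed. -/
theorem inner_sinOfInv_eq_zero (hR : R.IsPositive) {f g : H} {B d : ℝ}
    (hL : ∀ k : ℝ, 0 < k → ‖inner ℂ f (resolventOfInv R k g)‖ ≤ B * Real.exp (-k * d))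
    {τ : ℝ} (hτ : |τ| < d) : inner ℂ f (sinOfInv R τ g) = 0 := by
  obtain ⟨C, hC⟩ := exists_norm_sinOfInv_le R
  have hpos : ∀ t ∈ Ioo 0 d, inner ℂ f (sinOfInv R t g) = 0 := by
    intro t ht
    refine eq_zero_of_norm_laplace_le (F := fun t => inner ℂ f (sinOfInv R t g))
      (C := ‖f‖ * (C * ‖g‖)) (B := B) (d := d) ?_ (fun t => ?_) (fun k hk => ?_) ht
    · exact continuous_const.inner ((continuous_sinOfInv (R := R)).clm_apply continuous_const)
    · refine (norm_inner_le_norm _ _).trans ?_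
      gcongr
      exact (sinOfInv R t).le_of_opNorm_le (hC t) g
    · rw [integral_inner_sinOfInv hR hk]
      exact hL k hk
  -- The sine operator is odd in time, so positive times suffice.
  rcases lt_trichotomy τ 0 with h0 | rfl | h0
  · have := hpos (-τ) ⟨neg_pos.2 h0, by rwa [abs_of_neg h0] at hτ⟩
    rw [sinOfInv_neg] at this
    simpa using this
  · simp [sinOfInv_zero]
  · exact hpos τ ⟨h0, by rwa [abs_of_pos h0] at hτ⟩

end SineOperator

/-! ### Linear algebra of the dual metric. -/

section InverseForm

variable {H : Matrix (Fin 3) (Fin 3) ℝ}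

theorem invForm_add_left (a b c : Fin 3 → ℂ) :
    invForm H (a + b) c = invForm H a c + invForm H b c := by
  simp only [invForm, Pi.add_apply, map_add, mul_add, add_mul, Finset.sum_add_distrib]

theorem invForm_add_right (a b c : Fin 3 → ℂ) :
    invForm H a (b + c) = invForm H a b + invForm H a c := by
  simp only [invForm, Pi.add_apply, mul_add, Finset.sum_add_distrib]

theorem invForm_smul_left (z : ℂ) (a b : Fin 3 → ℂ) :
    invForm H (z • a) b = conj z * invForm H a b := by
  simp only [invForm, Pi.smul_apply, smul_eq_mul, map_mul, Finset.mul_sum]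
  exact Finset.sum_congr rfl fun i _ => Finset.sum_congr rfl fun j _ => by ring

theorem invForm_smul_right (z : ℂ) (a b : Fin 3 → ℂ) :
    invForm H a (z • b) = z * invForm H a b := by
  simp only [invForm, Pi.smul_apply, smul_eq_mul, Finset.mul_sum]
  exact Finset.sum_congr rfl fun i _ => Finset.sum_congr rfl fun j _ => by ring

theorem invForm_smul_self (z : ℂ) (a : Fin 3 → ℂ) :
    (invForm H (z • a) (z • a)).re = ‖z‖ ^ 2 * (invForm H a a).re := by
  rw [invForm_smul_left, invForm_smul_right, ← mul_assoc, Complex.conj_mul', ← Complex.ofReal_pow,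
    Complex.re_ofReal_mul]

theorem invForm_add_self_le (hH : H.PosDef) (a b : Fin 3 → ℂ) :
    (invForm H (a + b) (a + b)).re ≤ 2 * (invForm H a a).re + 2 * (invForm H b b).re := by
  have h1 := invForm_self_nonneg hH (a + (-1 : ℂ) • b)
  simp only [invForm_add_left, invForm_add_right, invForm_smul_left, invForm_smul_right, map_neg,
    map_one, neg_mul, one_mul, Complex.add_re, Complex.neg_re] at h1 ⊢
  linarith

/-- The identity behind the exponentially weighted energy estimate. -/
theorem invForm_weighted (hH : H.PosDef) (a p : Fin 3 → ℂ) (z : ℂ) (k : ℝ) :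
    (invForm H a (a + (2 * k * z) • p)).re =
      (invForm H (a + (k * z) • p) (a + (k * z) • p)).re - k ^ 2 * ‖z‖ ^ 2 * (invForm H p p).re := by
  -- By Hermitian symmetry the two cross terms of the square have the same real part, whence the
  -- factor `2` on the left side of the identity.
  have h1 : (invForm H ((k * z) • p) a).re = (k * z * invForm H a p).re := by
    rw [← Complex.conj_re, invForm_symm hH, invForm_smul_right]
  have h2 := invForm_smul_self (H := H) (k * z) p
  rw [norm_mul, Complex.norm_real, Real.norm_eq_abs, mul_pow, sq_abs] at h2
  rw [invForm_add_right, invForm_add_left, invForm_add_right, invForm_add_right,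
    invForm_smul_right, Complex.add_re, Complex.add_re, Complex.add_re, Complex.add_re, h1, h2,
    invForm_smul_right]
  have h3 : (2 * k * z * invForm H a p).re = 2 * (k * z * invForm H a p).re := by
    rw [mul_assoc, mul_assoc, mul_assoc]
    simp
  rw [h3]
  ring

theorem invForm_ofReal (a : Fin 3 → ℝ) :
    (invForm H (fun i => (a i : ℂ)) (fun i => (a i : ℂ))).re = a ⬝ᵥ H⁻¹.mulVec a := by
  simp only [invForm, Complex.re_sum, dotProduct, Matrix.mulVec, Finset.mul_sum]
  refine Finset.sum_congr rfl fun i _ => Finset.sum_congr rfl fun j _ => ?_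
  rw [Complex.conj_ofReal, ← Complex.ofReal_mul, ← Complex.ofReal_mul, Complex.ofReal_re]
  ring

/-- For `v = H⁻¹ a` the hypothesis reads `s² ≤ L s` with `s = aᵀ H⁻¹ a`. -/
theorem dotProduct_inv_le (hH : H.PosDef) (a : Fin 3 → ℝ) {L : ℝ} (hL : 0 ≤ L)
    (ha : ∀ v : Fin 3 → ℝ, (a ⬝ᵥ v) ^ 2 ≤ L * (v ⬝ᵥ H.mulVec v)) : a ⬝ᵥ H⁻¹.mulVec a ≤ L := by
  have h1 := ha (H⁻¹.mulVec a)
  have hu : IsUnit H.det := hH.det_pos.ne'.isUnit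
  rw [Matrix.mulVec_mulVec, Matrix.mul_nonsing_inv _ hu, Matrix.one_mulVec,
    dotProduct_comm (H⁻¹.mulVec a)] at h1
  nlinarith

/-- The discriminant of `s ↦ ⟨H⁻¹a + s v, H(H⁻¹a + s v)⟩ ≥ 0` cannot be positive. -/
theorem sq_dotProduct_le (hH : H.PosDef) (a v : Fin 3 → ℝ) :
    (a ⬝ᵥ v) ^ 2 ≤ (a ⬝ᵥ H⁻¹.mulVec a) * (v ⬝ᵥ H.mulVec v) := by
  have hu : IsUnit H.det := hH.det_pos.ne'.isUnit
  have hHt : H.transpose = H := by simpa using hH.isHermitian.eq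
  have hw : H.mulVec (H⁻¹.mulVec a) = a := by
    rw [Matrix.mulVec_mulVec, Matrix.mul_nonsing_inv _ hu, Matrix.one_mulVec]
  have h2 : (H⁻¹.mulVec a) ⬝ᵥ H.mulVec v = a ⬝ᵥ v := by
    rw [Matrix.dotProduct_mulVec, ← Matrix.mulVec_transpose, hHt, hw]
  have h3 : ∀ s : ℝ, 0 ≤ (v ⬝ᵥ H.mulVec v) * (s * s) + (2 * (a ⬝ᵥ v)) * s +
      a ⬝ᵥ H⁻¹.mulVec a := by
    intro s
    have h4 := hH.posSemidef.dotProduct_mulVec_nonneg (H⁻¹.mulVec a + s • v)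
    simp only [star_trivial, Matrix.mulVec_add, Matrix.mulVec_smul, hw, add_dotProduct,
      dotProduct_add, smul_dotProduct, dotProduct_smul, smul_eq_mul, h2] at h4
    rw [dotProduct_comm (H⁻¹.mulVec a) a, dotProduct_comm v a] at h4
    linarith
  have := discrim_le_zero h3
  rw [discrim] at this
  nlinarith

end InverseForm

/-! ### The norm of a differential, and short functions. -/

section Slope

variable {S : Type*} [TopologicalSpace S] [ChartedSpace E3 S] [IsManifold (𝓡 3) ∞ S]

/-- The differential of a real valued function. -/
noncomputable def realD (f : S → ℝ) (x : S) : TangentSpace (𝓡 3) x →L[ℝ] ℝ :=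
  mfderiv (𝓡 3) 𝓘(ℝ, ℝ) f x

/-- The squared norm of the differential of a real valued function. -/
noncomputable def slopeSq (h : C11Metric S) (f : S → ℝ) (x : S) : ℝ :=
  (invForm (gram h x) (fun i => (realD f x (e3 i) : ℂ)) (fun i => (realD f x (e3 i) : ℂ))).re

variable {h : C11Metric S} {f g : S → ℝ} {x : S}

theorem mfderiv_ofReal_comp (hf : ContMDiff (𝓡 3) 𝓘(ℝ, ℝ) ∞ f) (x : S)
    (v : TangentSpace (𝓡 3) x) :
    (mfderiv (𝓡 3) 𝓘(ℝ, ℂ) (fun y => (f y : ℂ)) x : E3 →L[ℝ] ℂ) v = (realD f x v : ℂ) := by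
  have h1 : MDifferentiableAt (𝓡 3) 𝓘(ℝ, ℝ) f x := hf.mdifferentiableAt (by simp)
  have := (Complex.ofRealCLM.hasMFDerivAt (x := f x)).comp x h1.hasMFDerivAt
  exact congrArg (fun T : E3 →L[ℝ] ℂ => T v) this.mfderiv

theorem contMDiff_ofReal (hf : ContMDiff (𝓡 3) 𝓘(ℝ, ℝ) ∞ f) :
    ContMDiff (𝓡 3) 𝓘(ℝ, ℂ) ∞ fun y => (f y : ℂ) :=
  Complex.ofRealCLM.contMDiff.comp hf

theorem continuous_slopeSq (h : C11Metric S) (hf : ContMDiff (𝓡 3) 𝓘(ℝ, ℝ) ∞ f) :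
    Continuous (slopeSq h f) := by
  refine (Complex.continuous_re.comp
    (continuous_cometric h (contMDiff_ofReal hf) (contMDiff_ofReal hf))).congr fun x => ?_
  exact congrArg (fun a => (invForm (gram h x) a a).re)
    (funext fun i => mfderiv_ofReal_comp hf x (e3 i))

theorem inner_eq_dotProduct (h : C11Metric S) (x : S) (v : E3) :
    h.inner x v v = v.ofLp ⬝ᵥ (gram h x).mulVec v.ofLp := by
  have hv : (v : E3) = ∑ i, v i • e3 i := by
    ext j; rw [sum_smul_e3]
  have key : ∀ B : E3 →L[ℝ] E3 →L[ℝ] ℝ, B v v =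
      v.ofLp ⬝ᵥ (Matrix.of fun i j => B (e3 i) (e3 j)).mulVec v.ofLp := by
    intro B
    conv_lhs => rw [hv]
    simp only [map_sum, map_smul, _root_.sum_apply, _root_.smul_apply, smul_eq_mul, dotProduct,
      Matrix.mulVec, Matrix.of_apply, Finset.mul_sum]
    rw [Finset.sum_comm]
    exact Finset.sum_congr rfl fun i _ => Finset.sum_congr rfl fun j _ => by ring
  exact key (h.inner x)

theorem clm_eq_dotProduct (α : E3 →L[ℝ] ℝ) (v : E3) : α v = (fun i => α (e3 i)) ⬝ᵥ v.ofLp := by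
  have hv : v = ∑ i, v i • e3 i := by
    ext j; rw [sum_smul_e3]
  conv_lhs => rw [hv]
  simp [dotProduct, mul_comm]

theorem slopeSq_eq (h : C11Metric S) (f : S → ℝ) (x : S) :
    slopeSq h f x = (fun i => realD f x (e3 i)) ⬝ᵥ (gram h x)⁻¹.mulVec fun i => realD f x (e3 i) :=
  invForm_ofReal _

theorem slopeSq_nonneg (h : C11Metric S) (f : S → ℝ) (x : S) : 0 ≤ slopeSq h f x :=
  invForm_self_nonneg (gram_posDef h x) _

theorem sq_realD_le (h : C11Metric S) (f : S → ℝ) (x : S) (v : TangentSpace (𝓡 3) x) :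
    realD f x v ^ 2 ≤ slopeSq h f x * h.inner x v v := by
  rw [slopeSq_eq]
  have h1 : realD f x v = (fun i => realD f x (e3 i)) ⬝ᵥ (show E3 from v).ofLp :=
    clm_eq_dotProduct (realD f x) v
  have h2 : h.inner x v v = (show E3 from v).ofLp ⬝ᵥ (gram h x).mulVec (show E3 from v).ofLp :=
    inner_eq_dotProduct h x v
  rw [h1, h2]
  exact sq_dotProduct_le (gram_posDef h x) _ _

/-- Together with `sq_realD_le` this identifies `slopeSq` as the square of the dual norm, the best
constant in the inequality for tangent vectors. -/
theorem slopeSq_le {L : ℝ} (hL : 0 ≤ L)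
    (hf : ∀ v : TangentSpace (𝓡 3) x, realD f x v ^ 2 ≤ L * h.inner x v v) :
    slopeSq h f x ≤ L := by
  rw [slopeSq_eq]
  refine dotProduct_inv_le (gram_posDef h x) _ hL fun v => ?_
  have h1 := clm_eq_dotProduct (realD f x) (WithLp.toLp 2 v)
  have h2 := inner_eq_dotProduct h x (WithLp.toLp 2 v)
  exact (congrArg (· ^ 2) h1).ge.trans ((hf _).trans (congrArg (L * ·) h2).le)

variable (h) in
/-- The smooth functions whose differential has norm at most `1`. -/
structure IsShort (f : S → ℝ) : Prop where
  contMDiff : ContMDiff (𝓡 3) 𝓘(ℝ, ℝ) ∞ f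
  sq_le (x : S) (v : TangentSpace (𝓡 3) x) : realD f x v ^ 2 ≤ h.inner x v v

theorem inner_self_nonneg_tangent (h : C11Metric S) (x : S) (v : TangentSpace (𝓡 3) x) :
    0 ≤ h.inner x v v := by
  rcases eq_or_ne v 0 with rfl | hv
  · simp
  · exact (h.pos x v hv).le

end Slope

/-! ### Multiplication operators on the form domain and on `L²`. -/

section Multiplication

variable {S : Type*} [TopologicalSpace S] [ChartedSpace E3 S] [IsManifold (𝓡 3) ∞ S]
  {h : C11Metric S} {m : ℝ}

/-- Multiplication of smooth functions by a smooth real valued function. -/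
noncomputable def mulCore {ρ : S → ℝ} (hρ : ContMDiff (𝓡 3) 𝓘(ℝ, ℝ) ∞ ρ) :
    FormCore h m →ₗ[ℂ] FormCore h m where
  toFun f := ⟨fun x => (ρ x : ℂ) * f.fn x,
    (contDiff_mul (𝕜 := ℝ) (𝔸 := ℂ)).contMDiff.comp
      ((contMDiff_ofReal hρ).prodMk_space f.contMDiff)⟩
  map_add' _ _ := Subtype.ext (funext fun _ => mul_add _ _ _)
  map_smul' _ _ := Subtype.ext (funext fun _ => mul_left_comm _ _ _)

variable {ρ : S → ℝ} (hρ : ContMDiff (𝓡 3) 𝓘(ℝ, ℝ) ∞ ρ)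

theorem mulCore_fn (f : FormCore h m) (x : S) : (mulCore hρ f).fn x = ρ x * f.fn x := rfl

theorem mulCore_d (f : FormCore h m) (x : S) :
    (fun i => (mulCore hρ f).d x (e3 i)) =
      (ρ x : ℂ) • (fun i => f.d x (e3 i)) + f.fn x • fun i => (realD ρ x (e3 i) : ℂ) := by
  have h1 : MDifferentiableAt (𝓡 3) 𝓘(ℝ, ℂ) f.fn x := f.contMDiff.mdifferentiableAt (by simp)
  have h2 : MDifferentiableAt (𝓡 3) 𝓘(ℝ, ℂ) (fun y => (ρ y : ℂ)) x :=
    (contMDiff_ofReal hρ).mdifferentiableAt (by simp)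
  funext i
  have h3 := (h2.hasMFDerivAt.mul h1.hasMFDerivAt).mfderiv
  have h4 := congrArg (fun T : E3 →L[ℝ] ℂ => T (e3 i)) h3
  have h5 := mfderiv_ofReal_comp hρ x (e3 i)
  refine h4.trans ?_
  exact (congrArg (fun z => (ρ x : ℂ) * f.d x (e3 i) + f.fn x * z) h5)

variable [T2Space S] [CompactSpace S] [MeasurableSpace S] [BorelSpace S]

theorem exists_slopeSq_le (h : C11Metric S) (hρ : ContMDiff (𝓡 3) 𝓘(ℝ, ℝ) ∞ ρ) :
    ∃ C, 0 < C ∧ ∀ x, slopeSq h ρ x ≤ C := by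
  obtain ⟨C, hC⟩ := (isCompact_range (continuous_slopeSq h hρ)).bddAbove
  exact ⟨max C 1, by positivity, fun x => (hC ⟨x, rfl⟩).trans (le_max_left _ _)⟩

theorem exists_abs_le (hρ : Continuous ρ) : ∃ C, 0 < C ∧ ∀ x, |ρ x| ≤ C := by
  obtain ⟨C, hC⟩ := (isCompact_range hρ.abs).bddAbove
  exact ⟨max C 1, by positivity, fun x => (hC ⟨x, rfl⟩).trans (le_max_left _ _)⟩

theorem formDensity_self_eq (f : FormCore h m) (x : S) :
    (formDensity f f x).re = (invForm (gram h x) (fun i => f.d x (e3 i))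
      (fun i => f.d x (e3 i))).re + m ^ 2 * ‖f.fn x‖ ^ 2 := by
  have h2 : ((m : ℂ) ^ 2 * (conj (f.fn x) * f.fn x)).re = m ^ 2 * ‖f.fn x‖ ^ 2 := by
    rw [Complex.conj_mul']
    norm_cast
  rw [formDensity, Complex.add_re, h2]
  rfl

/-- `|d(ρf)|² ≤ 2ρ²|df|² + 2|f|²|dρ|²`, and the mass term absorbs the part without derivatives of
`f`; hence the constant `2 C₁ / m²`. The bound lets multiplication extend to the completion. -/
theorem exists_norm_mulCore_le (hm : 0 < m) :
    ∃ C, ∀ f : FormCore h m, ‖mulCore hρ f‖ ≤ C * ‖f‖ := by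
  obtain ⟨C₁, hC₁, h₁⟩ := exists_slopeSq_le h hρ
  obtain ⟨C₂, hC₂, h₂⟩ := exists_abs_le hρ.continuous
  refine ⟨√(2 * C₂ ^ 2 + 2 * C₁ / m ^ 2), fun f => ?_⟩
  refine le_of_sq_le_sq ?_ (by positivity)
  rw [mul_pow, Real.sq_sqrt (by positivity), FormCore.norm_sq, FormCore.norm_sq,
    ← integral_const_mul]
  refine integral_mono (integrable_formDensity _ _).re
    ((integrable_formDensity f f).re.const_mul _) fun x => ?_
  change (formDensity (mulCore hρ f) (mulCore hρ f) x).re ≤ _ * (formDensity f f x).re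
  rw [formDensity_self_eq, formDensity_self_eq, mulCore_d, mulCore_fn]
  have h3 := invForm_add_self_le (gram_posDef h x) ((ρ x : ℂ) • (fun i => f.d x (e3 i)))
    (f.fn x • fun i => (realD ρ x (e3 i) : ℂ))
  rw [invForm_smul_self, invForm_smul_self] at h3
  have h4 : slopeSq h ρ x = (invForm (gram h x) (fun i => (realD ρ x (e3 i) : ℂ))
    (fun i => (realD ρ x (e3 i) : ℂ))).re := rfl
  rw [← h4, Complex.norm_real] at h3
  have h5 := invForm_self_nonneg (gram_posDef h x) (fun i => f.d x (e3 i))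
  rw [norm_mul, Complex.norm_real, mul_pow]
  set A := (invForm (gram h x) (fun i => f.d x (e3 i)) (fun i => f.d x (e3 i))).re
  have h6 : ‖ρ x‖ ^ 2 ≤ C₂ ^ 2 := by
    gcongr
    exact h₂ x
  have h7 : ‖f.fn x‖ ^ 2 * slopeSq h ρ x ≤ ‖f.fn x‖ ^ 2 * C₁ := by gcongr; exact h₁ x
  have h8 : ‖ρ x‖ ^ 2 * A ≤ C₂ ^ 2 * A := by gcongr
  have h9 : m ^ 2 * (‖ρ x‖ ^ 2 * ‖f.fn x‖ ^ 2) ≤ m ^ 2 * (C₂ ^ 2 * ‖f.fn x‖ ^ 2) := by gcongr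
  have h10 : (2 * C₂ ^ 2 + 2 * C₁ / m ^ 2) * (A + m ^ 2 * ‖f.fn x‖ ^ 2) =
      2 * C₂ ^ 2 * A + 2 * C₂ ^ 2 * (m ^ 2 * ‖f.fn x‖ ^ 2) + 2 * C₁ / m ^ 2 * A +
        2 * C₁ * ‖f.fn x‖ ^ 2 := by
    field_simp
    ring
  have h11 : 0 ≤ 2 * C₁ / m ^ 2 * A := by positivity
  have h12 : 0 ≤ C₂ ^ 2 * (m ^ 2 * ‖f.fn x‖ ^ 2) := by positivity
  rw [h10]
  linarith

theorem isUniformInducing_toComplL :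
    IsUniformInducing (UniformSpace.Completion.toComplL : FormCore h m →L[ℂ] FormDomain h m) :=
  UniformSpace.Completion.isUniformInducing_coe _

theorem denseRange_toComplL :
    DenseRange (UniformSpace.Completion.toComplL : FormCore h m →L[ℂ] FormDomain h m) :=
  UniformSpace.Completion.denseRange_coe

theorem inclL2_coe (hm : 0 < m) (f : FormCore h m) :
    inclL2 h hm (f : FormDomain h m) = toL2Lin h m f :=
  ContinuousLinearMap.extend_eq _ denseRange_toComplL isUniformInducing_toComplL f

theorem exists_mulForm (hm : 0 < m) : ∃ M : FormDomain h m →L[ℂ] FormDomain h m,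
    ∀ f : FormCore h m, M (f : FormDomain h m) = (mulCore hρ f : FormCore h m) := by
  obtain ⟨C, hC⟩ := exists_norm_mulCore_le (h := h) hρ hm
  refine ⟨((UniformSpace.Completion.toComplL : FormCore h m →L[ℂ] FormDomain h m).comp
    ((mulCore hρ).mkContinuous C hC)).extend UniformSpace.Completion.toComplL, fun f => ?_⟩
  exact ContinuousLinearMap.extend_eq _ denseRange_toComplL isUniformInducing_toComplL f

/-- Multiplication by a continuous real valued function on `L²`. -/
noncomputable def mulL2 (h : C11Metric S) (ρ : S → ℝ) (hρ : Continuous ρ) : L2 h →L[ℂ] L2 h :=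
  (ContinuousLinearMap.mul ℂ ℂ).holderL (vol h) ⊤ 2 2
    (ContinuousMap.toLp ⊤ (vol h) ℂ ⟨fun x => (ρ x : ℂ), Complex.continuous_ofReal.comp hρ⟩)

theorem coeFn_mulL2 (hρ : Continuous ρ) (f : L2 h) :
    mulL2 h ρ hρ f =ᵐ[vol h] fun x => ρ x * f x := by
  have h1 := (ContinuousLinearMap.mul ℂ ℂ).coeFn_holder (r := 2) (μ := vol h)
    (ContinuousMap.toLp ⊤ (vol h) ℂ ⟨fun x => (ρ x : ℂ), Complex.continuous_ofReal.comp hρ⟩) f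
  have h2 := ContinuousMap.coeFn_toLp (p := ⊤) (𝕜 := ℂ) (vol h)
    ⟨fun x => (ρ x : ℂ), Complex.continuous_ofReal.comp hρ⟩
  filter_upwards [h1, h2] with x hx1 hx2
  refine hx1.trans ?_
  rw [hx2]
  rfl

theorem mulL2_mulL2 {ρ₁ ρ₂ : S → ℝ} (h₁ : Continuous ρ₁) (h₂ : Continuous ρ₂) (f : L2 h) :
    mulL2 h ρ₁ h₁ (mulL2 h ρ₂ h₂ f) = mulL2 h (ρ₁ * ρ₂) (h₁.mul h₂) f := by
  refine Lp.ext ?_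
  filter_upwards [coeFn_mulL2 h₁ (mulL2 h ρ₂ h₂ f), coeFn_mulL2 h₂ f, coeFn_mulL2 (h₁.mul h₂) f]
    with x hx1 hx2 hx3
  rw [hx1, hx2, hx3, Pi.mul_apply, Complex.ofReal_mul, mul_assoc]

theorem inner_mulL2 (hρ : Continuous ρ) (f g : L2 h) :
    inner ℂ (mulL2 h ρ hρ f) g = inner ℂ f (mulL2 h ρ hρ g) := by
  rw [L2.inner_def, L2.inner_def]
  refine integral_congr_ae ?_
  filter_upwards [coeFn_mulL2 hρ f, coeFn_mulL2 hρ g] with x hx1 hx2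
  rw [hx1, hx2]
  simp only [RCLike.inner_apply, map_mul, Complex.conj_ofReal]
  ring

/-- The bound on `ρ` is required only where `f` does not vanish: this is how supports enter the
exponential estimates. -/
theorem norm_mulL2_le (hρ : Continuous ρ) (f : L2 h) {C : ℝ}
    (hC : ∀ᵐ x ∂(vol h), f x ≠ 0 → |ρ x| ≤ C) : ‖mulL2 h ρ hρ f‖ ≤ C * ‖f‖ := by
  refine Lp.norm_le_mul_norm_of_ae_le_mul ?_
  filter_upwards [coeFn_mulL2 hρ f, hC] with x hx1 hx2
  rw [hx1, norm_mul, Complex.norm_real]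
  by_cases h0 : f x = 0
  · simp [h0]
  · exact mul_le_mul_of_nonneg_right (hx2 h0) (norm_nonneg _)

theorem toL2Lin_mulCore (f : FormCore h m) :
    toL2Lin h m (mulCore hρ f) = mulL2 h ρ hρ.continuous (toL2Lin h m f) := by
  refine Lp.ext ?_
  have h1 := fun f : FormCore h m => ContinuousMap.coeFn_toLp (p := 2) (𝕜 := ℂ) (vol h)
    ⟨f.fn, f.contMDiff.continuous⟩
  filter_upwards [h1 (mulCore hρ f), h1 f, coeFn_mulL2 hρ.continuous (toL2Lin h m f)]
    with x hx1 hx2 hx3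
  exact hx1.trans ((congrArg (fun z => (ρ x : ℂ) * z) hx2.symm).trans hx3.symm)

theorem inner_toL2Lin (f g : FormCore h m) :
    inner ℂ (toL2Lin h m f) (toL2Lin h m g) = ∫ x, conj (f.fn x) * g.fn x ∂(vol h) := by
  refine (ContinuousMap.inner_toLp (vol h) _ _).trans ?_
  exact integral_congr_ae (ae_of_all _ fun x => mul_comm _ _)

end Multiplication

/-! ### Exponentially weighted resolvent estimates. -/

section Resolvent

variable {S : Type*} [TopologicalSpace S] [ChartedSpace E3 S] [IsManifold (𝓡 3) ∞ S]
  [T2Space S] [CompactSpace S] [MeasurableSpace S] [BorelSpace S] {h : C11Metric S} {m : ℝ}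
  {ψ : S → ℝ}

/-- The exponential weight `e^{kψ}`. -/
noncomputable def expWeight (ψ : S → ℝ) (k : ℝ) (x : S) : ℝ := Real.exp (k * ψ x)

theorem contMDiff_expWeight (hψ : ContMDiff (𝓡 3) 𝓘(ℝ, ℝ) ∞ ψ) (k : ℝ) :
    ContMDiff (𝓡 3) 𝓘(ℝ, ℝ) ∞ (expWeight ψ k) :=
  (Real.contDiff_exp.comp (contDiff_const.mul contDiff_id)).contMDiff.comp hψ

theorem realD_expWeight (hψ : ContMDiff (𝓡 3) 𝓘(ℝ, ℝ) ∞ ψ) (k : ℝ) (x : S)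
    (v : TangentSpace (𝓡 3) x) :
    realD (expWeight ψ k) x v = k * expWeight ψ k x * realD ψ x v := by
  have h1 : MDifferentiableAt (𝓡 3) 𝓘(ℝ, ℝ) ψ x := hψ.mdifferentiableAt (by simp)
  have h2 : HasDerivAt (fun t : ℝ => Real.exp (k * t)) (Real.exp (k * ψ x) * (k * 1)) (ψ x) :=
    ((hasDerivAt_id _).const_mul k).exp
  have := (h2.hasFDerivAt.hasMFDerivAt).comp x h1.hasMFDerivAt
  have h3 := congrArg (fun T : E3 →L[ℝ] ℝ => T v) this.mfderiv
  refine h3.trans ?_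
  change realD ψ x v • (Real.exp (k * ψ x) * (k * 1)) = _
  simp only [expWeight, smul_eq_mul]
  ring

/-- As `d(e^{2kψ} f) = e^{2kψ}(df + 2kf dψ)`, completing the square with `invForm_weighted` leaves a
nonnegative term minus `k²|f|²|dψ|²`, and `|dψ| ≤ 1`. -/
theorem re_formDensity_expWeight (hψ : IsShort h ψ) (k : ℝ) (f : FormCore h m) (x : S) :
    m ^ 2 * (expWeight ψ (2 * k) x * ‖f.fn x‖ ^ 2) ≤
      (formDensity f (mulCore (contMDiff_expWeight hψ.contMDiff (2 * k)) f) x).re +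
        k ^ 2 * (expWeight ψ (2 * k) x * ‖f.fn x‖ ^ 2) := by
  set ρ := expWeight ψ (2 * k) with hρ
  have hρ0 : 0 < ρ x := Real.exp_pos _
  set a : Fin 3 → ℂ := fun i => f.d x (e3 i)
  set p : Fin 3 → ℂ := fun i => (realD ψ x (e3 i) : ℂ)
  have hd : (fun i => (mulCore (contMDiff_expWeight hψ.contMDiff (2 * k)) f).d x (e3 i)) =
      (ρ x : ℂ) • (a + (2 * k * f.fn x) • p) := by
    rw [mulCore_d]
    funext i
    have hr : realD (expWeight ψ (2 * k)) x (e3 i) = 2 * k * ρ x * realD ψ x (e3 i) :=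
      realD_expWeight hψ.contMDiff (2 * k) x (e3 i)
    change (ρ x : ℂ) * a i + f.fn x * ((realD (expWeight ψ (2 * k)) x (e3 i) : ℝ) : ℂ) =
      ρ x * (a i + 2 * k * f.fn x * (realD ψ x (e3 i) : ℂ))
    rw [hr]
    push_cast
    ring
  have h1 : (formDensity f (mulCore (contMDiff_expWeight hψ.contMDiff (2 * k)) f) x).re =
      ρ x * (invForm (gram h x) a (a + (2 * k * f.fn x) • p)).re +
        m ^ 2 * (ρ x * ‖f.fn x‖ ^ 2) := by
    have e1 : cometric h x (f.d x) ((mulCore (contMDiff_expWeight hψ.contMDiff (2 * k)) f).d x) =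
        invForm (gram h x) a
          (fun i => (mulCore (contMDiff_expWeight hψ.contMDiff (2 * k)) f).d x (e3 i)) := rfl
    have e2 : (m : ℂ) ^ 2 * (conj (f.fn x) * (ρ x * f.fn x)) =
        ((m ^ 2 * (ρ x * ‖f.fn x‖ ^ 2) : ℝ) : ℂ) := by
      rw [mul_left_comm (conj (f.fn x)), Complex.conj_mul']
      push_cast
      ring
    rw [formDensity, e1, hd, invForm_smul_right, mulCore_fn, e2, Complex.add_re,
      Complex.re_ofReal_mul, Complex.ofReal_re]
  have h2 := invForm_weighted (gram_posDef h x) a p (f.fn x) k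
  have h3 := invForm_self_nonneg (gram_posDef h x) (a + (k * f.fn x) • p)
  have h4 : (invForm (gram h x) p p).re ≤ 1 := 
    slopeSq_le zero_le_one fun v => (hψ.sq_le x v).trans_eq (one_mul _).symm
  rw [h1, h2]
  have h5 : k ^ 2 * ‖f.fn x‖ ^ 2 * (invForm (gram h x) p p).re ≤ k ^ 2 * ‖f.fn x‖ ^ 2 * 1 := by
    gcongr
  nlinarith

/-- Integrate the pointwise bound on smooth functions; both sides are continuous in the form norm,
so density gives the rest. -/
theorem re_inner_expWeight (hm : 0 < m) (hψ : IsShort h ψ) (k : ℝ)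
    {M : FormDomain h m →L[ℂ] FormDomain h m}
    (hM : ∀ f : FormCore h m, M (f : FormDomain h m) =
      (mulCore (contMDiff_expWeight hψ.contMDiff (2 * k)) f : FormCore h m)) (u : FormDomain h m) :
    m ^ 2 * (inner ℂ (inclL2 h hm u) (inclL2 h hm (M u))).re ≤
      (inner ℂ u (M u)).re + k ^ 2 * (inner ℂ (inclL2 h hm u) (inclL2 h hm (M u))).re := by
  induction u using UniformSpace.Completion.induction_on with
  | hp => exact isClosed_le (by fun_prop) (by fun_prop)
  | ih f =>
    rw [hM, inclL2_coe, inclL2_coe, UniformSpace.Completion.inner_coe, inner_toL2Lin]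
    set ρ := expWeight ψ (2 * k)
    set g := mulCore (contMDiff_expWeight hψ.contMDiff (2 * k)) f
    have h1 : inner ℂ f g = ∫ x, formDensity f g x ∂(vol h) := rfl
    have h2 : ∫ x, conj (f.fn x) * g.fn x ∂(vol h) =
        ((∫ x, ρ x * ‖f.fn x‖ ^ 2 ∂(vol h) : ℝ) : ℂ) := by
      rw [← integral_complex_ofReal]
      refine integral_congr_ae (ae_of_all _ fun x => ?_)
      simp only [g, mulCore_fn]
      rw [mul_left_comm, Complex.conj_mul']
      push_cast
      rfl
    have hInt : Integrable (fun x => ρ x * ‖f.fn x‖ ^ 2) (vol h) :=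
      ((contMDiff_expWeight hψ.contMDiff (2 * k)).continuous.mul
        (f.contMDiff.continuous.norm.pow 2)).integrable_of_hasCompactSupport
        (HasCompactSupport.of_compactSpace _)
    have hre : Integrable (fun x => (formDensity f g x).re) (vol h) :=
      (integrable_formDensity f g).re
    have h3 : (∫ x, formDensity f g x ∂(vol h)).re = ∫ x, (formDensity f g x).re ∂(vol h) :=
      (integral_re (integrable_formDensity f g)).symm
    rw [h1, h2, h3, Complex.ofReal_re, ← integral_const_mul, ← integral_const_mul,
      ← integral_add hre (hInt.const_mul _)]
    exact integral_mono (hInt.const_mul _) (hre.add (hInt.const_mul _))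
      fun x => re_formDensity_expWeight hψ k f x

theorem isPositive_invA (hm : 0 < m) : (invA h hm).IsPositive :=
  ContinuousLinearMap.isPositive_self_comp_adjoint _

/-- A Combes–Thomas estimate: the `k²` lost to the gradient of the weight is the `k²` gained from `A
+ k²`, and the mass leaves a constant independent of `k`. -/
theorem norm_expWeight_resolvent_le (hm : 0 < m) (hψ : IsShort h ψ) (k : ℝ) (g : L2 h) :
    m ^ 2 * ‖mulL2 h (expWeight ψ k) (contMDiff_expWeight hψ.contMDiff k).continuous
        (resolventOfInv (invA h hm) k g)‖ ≤
      ‖mulL2 h (expWeight ψ k) (contMDiff_expWeight hψ.contMDiff k).continuous g‖ := by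
  have hw := (contMDiff_expWeight hψ.contMDiff k).continuous
  have hw2 := contMDiff_expWeight hψ.contMDiff (2 * k)
  set v := resolventOfInv (invA h hm) k g with hv
  set W := mulL2 h (expWeight ψ k) hw with hW
  obtain ⟨M, hM⟩ := exists_mulForm (h := h) hw2 hm
  -- The weak solution of `A u = g - k² v`; by `resolventOfInv_eq` its class in `L²` is `v` itself.
  set u : FormDomain h m := ContinuousLinearMap.adjoint (inclL2 h hm) (g - ((k : ℂ) ^ 2) • v) with hu
  have hιu : inclL2 h hm u = v := by
    have h1 := congrArg (fun T : L2 h →L[ℂ] L2 h => T g)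
      (resolventOfInv_eq (isPositive_invA (h := h) hm) k)
    rw [hv, h1]
    have h2 : ((k : ℂ) ^ 2) • v = (k ^ 2 : ℝ) • v := by
      rw [← Complex.ofReal_pow]; exact Complex.coe_smul _ _
    rw [hu, h2]
    rfl
  have hcomm : ∀ u, inclL2 h hm (M u) = mulL2 h _ hw2.continuous (inclL2 h hm u) := by
    intro u
    induction u using UniformSpace.Completion.induction_on with
    | hp => exact isClosed_eq (by fun_prop) (by fun_prop)
    | ih f => rw [hM, inclL2_coe, inclL2_coe, toL2Lin_mulCore]
  have hsq : ∀ f, mulL2 h _ hw2.continuous f = W (W f) := by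
    intro f
    rw [hW, mulL2_mulL2]
    have : expWeight ψ (2 * k) = expWeight ψ k * expWeight ψ k := by
      funext x
      rw [Pi.mul_apply, expWeight, expWeight, ← Real.exp_add]
      ring_nf
    simp only [this]
  have hself : ∀ f f', inner ℂ f (W (W f')) = inner ℂ (W f) (W f') := fun f f' =>
    (inner_mulL2 hw f (W f')).symm
  have key := re_inner_expWeight hm hψ k hM u
  -- The weak equation tested against `e^{2kψ} u`, the weight being shared equally between the two
  -- factors.
  have h1 : inner ℂ u (M u) = inner ℂ (W g) (W v) - (k : ℂ) ^ 2 * inner ℂ (W v) (W v) := by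
    conv_lhs => rw [hu]
    rw [ContinuousLinearMap.adjoint_inner_left, ← hu, hcomm, hιu, hsq, inner_sub_left, hself,
      inner_smul_left, hself]
    simp
  rw [h1, hcomm, hιu, hsq, hself, inner_self_eq_norm_sq_to_K] at key
  have h2 : ((k : ℂ) ^ 2 * ((‖W v‖ : ℝ) : ℂ) ^ 2).re = k ^ 2 * ‖W v‖ ^ 2 := by norm_cast
  have h3 : ((‖W v‖ : ℂ) ^ 2).re = ‖W v‖ ^ 2 := by norm_cast
  have h4 : (inner ℂ (W g) (W v)).re ≤ ‖W g‖ * ‖W v‖ :=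
    (Complex.re_le_norm _).trans (norm_inner_le_norm _ _)
  change m ^ 2 * ((‖W v‖ : ℂ) ^ 2).re ≤
    (inner ℂ (W g) (W v) - (k : ℂ) ^ 2 * ((‖W v‖ : ℝ) : ℂ) ^ 2).re +
      k ^ 2 * ((‖W v‖ : ℂ) ^ 2).re at key
  rw [Complex.sub_re, h2, h3] at key
  rcases (norm_nonneg (W v)).eq_or_lt with h0 | h0
  · rw [← h0, mul_zero]; exact norm_nonneg _
  · refine le_of_mul_le_mul_right ?_ h0
    nlinarith

/-- Finite propagation speed. -/
theorem inner_sinOp_eq_zero (hm : 0 < m) (hψ : IsShort h ψ) {a b τ : ℝ} (hτ : |τ| < b - a)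
    {f g : L2 h} (hf : ∀ᵐ x ∂(vol h), f x ≠ 0 → b ≤ ψ x)
    (hg : ∀ᵐ x ∂(vol h), g x ≠ 0 → ψ x ≤ a) : inner ℂ f (sinOp h hm τ g) = 0 := by
  refine inner_sinOfInv_eq_zero (isPositive_invA hm) (B := m⁻¹ ^ 2 * (‖f‖ * ‖g‖))
    (fun k hk => ?_) hτ
  have hw := fun k => (contMDiff_expWeight hψ.contMDiff k).continuous
  set v := resolventOfInv (invA h hm) k g
  have h1 : mulL2 h _ (hw (-k)) (mulL2 h _ (hw k) v) = v := by
    rw [mulL2_mulL2]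
    refine Lp.ext ?_
    filter_upwards [coeFn_mulL2 ((hw (-k)).mul (hw k)) v] with x hx
    rw [hx, Pi.mul_apply, expWeight, expWeight, ← Real.exp_add]
    simp
  have h2 : ‖mulL2 h _ (hw (-k)) f‖ ≤ Real.exp (-k * b) * ‖f‖ := by
    refine norm_mulL2_le _ _ ?_
    filter_upwards [hf] with x hx h0
    rw [expWeight, Real.abs_exp, Real.exp_le_exp]
    nlinarith [hx h0]
  have h3 : ‖mulL2 h _ (hw k) g‖ ≤ Real.exp (k * a) * ‖g‖ := by
    refine norm_mulL2_le _ _ ?_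
    filter_upwards [hg] with x hx h0
    rw [expWeight, Real.abs_exp, Real.exp_le_exp]
    nlinarith [hx h0]
  have h4 : ‖mulL2 h _ (hw k) v‖ ≤ m⁻¹ ^ 2 * (Real.exp (k * a) * ‖g‖) := by
    rw [inv_pow, inv_mul_eq_div, le_div_iff₀' (by positivity)]
    exact (norm_expWeight_resolvent_le hm hψ k g).trans h3
  -- Insert `e^{-kψ} e^{kψ}`: the decaying factor falls on `f`, where `ψ ≥ b`, and the growing one
  -- on the resolvent, which is controlled by `g`, where `ψ ≤ a`.
  rw [← h1, ← inner_mulL2]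
  calc _ ≤ ‖mulL2 h _ (hw (-k)) f‖ * ‖mulL2 h _ (hw k) v‖ := norm_inner_le_norm _ _
    _ ≤ (Real.exp (-k * b) * ‖f‖) * (m⁻¹ ^ 2 * (Real.exp (k * a) * ‖g‖)) := by gcongr
    _ = m⁻¹ ^ 2 * (‖f‖ * ‖g‖) * (Real.exp (-k * b) * Real.exp (k * a)) := by ring
    _ = _ := by rw [← Real.exp_add]; ring_nf

end Resolvent

/-! ### Summation over an orthonormal basis. -/

section Trace

variable {H : Type*} [NormedAddCommGroup H] [InnerProductSpace ℂ H]

/-- Distinct basis vectors are `√2` apart, so balls of radius `1/2` around them are disjoint.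
Countability is needed to exchange the sum over the basis with integrals. -/
theorem countable_of_hilbertBasis [SecondCountableTopology H] {ι : Type*}
    (b : HilbertBasis ι ℂ H) : Countable ι := by
  have hd : ∀ i j, i ≠ j → Disjoint (Metric.ball (b i) (1 / 2)) (Metric.ball (b j) (1 / 2)) := by
    intro i j hij
    refine Metric.ball_disjoint_ball ?_
    have h1 : ‖b i - b j‖ ^ 2 = 2 := by
      have := b.orthonormal.2 hij
      rw [@norm_sub_sq ℂ, this, b.orthonormal.1 i, b.orthonormal.1 j]
      norm_num
    rw [dist_eq_norm]
    nlinarith [norm_nonneg (b i - b j)]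
  exact Pairwise.countable_of_isOpen_disjoint (s := fun i => Metric.ball (b i) (1 / 2)) hd
    (fun i => Metric.isOpen_ball) fun i => ⟨b i, Metric.mem_ball_self (by norm_num)⟩

/-- The trace of an integral of operators of rank one. -/
theorem tsum_integral_inner_mul_inner [CompleteSpace H] {ι X : Type*} [Countable ι]
    [MeasurableSpace X] (μ : Measure X) (b : HilbertBasis ι ℂ H) (T : X → H →L[ℂ] H) (g θ : X → H)
    {K : Set X} (hK : MeasurableSet K) (hμ : μ K ≠ ⊤) {C : ℝ}
    (hg : ∀ x ∉ K, g x = 0) (hT : ∀ x, ‖ContinuousLinearMap.adjoint (T x) (g x)‖ ≤ C)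
    (hθ : ∀ x, ‖θ x‖ ≤ C)
    (hmeas : ∀ k, AEStronglyMeasurable
      (fun x => inner ℂ (g x) (T x (b k)) * inner ℂ (b k) (θ x)) μ) :
    ∑' k, ∫ x, inner ℂ (g x) (T x (b k)) * inner ℂ (b k) (θ x) ∂μ =
      ∫ x, inner ℂ (g x) (T x (θ x)) ∂μ := by
  rw [← integral_tsum hmeas]
  · refine integral_congr_ae (ae_of_all _ fun x => ?_)
    -- Parseval's identity for `T(x)* g(x)` and `θ(x)`.
    have := (b.hasSum_inner_mul_inner (ContinuousLinearMap.adjoint (T x) (g x)) (θ x)).tsum_eq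
    simpa only [ContinuousLinearMap.adjoint_inner_left] using this
  -- Absolute convergence: `|αβ| ≤ (|α|² + |β|²)/2` and Bessel's inequality bound the sum by `C²`,
  -- on a set of finite measure.
  · have hC : ∀ x, ∑' k, ‖inner ℂ (g x) (T x (b k)) * inner ℂ (b k) (θ x)‖ₑ ≤
        K.indicator (fun _ => ENNReal.ofReal (C ^ 2)) x := by
      intro x
      by_cases hx : x ∈ K
      · rw [indicator_of_mem hx, ENNReal.tsum_eq_iSup_sum]
        refine iSup_le fun s => ?_
        simp only [← ofReal_norm]
        rw [← ENNReal.ofReal_sum_of_nonneg fun _ _ => norm_nonneg _]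
        refine ENNReal.ofReal_le_ofReal ?_
        have h1 := b.orthonormal.sum_inner_products_le
          (ContinuousLinearMap.adjoint (T x) (g x)) (s := s)
        have h2 := b.orthonormal.sum_inner_products_le (θ x) (s := s)
        have h3 : ∀ k, ‖inner ℂ (g x) (T x (b k)) * inner ℂ (b k) (θ x)‖ ≤
            (‖inner ℂ (b k) (ContinuousLinearMap.adjoint (T x) (g x))‖ ^ 2 +
              ‖inner ℂ (b k) (θ x)‖ ^ 2) / 2 := by
          intro k
          rw [norm_mul, ← ContinuousLinearMap.adjoint_inner_left, norm_inner_symm]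
          nlinarith [sq_nonneg (‖inner ℂ (b k) (ContinuousLinearMap.adjoint (T x) (g x))‖ -
            ‖inner ℂ (b k) (θ x)‖)]
        refine (Finset.sum_le_sum fun k _ => h3 k).trans ?_
        rw [← Finset.sum_div, Finset.sum_add_distrib]
        have h4 : ‖ContinuousLinearMap.adjoint (T x) (g x)‖ ^ 2 ≤ C ^ 2 := by
          gcongr; exact hT x
        have h5 : ‖θ x‖ ^ 2 ≤ C ^ 2 := by gcongr; exact hθ x
        linarith
      · simp [hg x hx]
    rw [← lintegral_tsum fun k => (hmeas k).enorm]
    refine ((lintegral_mono hC).trans_lt ?_).ne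
    rw [lintegral_indicator hK, setLIntegral_const]
    exact ENNReal.mul_lt_top ENNReal.ofReal_lt_top hμ.lt_top

theorem integral_mul_integral_swap {X Z : Type*} [MeasurableSpace X] [MeasurableSpace Z]
    {μ : Measure X} {ν : Measure Z} [SFinite μ] [SFinite ν] {f : X → ℂ} (hf : Integrable f μ)
    {Φ : Z × X → ℂ} (hΦ : AEStronglyMeasurable Φ (ν.prod μ)) {K : Set Z} (hK : MeasurableSet K)
    (hν : ν K ≠ ⊤) {C : ℝ} (hC : ∀ p, ‖Φ p‖ ≤ K.indicator (fun _ => C) p.1) :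
    ∫ x, f x * ∫ z, Φ (z, x) ∂ν ∂μ = ∫ z, ∫ x, f x * Φ (z, x) ∂μ ∂ν := by
  simp only [← integral_const_mul]
  refine integral_integral_swap ?_
  have h1 : Integrable (fun p : X × Z => f p.1 * K.indicator (fun _ => (C : ℂ)) p.2) (μ.prod ν) :=
    hf.mul_prod ((integrable_indicator_iff hK).2 (integrableOn_const hν))
  refine h1.mono (hf.1.comp_fst.mul hΦ.prod_swap) (ae_of_all _ fun p => ?_)
  simp only [Function.uncurry, norm_mul]
  gcongr
  refine (hC (p.2, p.1)).trans ?_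
  by_cases hp : p.2 ∈ K
  · simpa [hp] using le_abs_self C
  · simp [hp]

end Trace

/-! ### Partial derivatives with parameters in a manifold. -/

section PartialDerivatives

variable {F G N : Type*} [NormedAddCommGroup F] [NormedSpace ℝ F] [TopologicalSpace G]
  {J : ModelWithCorners ℝ F G} [TopologicalSpace N] [ChartedSpace G N] [IsManifold J 1 N]

/-- The derivative in the direction `e3 i` of the second variable. -/
noncomputable def partialD (i : Fin 3) (u : N × E3 → ℂ) (p : N × E3) : ℂ :=
  fderiv ℝ (fun z => u (p.1, z)) p.2 (e3 i)

/-- Smoothness holds jointly with the parameter. In the model space the changes of tangent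
coordinates are trivial, so the manifold statement speaks of `fderiv` itself. -/
theorem contMDiff_partialD {u : N × E3 → ℂ} (hu : ContMDiff (J.prod 𝓘(ℝ, E3)) 𝓘(ℝ, ℂ) ∞ u)
    (i : Fin 3) : ContMDiff (J.prod 𝓘(ℝ, E3)) 𝓘(ℝ, ℂ) ∞ (partialD i u) := by
  intro p
  have h1 : ContMDiffAt ((J.prod 𝓘(ℝ, E3)).prod 𝓘(ℝ, E3)) 𝓘(ℝ, ℂ) ∞
      (Function.uncurry fun (q : N × E3) (z : E3) => u (q.1, z)) (p, p.2) :=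
    (hu.comp ((contMDiff_fst.comp contMDiff_fst).prodMk contMDiff_snd)).contMDiffAt
  have h2 := ContMDiffAt.mfderiv (J := J.prod 𝓘(ℝ, E3)) (I := 𝓘(ℝ, E3)) (I' := 𝓘(ℝ, ℂ))
    (m := ∞) (n := ∞) (fun (q : N × E3) (z : E3) => u (q.1, z)) (fun q => q.2) h1
    contMDiff_snd.contMDiffAt (by simp)
  have h5 := inTangentCoordinates_model_space (I := 𝓘(ℝ, E3)) (I' := 𝓘(ℝ, ℂ))
    (fun q : N × E3 => q.2) (fun q => u (q.1, q.2))
    (fun q => fderiv ℝ (fun z => u (q.1, z)) q.2) p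
  simp only [mfderiv_eq_fderiv] at h2
  replace h2 := h5 ▸ h2
  have h3 : ContMDiff 𝓘(ℝ, E3 →L[ℝ] ℂ) 𝓘(ℝ, ℂ) ∞ fun L : E3 →L[ℝ] ℂ => L (e3 i) :=
    (ContinuousLinearMap.apply ℝ ℂ (e3 i)).contMDiff
  have h4 := h3.contMDiffAt.comp p h2
  refine h4.congr_of_eventuallyEq (Eventually.of_forall fun q => ?_)
  rfl

theorem partialD_eq_zero {u : N × E3 → ℂ} {K : Set (N × E3)} (hK : IsClosed K)
    (hu : ∀ p ∉ K, u p = 0) (i : Fin 3) : ∀ p ∉ K, partialD i u p = 0 := by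
  intro p hp
  have h1 : (fun z => u (p.1, z)) =ᶠ[𝓝 p.2] fun _ => 0 := by
    have h2 : Tendsto (fun z => (p.1, z)) (𝓝 p.2) (𝓝 (p.1, p.2)) :=
      (Continuous.prodMk_right p.1).tendsto p.2
    filter_upwards [h2 (hK.isOpen_compl.mem_nhds hp)] with z hz using hu _ hz
  rw [partialD, h1.fderiv_eq]
  simp

theorem contDiff_slice {u : N × E3 → ℂ} (hu : ContMDiff (J.prod 𝓘(ℝ, E3)) 𝓘(ℝ, ℂ) ∞ u) (n : N) :
    ContDiff ℝ ∞ fun z => u (n, z) :=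
  (hu.comp (contMDiff_const.prodMk contMDiff_id)).contDiff

/-- The fundamental theorem of calculus on a coordinate line. -/
theorem integral_partialD {u : N × E3 → ℂ} (hu : ContMDiff (J.prod 𝓘(ℝ, E3)) 𝓘(ℝ, ℂ) ∞ u)
    {K : Set (N × E3)} (hK : IsCompact K) (hKu : ∀ p ∉ K, u p = 0) (i : Fin 3) (n : N) (r : E3)
    (y : ℝ) : ∫ a in Iic y, partialD i u (n, r + a • e3 i) = u (n, r + y • e3 i) := by
  have hd : ∀ a, deriv (fun a : ℝ => u (n, r + a • e3 i)) a = partialD i u (n, r + a • e3 i) := by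
    intro a
    have h1 : HasFDerivAt (fun z => u (n, z)) (fderiv ℝ (fun z => u (n, z)) (r + a • e3 i))
        (r + a • e3 i) :=
      ((contDiff_slice hu n).differentiable (by simp)).differentiableAt.hasFDerivAt
    have h2 : HasDerivAt (fun a : ℝ => r + a • e3 i) ((1 : ℝ) • e3 i) a :=
      ((hasDerivAt_id a).smul_const (e3 i)).const_add r
    have := h1.comp_hasDerivAt a h2
    rw [one_smul] at this
    exact this.deriv
  simp only [← hd]
  refine HasCompactSupport.integral_Iic_deriv_eq (f := fun a : ℝ => u (n, r + a • e3 i)) ?_ ?_ y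
  · exact ((contDiff_slice hu n).of_le (by simp)).comp
      (contDiff_const.add (contDiff_id.smul contDiff_const))
  -- The point `r + a e_i` has `i`-th coordinate `r i + a`, hence the shift by `r i`.
  · refine HasCompactSupport.intro
      (K := (fun z : E3 => z i - r i) '' (Prod.snd '' K)) ?_ fun a ha => hKu _ fun hmem => ha ?_
    · exact (hK.image continuous_snd).image (by fun_prop)
    · exact ⟨_, ⟨_, hmem, rfl⟩, by simp⟩

end PartialDerivatives

/-! ### Functions as integrals of their mixed third derivative over octants. -/

section Superposition

/-- The point of `ℝ³` with given coordinates. -/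
noncomputable def ofCoords (r : ℝ × ℝ × ℝ) : E3 := r.1 • e3 0 + r.2.1 • e3 1 + r.2.2 • e3 2

/-- The coordinates of a point of `ℝ³`. -/
def toCoords (z : E3) : ℝ × ℝ × ℝ := (z 0, z 1, z 2)

theorem continuous_ofCoords : Continuous ofCoords := by
  unfold ofCoords
  fun_prop

theorem continuous_toCoords : Continuous toCoords := by
  unfold toCoords
  fun_prop

theorem toCoords_ofCoords (r : ℝ × ℝ × ℝ) : toCoords (ofCoords r) = r := by
  simp [toCoords, ofCoords]

theorem ofCoords_toCoords (z : E3) : ofCoords (toCoords z) = z := by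
  ext i
  fin_cases i <;> simp [toCoords, ofCoords]

/-- The octant below a point. -/
def lowerOctant (r : ℝ × ℝ × ℝ) : Set (ℝ × ℝ × ℝ) := Iic r.1 ×ˢ (Iic r.2.1 ×ˢ Iic r.2.2)

theorem measurableSet_lowerOctant (r : ℝ × ℝ × ℝ) : MeasurableSet (lowerOctant r) :=
  measurableSet_Iic.prod (measurableSet_Iic.prod measurableSet_Iic)

variable {F G N : Type*} [NormedAddCommGroup F] [NormedSpace ℝ F] [TopologicalSpace G]
  {J : ModelWithCorners ℝ F G} [TopologicalSpace N] [ChartedSpace G N] [IsManifold J 1 N]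

/-- The mixed third derivative `∂₀∂₁∂₂` in the second variable. -/
noncomputable def mixedD (u : N × E3 → ℂ) : N × E3 → ℂ := partialD 2 (partialD 1 (partialD 0 u))

theorem contMDiff_mixedD {u : N × E3 → ℂ} (hu : ContMDiff (J.prod 𝓘(ℝ, E3)) 𝓘(ℝ, ℂ) ∞ u) :
    ContMDiff (J.prod 𝓘(ℝ, E3)) 𝓘(ℝ, ℂ) ∞ (mixedD u) :=
  contMDiff_partialD (contMDiff_partialD (contMDiff_partialD hu 0) 1) 2

theorem mixedD_eq_zero {u : N × E3 → ℂ} {K : Set (N × E3)} (hK : IsClosed K)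
    (hu : ∀ p ∉ K, u p = 0) : ∀ p ∉ K, mixedD u p = 0 :=
  partialD_eq_zero hK (partialD_eq_zero hK (partialD_eq_zero hK hu 0) 1) 2

/-- Fubini and three applications of the fundamental theorem of calculus. The innermost integral
undoes `∂₂`, the derivative taken last. -/
theorem setIntegral_lowerOctant_mixedD [T2Space N] {u : N × E3 → ℂ}
    (hu : ContMDiff (J.prod 𝓘(ℝ, E3)) 𝓘(ℝ, ℂ) ∞ u) {K : Set (N × E3)} (hK : IsCompact K)
    (hKu : ∀ p ∉ K, u p = 0) (n : N) (r : ℝ × ℝ × ℝ) :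
    ∫ z in lowerOctant r, mixedD u (n, ofCoords z) = u (n, ofCoords r) := by
  have hInt : Integrable fun z => mixedD u (n, ofCoords z) := by
    refine Continuous.integrable_of_hasCompactSupport ?_ ?_
    · exact (contMDiff_mixedD hu).continuous.comp (continuous_const.prodMk continuous_ofCoords)
    · refine HasCompactSupport.intro (K := toCoords '' (Prod.snd '' K))
        ((hK.image continuous_snd).image continuous_toCoords) fun z hz => ?_
      refine mixedD_eq_zero hK.isClosed hKu _ fun hmem => hz ?_
      exact ⟨_, ⟨_, hmem, rfl⟩, toCoords_ofCoords z⟩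
  have h0 := partialD_eq_zero hK.isClosed hKu 0
  have h1 := partialD_eq_zero hK.isClosed h0 1
  have s0 := contMDiff_partialD hu 0
  have s1 := contMDiff_partialD s0 1
  have e2 : ∀ a b : ℝ, ∫ c in Iic r.2.2, mixedD u (n, ofCoords (a, b, c)) =
      partialD 1 (partialD 0 u) (n, a • e3 0 + r.2.2 • e3 2 + b • e3 1) := by
    intro a b
    rw [add_right_comm]
    exact integral_partialD s1 hK h1 2 n (a • e3 0 + b • e3 1) r.2.2
  have e1 : ∀ a : ℝ, ∫ b in Iic r.2.1,
      partialD 1 (partialD 0 u) (n, a • e3 0 + r.2.2 • e3 2 + b • e3 1) =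
      partialD 0 u (n, r.2.1 • e3 1 + r.2.2 • e3 2 + a • e3 0) := by
    intro a
    rw [integral_partialD s0 hK h0 1 n _ r.2.1]
    congr 2
    abel
  have e0 : ∫ a in Iic r.1, partialD 0 u (n, r.2.1 • e3 1 + r.2.2 • e3 2 + a • e3 0) =
      u (n, ofCoords r) := by
    rw [integral_partialD hu hK hKu 0 n _ r.1]
    congr 2
    rw [ofCoords]
    abel
  rw [← e0]
  simp only [← e1, ← e2]
  rw [lowerOctant, Measure.volume_eq_prod, setIntegral_prod _ hInt.integrableOn]
  have hae := hInt.prod_right_ae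
  refine integral_congr_ae (ae_restrict_of_ae ?_)
  filter_upwards [hae] with a ha
  rw [Measure.volume_eq_prod]
  exact setIntegral_prod _ ha.integrableOn

end Superposition

/-! ### Test functions as superpositions of products. -/

section ChartPull

variable {S : Type*} [TopologicalSpace S] [ChartedSpace E3 S] [IsManifold (𝓡 3) ∞ S]

open Classical in
/-- A function on `M × M`, with the last variable read in the chart around `c`. -/
noncomputable def chartPull (c : S) (w : (ℝ × S) × (ℝ × S) → ℂ) (p : ((ℝ × S) × ℝ) × E3) : ℂ :=
  if p.2 ∈ (extChartAt (𝓡 3) c).target then w (p.1.1, (p.1.2, (extChartAt (𝓡 3) c).symm p.2))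
  else 0

/-- The support of `w`, with the last variable read in the chart around `c`. -/
def chartSupport (c : S) (w : (ℝ × S) × (ℝ × S) → ℂ) : Set (((ℝ × S) × ℝ) × E3) :=
  (fun r : (ℝ × S) × (ℝ × S) => ((r.1, r.2.1), extChartAt (𝓡 3) c r.2.2)) '' tsupport w

variable {c : S} {w : (ℝ × S) × (ℝ × S) → ℂ}

theorem isCompact_chartSupport (hw : HasCompactSupport w)
    (hc : ∀ r ∈ tsupport w, r.2.2 ∈ (extChartAt (𝓡 3) c).source) :
    IsCompact (chartSupport c w) := by
  refine IsCompact.image_of_continuousOn hw ?_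
  refine ContinuousOn.prodMk (by fun_prop) ?_
  exact (continuousOn_extChartAt c).comp (by fun_prop) hc

theorem chartPull_eq_zero : ∀ p ∉ chartSupport c w, chartPull c w p = 0 := by
  intro p hp
  by_contra h0
  refine hp ?_
  unfold chartPull at h0
  split_ifs at h0 with ht
  · exact ⟨_, subset_tsupport w h0, 
      Prod.ext rfl ((extChartAt (𝓡 3) c).right_inv ht)⟩
  · exact absurd rfl h0

/-- The extension by zero is smooth because the support, read in the chart, is compact, hence
closed, and contained in the chart's target. -/
theorem contMDiff_chartPull [T2Space S] (hw : IsTest (IM.prod IM) w)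
    (hc : ∀ r ∈ tsupport w, r.2.2 ∈ (extChartAt (𝓡 3) c).source) :
    ContMDiff ((IM.prod 𝓘(ℝ, ℝ)).prod 𝓘(ℝ, E3)) 𝓘(ℝ, ℂ) ∞ (chartPull c w) := by
  intro p
  by_cases ht : p.2 ∈ (extChartAt (𝓡 3) c).target
  · have hopen : IsOpen (extChartAt (𝓡 3) c).target := isOpen_extChartAt_target c
    have h1 : ContMDiffAt 𝓘(ℝ, E3) (𝓡 3) ∞ (extChartAt (𝓡 3) c).symm p.2 :=
      (contMDiffOn_extChartAt_symm c).contMDiffAt (hopen.mem_nhds ht)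
    have h2 : ContMDiffAt ((IM.prod 𝓘(ℝ, ℝ)).prod 𝓘(ℝ, E3)) (IM.prod IM) ∞
        (fun p : ((ℝ × S) × ℝ) × E3 =>
          (p.1.1, (p.1.2, (extChartAt (𝓡 3) c).symm p.2))) p := by
      have hfst : ContMDiffAt ((IM.prod 𝓘(ℝ, ℝ)).prod 𝓘(ℝ, E3)) (IM.prod 𝓘(ℝ, ℝ)) ∞
        (fun p : ((ℝ × S) × ℝ) × E3 => p.1) p := contMDiffAt_fst
      exact (contMDiffAt_fst.comp p hfst).prodMk
        ((contMDiffAt_snd.comp p hfst).prodMk (h1.comp p contMDiffAt_snd))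
    refine (hw.contMDiff.contMDiffAt.comp p h2).congr_of_eventuallyEq ?_
    filter_upwards [(hopen.preimage continuous_snd).mem_nhds ht] with q hq
    exact if_pos hq
  · have hK := (isCompact_chartSupport hw.hasCompactSupport hc).isClosed
    have hp : p ∉ chartSupport c w := by
      rintro ⟨r, hr, rfl⟩
      exact ht ((extChartAt (𝓡 3) c).map_source (hc r hr))
    refine (contMDiffAt_const (c := (0 : ℂ))).congr_of_eventuallyEq ?_
    filter_upwards [hK.isOpen_compl.mem_nhds hp] with q hq using chartPull_eq_zero q hq

/-- The pairs of a point of `O` and of a triple of reals below its coordinates. -/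
def belowSet (c : S) (O : Set S) : Set ((ℝ × ℝ × ℝ) × S) :=
  {p | p.2 ∈ O ∧ p.1 ∈ lowerOctant (toCoords (extChartAt (𝓡 3) c p.2))}

/-- Every test function is a superposition of products. -/
theorem integral_mixedD_chartPull [T2Space S] (hw : IsTest (IM.prod IM) w)
    {O : Set S} (hO : O ⊆ (extChartAt (𝓡 3) c).source) (hcO : ∀ r ∈ tsupport w, r.2.2 ∈ O) (p : ℝ × S) (q : ℝ × S) :
    ∫ r, mixedD (chartPull c w) ((p, q.1), ofCoords r) *
      (belowSet c O).indicator (fun _ => (1 : ℂ)) (r, q.2) = w (p, q) := by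
  have hc := fun r hr => hO (hcO r hr)
  by_cases hq : q.2 ∈ O
  · have h1 := setIntegral_lowerOctant_mixedD (contMDiff_chartPull hw hc)
      (isCompact_chartSupport hw.hasCompactSupport hc) chartPull_eq_zero (p, q.1)
      (toCoords (extChartAt (𝓡 3) c q.2))
    rw [ofCoords_toCoords] at h1
    have h2 : chartPull c w ((p, q.1), extChartAt (𝓡 3) c q.2) = w (p, q) := by
      simp only [chartPull]
      rw [if_pos ((extChartAt (𝓡 3) c).map_source (hO hq)), (extChartAt (𝓡 3) c).left_inv (hO hq)]
    rw [← h2, ← h1, ← integral_indicator (measurableSet_lowerOctant _)]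
    refine integral_congr_ae (ae_of_all _ fun r => ?_)
    by_cases hr : r ∈ lowerOctant (toCoords (extChartAt (𝓡 3) c q.2))
    · have : (r, q.2) ∈ belowSet c O := ⟨hq, hr⟩
      beta_reduce
      rw [indicator_of_mem hr, indicator_of_mem this, mul_one]
    · have : (r, q.2) ∉ belowSet c O := fun h => hr h.2
      beta_reduce
      rw [indicator_of_notMem hr, indicator_of_notMem this, mul_zero]
  · have h1 : w (p, q) = 0 := by
      by_contra h0
      exact hq (hcO _ (subset_tsupport w h0))
    have h2 : ∀ r, (r, q.2) ∉ belowSet c O := fun r h => hq h.1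
    simp [h1, h2]

/-- Coordinates are continuous only on the chart domain; continued by zero off `O` they are
measurable, and the set is cut out by three inequalities. -/
theorem measurableSet_belowSet [MeasurableSpace S] [BorelSpace S] [SecondCountableTopology S]
    {c : S} {O : Set S} (hO : O ⊆ (extChartAt (𝓡 3) c).source) (hOo : IsOpen O) :
    MeasurableSet (belowSet c O) := by
  classical
  have hV : MeasurableSet O := hOo.measurableSet
  set f : S → ℝ × ℝ × ℝ := O.piecewise
    (fun y => toCoords (extChartAt (𝓡 3) c y)) fun _ => 0 with hf
  have hm : Measurable f :=
    (continuous_toCoords.comp_continuousOn ((continuousOn_extChartAt c).mono hO)).measurable_piecewise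
      continuousOn_const hV
  have h1 : belowSet c O = (Prod.snd ⁻¹' O) ∩
      ({p | p.1.1 ≤ (f p.2).1} ∩ ({p | p.1.2.1 ≤ (f p.2).2.1} ∩ {p | p.1.2.2 ≤ (f p.2).2.2})) := by
    ext p
    refine and_congr_right fun hp => ?_
    have h2 : f p.2 = toCoords (extChartAt (𝓡 3) c p.2) := piecewise_eq_of_mem _ _ _ hp
    simp only [mem_inter_iff, mem_ofPred_eq, h2]
    rfl
  rw [h1]
  refine (hV.preimage measurable_snd).inter (MeasurableSet.inter ?_ (MeasurableSet.inter ?_ ?_))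
  · exact measurableSet_le (by fun_prop) (by fun_prop)
  · exact measurableSet_le (by fun_prop) (by fun_prop)
  · exact measurableSet_le (by fun_prop) (by fun_prop)

end ChartPull

/-! ### The kernel as an integral of matrix elements, and its vanishing. -/

section KernelVanishing

variable {S : Type*} [TopologicalSpace S] [ChartedSpace E3 S] [IsManifold (𝓡 3) ∞ S]
  [T2Space S] [CompactSpace S] [MeasurableSpace S] [BorelSpace S]

/-- The indicator of the points of `O` with coordinates above `r`, as an element of `L²`. -/
noncomputable def belowL2 (h : C11Metric S) {c : S} {O : Set S} (hB : MeasurableSet (belowSet c O))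
    (r : ℝ × ℝ × ℝ) : L2 h :=
  indicatorConstLp 2 (hB.preimage measurable_prodMk_left : MeasurableSet (Prod.mk r ⁻¹' belowSet c O))
    (measure_ne_top (vol h) _) (1 : ℂ)

theorem inner_belowL2 (h : C11Metric S) {c : S} {O : Set S} (hB : MeasurableSet (belowSet c O))
    (r : ℝ × ℝ × ℝ) (f : L2 h) :
    inner ℂ f (belowL2 h hB r) =
      ∫ y, conj (f y) * (belowSet c O).indicator (fun _ => (1 : ℂ)) (r, y) ∂(vol h) := by
  rw [L2.inner_def]
  refine integral_congr_ae ?_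
  filter_upwards [indicatorConstLp_coeFn (p := 2) (μ := vol h)
    (hs := (hB.preimage measurable_prodMk_left : MeasurableSet (Prod.mk r ⁻¹' belowSet c O)))
    (hμs := measure_ne_top (vol h) _) (c := (1 : ℂ))] with y hy
  rw [belowL2, hy, RCLike.inner_apply, mul_comm]
  rfl

theorem exists_norm_belowL2_le (h : C11Metric S) {c : S} {O : Set S}
    (hB : MeasurableSet (belowSet c O)) : ∃ C, ∀ r, ‖belowL2 h hB r‖ ≤ C := by
  refine ⟨measureUnivNNReal (vol h) ^ (ENNReal.toReal 2)⁻¹ * 1, fun r => ?_⟩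
  refine Lp.norm_le_of_ae_bound zero_le_one ?_
  filter_upwards [indicatorConstLp_coeFn (p := 2) (μ := vol h)
    (hs := (hB.preimage measurable_prodMk_left : MeasurableSet (Prod.mk r ⁻¹' belowSet c O)))
    (hμs := measure_ne_top (vol h) _) (c := (1 : ℂ))] with y hy
  rw [belowL2, hy]
  refine (norm_indicator_le_norm_self _ _).trans ?_
  simp

theorem stronglyMeasurable_inner_belowL2 [SecondCountableTopology S] (h : C11Metric S) {c : S}
    {O : Set S} (hB : MeasurableSet (belowSet c O)) (f : L2 h) :
    StronglyMeasurable fun r => inner ℂ f (belowL2 h hB r) := by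
  simp only [inner_belowL2]
  refine StronglyMeasurable.integral_prod_right' (f := fun p : (ℝ × ℝ × ℝ) × S =>
    conj (f p.2) * (belowSet c O).indicator (fun _ => (1 : ℂ)) p) ?_
  refine StronglyMeasurable.mul ?_ (stronglyMeasurable_const.indicator hB)
  exact Complex.continuous_conj.comp_stronglyMeasurable
    ((Lp.stronglyMeasurable f).comp_measurable measurable_snd)

theorem belowL2_support (h : C11Metric S) {c : S} {O : Set S} (hB : MeasurableSet (belowSet c O))
    (r : ℝ × ℝ × ℝ) : ∀ᵐ y ∂(vol h), belowL2 h hB r y ≠ 0 → y ∈ O := by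
  filter_upwards [indicatorConstLp_coeFn (p := 2) (μ := vol h)
    (hs := (hB.preimage measurable_prodMk_left : MeasurableSet (Prod.mk r ⁻¹' belowSet c O)))
    (hμs := measure_ne_top (vol h) _) (c := (1 : ℂ))] with y hy h0
  rw [belowL2, hy] at h0
  exact (mem_of_indicator_ne_zero h0).1

/-- The parameters `((t, s), r)` of the superposition. -/
abbrev Params : Type := (ℝ × ℝ) × (ℝ × ℝ × ℝ)

variable {c : S} {w : (ℝ × S) × (ℝ × S) → ℂ}

/-- The factor of the superposition that depends on the first point. -/
noncomputable def leftFactor (c : S) (w : (ℝ × S) × (ℝ × S) → ℂ) (p : Params × S) : ℂ :=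
  mixedD (chartPull c w) (((p.1.1.1, p.2), p.1.1.2), ofCoords p.1.2)

variable {O : Set S}

theorem continuous_leftFactor
    (hw : IsTest (IM.prod IM) w) (hO : O ⊆ (extChartAt (𝓡 3) c).source)
    (hcO : ∀ r ∈ tsupport w, r.2.2 ∈ O) :
    Continuous (leftFactor c w) := by
  refine (contMDiff_mixedD (contMDiff_chartPull hw fun r hr => hO (hcO r hr))).continuous.comp ?_
  have := continuous_ofCoords
  fun_prop

theorem leftFactor_ne_zero
    (hw : IsTest (IM.prod IM) w) (hO : O ⊆ (extChartAt (𝓡 3) c).source)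
    (hcO : ∀ r ∈ tsupport w, r.2.2 ∈ O) {p : Params × S} (hp : leftFactor c w p ≠ 0) :
    ∃ r ∈ tsupport w, r.1 = (p.1.1.1, p.2) ∧ r.2.1 = p.1.1.2 ∧
      toCoords (extChartAt (𝓡 3) c r.2.2) = p.1.2 := by
  have h1 : (((p.1.1.1, p.2), p.1.1.2), ofCoords p.1.2) ∈ chartSupport c w := by
    by_contra h0
    exact hp (mixedD_eq_zero (isCompact_chartSupport hw.hasCompactSupport
      fun r hr => hO (hcO r hr)).isClosed chartPull_eq_zero _ h0)
  obtain ⟨r, hr, he⟩ := h1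
  simp only [Prod.mk.injEq] at he
  exact ⟨r, hr, he.1.1, he.1.2, by rw [he.2, toCoords_ofCoords]⟩

theorem exists_compact_leftFactor
    (hw : IsTest (IM.prod IM) w) (hO : O ⊆ (extChartAt (𝓡 3) c).source)
    (hcO : ∀ r ∈ tsupport w, r.2.2 ∈ O) :
    ∃ K : Set Params, IsCompact K ∧ ∀ p : Params × S, p.1 ∉ K → leftFactor c w p = 0 := by
  refine ⟨(fun r : (ℝ × S) × (ℝ × S) => ((r.1.1, r.2.1), toCoords (extChartAt (𝓡 3) c r.2.2))) ''
    tsupport w, ?_, fun p hp => ?_⟩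
  · refine IsCompact.image_of_continuousOn hw.hasCompactSupport ?_
    refine ContinuousOn.prodMk (by fun_prop) (continuous_toCoords.comp_continuousOn ?_)
    exact (continuousOn_extChartAt c).comp (by fun_prop) fun r hr => hO (hcO r hr)
  · by_contra h0
    obtain ⟨r, hr, h1, h2, h3⟩ := leftFactor_ne_zero hw hO hcO h0
    exact hp ⟨r, hr, by simp only [h1, h2, h3]⟩

theorem exists_norm_leftFactor_le
    (hw : IsTest (IM.prod IM) w) (hO : O ⊆ (extChartAt (𝓡 3) c).source)
    (hcO : ∀ r ∈ tsupport w, r.2.2 ∈ O) :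
    ∃ C, ∀ p, ‖leftFactor c w p‖ ≤ C := by
  obtain ⟨K, hK, hz⟩ := exists_compact_leftFactor hw hO hcO
  refine (continuous_leftFactor hw hO hcO).bounded_above_of_compact_support ?_
  refine HasCompactSupport.intro (hK.prod isCompact_univ) fun p hp => hz p fun h => hp ⟨h, mem_univ _⟩

/-- The left factor, conjugated, as a family of elements of `L²`. -/
noncomputable def leftL2 (h : C11Metric S) (hw : IsTest (IM.prod IM) w)
    (hO : O ⊆ (extChartAt (𝓡 3) c).source) (hcO : ∀ r ∈ tsupport w, r.2.2 ∈ O) (r : Params) :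
    L2 h :=
  ContinuousMap.toLp 2 (vol h) ℂ
    ⟨fun x => conj (leftFactor c w (r, x)), Complex.continuous_conj.comp
      ((continuous_leftFactor hw hO hcO).comp (Continuous.prodMk_right r))⟩

/-- Currying a jointly continuous function gives continuity in the uniform norm, which dominates the
`L²` norm up to a constant. -/
theorem continuous_leftL2
    (hw : IsTest (IM.prod IM) w) (hO : O ⊆ (extChartAt (𝓡 3) c).source)
    (hcO : ∀ r ∈ tsupport w, r.2.2 ∈ O) (h : C11Metric S) : Continuous (leftL2 h hw hO hcO) := by
  refine (ContinuousMap.toLp 2 (vol h) ℂ).continuous.comp ?_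
  let f : C(Params × S, ℂ) := ⟨fun p => conj (leftFactor c w p),
    Complex.continuous_conj.comp (continuous_leftFactor hw hO hcO)⟩
  exact f.curry.continuous

theorem inner_leftL2
    (hw : IsTest (IM.prod IM) w) (hO : O ⊆ (extChartAt (𝓡 3) c).source)
    (hcO : ∀ r ∈ tsupport w, r.2.2 ∈ O) (h : C11Metric S) (r : Params) (f : L2 h) :
    inner ℂ (leftL2 h hw hO hcO r) f = ∫ x, f x * leftFactor c w (r, x) ∂(vol h) := by
  rw [L2.inner_def]
  refine integral_congr_ae ?_
  filter_upwards [ContinuousMap.coeFn_toLp (p := 2) (𝕜 := ℂ) (vol h)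
    ⟨fun x => conj (leftFactor c w (r, x)), Complex.continuous_conj.comp
      ((continuous_leftFactor hw hO hcO).comp (Continuous.prodMk_right r))⟩] with x hx
  rw [leftL2, hx, RCLike.inner_apply]
  simp

theorem leftL2_support
    (hw : IsTest (IM.prod IM) w) (hO : O ⊆ (extChartAt (𝓡 3) c).source)
    (hcO : ∀ r ∈ tsupport w, r.2.2 ∈ O) (h : C11Metric S) (r : Params) :
    ∀ᵐ x ∂(vol h), leftL2 h hw hO hcO r x ≠ 0 → leftFactor c w (r, x) ≠ 0 := by
  filter_upwards [ContinuousMap.coeFn_toLp (p := 2) (𝕜 := ℂ) (vol h)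
    ⟨fun x => conj (leftFactor c w (r, x)), Complex.continuous_conj.comp
      ((continuous_leftFactor hw hO hcO).comp (Continuous.prodMk_right r))⟩] with x hx h0
  rw [leftL2, hx] at h0
  simpa using h0

theorem leftL2_eq_zero
    (hw : IsTest (IM.prod IM) w) (hO : O ⊆ (extChartAt (𝓡 3) c).source)
    (hcO : ∀ r ∈ tsupport w, r.2.2 ∈ O) (h : C11Metric S) {r : Params} (hr : ∀ x, leftFactor c w (r, x) = 0) :
    leftL2 h hw hO hcO r = 0 := by
  refine (Lp.eq_zero_iff_ae_eq_zero).2 ?_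
  filter_upwards [leftL2_support hw hO hcO h r] with x hx
  by_contra h0
  exact hx h0 (hr x)

theorem exists_norm_leftL2_le
    (hw : IsTest (IM.prod IM) w) (hO : O ⊆ (extChartAt (𝓡 3) c).source)
    (hcO : ∀ r ∈ tsupport w, r.2.2 ∈ O) (h : C11Metric S) : ∃ C, ∀ r, ‖leftL2 h hw hO hcO r‖ ≤ C := by
  obtain ⟨K, hK, hz⟩ := exists_compact_leftFactor hw hO hcO
  refine (continuous_leftL2 hw hO hcO h).bounded_above_of_compact_support ?_
  exact HasCompactSupport.intro hK fun r hr => leftL2_eq_zero hw hO hcO h fun x => hz (r, x) hr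

/-- The pairing of a product of two `L²` functions with a test function. -/
theorem integral_integral_mul_test
    (hw : IsTest (IM.prod IM) w) (hO : O ⊆ (extChartAt (𝓡 3) c).source)
    (hcO : ∀ r ∈ tsupport w, r.2.2 ∈ O) [SecondCountableTopology S] (h : C11Metric S)
    (hB : MeasurableSet (belowSet c O)) (f g : L2 h) (t s : ℝ) :
    ∫ x, ∫ y, f x * conj (g y) * w ((t, x), (s, y)) ∂(vol h) ∂(vol h) =
      ∫ r, inner ℂ (leftL2 h hw hO hcO ((t, s), r)) f * inner ℂ g (belowL2 h hB r) := by
  have hf : Integrable f (vol h) := (Lp.memLp f).integrable one_le_two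
  have hg : Integrable (fun y => conj (g y)) (vol h) :=
    (Complex.conjCLE.toContinuousLinearMap.integrable_comp
      ((Lp.memLp g).integrable one_le_two))
  obtain ⟨K, hK, hz⟩ := exists_compact_leftFactor hw hO hcO
  obtain ⟨C₁, hC₁⟩ := exists_norm_leftFactor_le hw hO hcO
  obtain ⟨C₂, hC₂⟩ := exists_norm_belowL2_le h hB
  set K' : Set (ℝ × ℝ × ℝ) := Prod.snd '' K
  have hK' : IsCompact K' := hK.image continuous_snd
  have hz' : ∀ r ∉ K', ∀ x, leftFactor c w (((t, s), r), x) = 0 := fun r hr x =>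
    hz _ fun hm => hr ⟨_, hm, rfl⟩
  have hcont := continuous_leftFactor hw hO hcO
  -- The superposition replaces `w`, and Fubini moves the integral over `y` inside; the integral
  -- over `x` is exchanged in the same way below.
  have hin : ∀ x, ∫ y, conj (g y) * w ((t, x), (s, y)) ∂(vol h) =
      ∫ r, leftFactor c w (((t, s), r), x) * inner ℂ g (belowL2 h hB r) := by
    intro x
    have h1 := integral_mul_integral_swap (ν := (volume : Measure (ℝ × ℝ × ℝ))) hg
      (Φ := fun p : (ℝ × ℝ × ℝ) × S => leftFactor c w (((t, s), p.1), x) *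
        (belowSet c O).indicator (fun _ => (1 : ℂ)) p) (K := K') (C := C₁)
      (((hcont.comp (by fun_prop : Continuous fun p : (ℝ × ℝ × ℝ) × S =>
        ((((t, s), p.1), x) : Params × S))).aestronglyMeasurable).mul
        (stronglyMeasurable_const.indicator hB).aestronglyMeasurable)
      hK'.measurableSet hK'.measure_ne_top (fun p => by
        by_cases hp : p.1 ∈ K'
        · rw [indicator_of_mem hp, norm_mul]
          refine (mul_le_of_le_one_right (norm_nonneg _) ?_).trans (hC₁ _)
          exact (norm_indicator_le_norm_self _ _).trans (by simp)
        · rw [indicator_of_notMem hp, hz' _ hp, zero_mul, norm_zero])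
    have h2 : ∀ y, ∫ r, leftFactor c w (((t, s), r), x) *
        (belowSet c O).indicator (fun _ => (1 : ℂ)) (r, y) = w ((t, x), (s, y)) := fun y =>
      integral_mixedD_chartPull hw hO hcO (t, x) (s, y)
    simp only [h2] at h1
    rw [h1]
    refine integral_congr_ae (ae_of_all _ fun r => ?_)
    simp only [inner_belowL2]
    rw [← integral_const_mul]
    exact integral_congr_ae (ae_of_all _ fun y => by ring)
  simp only [mul_assoc, integral_const_mul, hin]
  rw [integral_mul_integral_swap (ν := (volume : Measure (ℝ × ℝ × ℝ))) hf
      (Φ := fun p : (ℝ × ℝ × ℝ) × S => leftFactor c w (((t, s), p.1), p.2) *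
        inner ℂ g (belowL2 h hB p.1)) (K := K') (C := C₁ * (‖g‖ * C₂))
      (((hcont.comp (by fun_prop : Continuous fun p : (ℝ × ℝ × ℝ) × S =>
        ((((t, s), p.1), p.2) : Params × S))).aestronglyMeasurable).mul
        ((stronglyMeasurable_inner_belowL2 h hB g).comp_measurable
          measurable_fst).aestronglyMeasurable)
      hK'.measurableSet hK'.measure_ne_top (fun p => by
        by_cases hp : p.1 ∈ K'
        · rw [indicator_of_mem hp, norm_mul]
          have h3 := norm_inner_le_norm (𝕜 := ℂ) g (belowL2 h hB p.1)
          have h4 := hC₂ p.1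
          have h5 := hC₁ (((t, s), p.1), p.2)
          have h6 : 0 ≤ C₁ := (norm_nonneg _).trans h5
          refine mul_le_mul h5 (h3.trans ?_) (norm_nonneg _) h6
          gcongr
        · rw [indicator_of_notMem hp, hz' _ hp, zero_mul, norm_zero])]
  refine integral_congr_ae (ae_of_all _ fun r => ?_)
  simp only [inner_leftL2]
  rw [← integral_mul_const]
  exact integral_congr_ae (ae_of_all _ fun y => by ring)

/-- Each term of the series is an integral over the parameters of `⟨left, T bₖ⟩ ⟨bₖ, right⟩`, so the
sum over `k` is a trace that no longer involves the basis. -/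
theorem causalKernel_eq_integral
    (hw : IsTest (IM.prod IM) w) (hO : O ⊆ (extChartAt (𝓡 3) c).source)
    (hcO : ∀ r ∈ tsupport w, r.2.2 ∈ O) (h : C11Metric S) {m : ℝ} (hm : 0 < m) (hOo : IsOpen O)
    {ι : Type*} (b : HilbertBasis ι ℂ (L2 h)) :
    ∃ hB : MeasurableSet (belowSet c O), causalKernel h hm b w =
      -∫ r : Params, inner ℂ (leftL2 h hw hO hcO r)
        (sinOp h hm (r.1.1 - r.1.2) (belowL2 h hB r.2)) := by
  have : SecondCountableTopology S := ChartedSpace.secondCountable_of_sigmaCompact E3 S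
  have hB := measurableSet_belowSet hO hOo
  refine ⟨hB, ?_⟩
  have : Fact ((2 : ENNReal) ≠ ⊤) := ⟨by norm_num⟩
  have hι : Countable ι := countable_of_hilbertBasis b
  obtain ⟨K, hK, hz⟩ := exists_compact_leftFactor hw hO hcO
  obtain ⟨C₁, hC₁⟩ := exists_norm_leftL2_le hw hO hcO h
  obtain ⟨C₂, hC₂⟩ := exists_norm_belowL2_le h hB
  obtain ⟨C₃, hC₃⟩ := exists_norm_sinOfInv_le (invA h hm)
  have hC₁0 : 0 ≤ C₁ := (norm_nonneg _).trans (hC₁ 0)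
  have hC₃0 : 0 ≤ C₃ := (norm_nonneg _).trans (hC₃ 0)
  have hleft := continuous_leftL2 hw hO hcO h
  have hsin : Continuous fun r : Params => sinOp h hm (r.1.1 - r.1.2) :=
    (continuous_sinOfInv (R := invA h hm)).comp (by fun_prop)
  have hmeas : ∀ k, AEStronglyMeasurable (fun r : Params => inner ℂ (leftL2 h hw hO hcO r)
      (sinOp h hm (r.1.1 - r.1.2) (b k)) * inner ℂ (b k) (belowL2 h hB r.2)) volume := by
    intro k
    refine AEStronglyMeasurable.mul ?_ ?_
    · exact (hleft.inner (hsin.clm_apply continuous_const)).aestronglyMeasurable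
    · exact ((stronglyMeasurable_inner_belowL2 h hB (b k)).comp_measurable
        measurable_snd).aestronglyMeasurable
  have hg0 : ∀ r ∉ K, leftL2 h hw hO hcO r = 0 := fun r hr =>
    leftL2_eq_zero hw hO hcO h fun x => hz (r, x) hr
  have htr := tsum_integral_inner_mul_inner (volume : Measure Params) b
    (fun r => sinOp h hm (r.1.1 - r.1.2)) (leftL2 h hw hO hcO) (fun r => belowL2 h hB r.2)
    hK.measurableSet hK.measure_ne_top (C := max (C₃ * C₁) C₂) hg0 (fun r => by
      refine (ContinuousLinearMap.le_opNorm _ _).trans (le_trans ?_ (le_max_left _ _))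
      rw [LinearIsometryEquiv.norm_map]
      exact mul_le_mul (hC₃ _) (hC₁ _) (norm_nonneg _) hC₃0)
    (fun r => (hC₂ _).trans (le_max_right _ _)) hmeas
  rw [← htr, causalKernel]
  congr 2
  funext k
  have hInt : Integrable (fun r : Params => inner ℂ (leftL2 h hw hO hcO r)
      (sinOp h hm (r.1.1 - r.1.2) (b k)) * inner ℂ (b k) (belowL2 h hB r.2)) volume := by
    refine Integrable.mono' (g := K.indicator fun _ => C₁ * (C₃ * ‖b k‖) * (‖b k‖ * C₂))
      ((integrable_indicator_iff hK.measurableSet).2 (integrableOn_const hK.measure_ne_top))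
      (hmeas k) (ae_of_all _ fun r => ?_)
    by_cases hr : r ∈ K
    · rw [indicator_of_mem hr, norm_mul]
      refine mul_le_mul ?_ ?_ (norm_nonneg _) (by positivity)
      · refine (norm_inner_le_norm _ _).trans
          (mul_le_mul (hC₁ r) ?_ (norm_nonneg _) hC₁0)
        exact ContinuousLinearMap.le_of_opNorm_le _ (hC₃ _) _
      · refine (norm_inner_le_norm _ _).trans ?_
        gcongr
        exact hC₂ _
    · simp [hr, hg0 r hr]
  simp only [integral_integral_mul_test hw hO hcO h hB]
  -- Fubini twice, to match the iterated integrals over `t`, `s` and the octant parameter.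
  exact (((integral_prod _ hInt).trans (integral_prod _ hInt.integral_prod_left))).symm

/-- The strict inequality persists on a neighbourhood of `(p, q)`, where finite propagation speed
kills every matrix element in the superposition. -/
theorem notMem_distSupport_of_isShort (h : C11Metric S) {m : ℝ} (hm : 0 < m) {ι : Type*}
    (b : HilbertBasis ι ℂ (L2 h)) {ψ : S → ℝ} (hψ : IsShort h ψ) {p q : ℝ × S}
    (hpq : |p.1 - q.1| < ψ p.2 - ψ q.2) :
    (p, q) ∉ distSupport (IM.prod IM) (causalKernel h hm b) := by
  rw [distSupport, mem_compl_iff, not_not]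
  -- Both times and both values of `ψ` may move by `ε`, which uses up four of the five parts of the
  -- gap.
  set ε := (ψ p.2 - ψ q.2 - |p.1 - q.1|) / 5 with hε
  have hε0 : 0 < ε := by rw [hε]; linarith
  have hψc := hψ.contMDiff.continuous
  set O : Set S := (extChartAt (𝓡 3) q.2).source ∩ {y | ψ y < ψ q.2 + ε} with hOdef
  have hOo : IsOpen O := (isOpen_extChartAt_source q.2).inter (isOpen_lt hψc continuous_const)
  set W : Set ((ℝ × S) × (ℝ × S)) := {r | |r.1.1 - p.1| < ε} ∩ {r | |r.2.1 - q.1| < ε} ∩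
    {r | ψ p.2 - ε < ψ r.1.2} ∩ {r | r.2.2 ∈ O} with hW
  refine ⟨W, ⟨?_, fun w hw hsupp => ?_⟩, ?_⟩
  · refine (((isOpen_lt ?_ continuous_const).inter (isOpen_lt ?_ continuous_const)).inter
      (isOpen_lt continuous_const ?_)).inter (hOo.preimage (by fun_prop)) <;> fun_prop
  · obtain ⟨hB, hker⟩ := causalKernel_eq_integral hw (inter_subset_left : O ⊆ _)
      (fun r hr => (hsupp hr).2) h hm hOo b
    rw [hker, neg_eq_zero]
    refine integral_eq_zero_of_ae (ae_of_all _ fun r => ?_)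
    by_cases hr : ∀ x, leftFactor q.2 w (r, x) = 0
    · have h0 := leftL2_eq_zero hw (inter_subset_left : O ⊆ _) (fun r hr => (hsupp hr).2) h hr
      beta_reduce
      rw [h0, inner_zero_left, Pi.zero_apply]
    -- One point where the left factor is nonzero already places both time parameters within `ε` of
    -- the times of `p` and `q`.
    · push Not at hr
      obtain ⟨x, hx⟩ := hr
      obtain ⟨r', hr', h1, h2, -⟩ := leftFactor_ne_zero hw (inter_subset_left : O ⊆ _)
        (fun r hr => (hsupp hr).2) hx
      have hWr := hsupp hr'
      have ht : |r.1.1 - p.1| < ε := by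
        have := hWr.1.1.1
        rwa [mem_ofPred_eq, h1] at this
      have hs : |r.1.2 - q.1| < ε := by
        have := hWr.1.1.2
        rwa [mem_ofPred_eq, h2] at this
      refine inner_sinOp_eq_zero hm hψ (a := ψ q.2 + ε) (b := ψ p.2 - ε) ?_ ?_ ?_
      · have h3 : |r.1.1 - r.1.2| ≤ |r.1.1 - p.1| + |p.1 - q.1| + |r.1.2 - q.1| := by
          have := abs_add_three (r.1.1 - p.1) (p.1 - q.1) (q.1 - r.1.2)
          rw [abs_sub_comm q.1] at this
          rwa [show r.1.1 - p.1 + (p.1 - q.1) + (q.1 - r.1.2) = r.1.1 - r.1.2 by ring] at this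
        have h4 : |p.1 - q.1| = ψ p.2 - ψ q.2 - 5 * ε := by rw [hε]; ring
        linarith
      · filter_upwards [leftL2_support hw (inter_subset_left : O ⊆ _)
          (fun r hr => (hsupp hr).2) h r] with y hy h0
        obtain ⟨r'', hr'', h3, -, -⟩ := leftFactor_ne_zero hw (inter_subset_left : O ⊆ _)
          (fun r hr => (hsupp hr).2) (hy h0)
        have := (hsupp hr'').1.2
        rw [mem_ofPred_eq, h3] at this
        exact this.le
      · filter_upwards [belowL2_support h hB r.2] with y hy h0
        exact (hy h0).2.le
  · refine ⟨⟨⟨?_, ?_⟩, ?_⟩, ?_⟩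
    · simpa using hε0
    · simpa using hε0
    · simpa using hε0
    · exact ⟨mem_extChartAt_source q.2, by simpa using hε0⟩

end KernelVanishing

/-! ### Construction of short functions. -/

section ShortFunctions

variable {S : Type*} [TopologicalSpace S] [ChartedSpace E3 S] [IsManifold (𝓡 3) ∞ S]
  {h : C11Metric S} {f g : S → ℝ}

/-- The length of a tangent vector. -/
noncomputable def tangentNorm (h : C11Metric S) (x : S) (v : TangentSpace (𝓡 3) x) : ℝ :=
  √(h.inner x v v)

theorem tangentNorm_nonneg (x : S) (v : TangentSpace (𝓡 3) x) : 0 ≤ tangentNorm h x v :=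
  Real.sqrt_nonneg _

theorem abs_realD_le (f : S → ℝ) (x : S) (v : TangentSpace (𝓡 3) x) :
    |realD f x v| ≤ √(slopeSq h f x) * tangentNorm h x v := by
  rw [tangentNorm, ← Real.sqrt_mul (slopeSq_nonneg h f x)]
  exact Real.abs_le_sqrt (sq_realD_le h f x v)

theorem IsShort.abs_realD_le (hf : IsShort h f) (x : S) (v : TangentSpace (𝓡 3) x) :
    |realD f x v| ≤ tangentNorm h x v :=
  Real.abs_le_sqrt (hf.sq_le x v)

theorem IsShort.of_abs_le (hf : ContMDiff (𝓡 3) 𝓘(ℝ, ℝ) ∞ f)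
    (hle : ∀ x v, |realD f x v| ≤ tangentNorm h x v) : IsShort h f := by
  refine ⟨hf, fun x v => ?_⟩
  have h1 := pow_le_pow_left₀ (abs_nonneg _) (hle x v) 2
  rwa [sq_abs, tangentNorm, Real.sq_sqrt (inner_self_nonneg_tangent h x v)] at h1

theorem realD_comp {F : ℝ → ℝ} {F' : ℝ} {x : S} (hf : ContMDiff (𝓡 3) 𝓘(ℝ, ℝ) ∞ f)
    (hF : HasDerivAt F F' (f x)) (v : TangentSpace (𝓡 3) x) :
    realD (fun y => F (f y)) x v = F' * realD f x v := by
  have h1 : MDifferentiableAt (𝓡 3) 𝓘(ℝ, ℝ) f x := hf.mdifferentiableAt (by simp)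
  have := (hF.hasFDerivAt.hasMFDerivAt).comp x h1.hasMFDerivAt
  refine (congrArg (fun T : E3 →L[ℝ] ℝ => T v) this.mfderiv).trans ?_
  change realD f x v • F' = _
  rw [smul_eq_mul, mul_comm]

theorem realD_mul {x : S} (hf : ContMDiff (𝓡 3) 𝓘(ℝ, ℝ) ∞ f) (hg : ContMDiff (𝓡 3) 𝓘(ℝ, ℝ) ∞ g)
    (v : TangentSpace (𝓡 3) x) :
    realD (fun y => f y * g y) x v = f x * realD g x v + g x * realD f x v := by
  have h1 : MDifferentiableAt (𝓡 3) 𝓘(ℝ, ℝ) f x := hf.mdifferentiableAt (by simp)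
  have h2 : MDifferentiableAt (𝓡 3) 𝓘(ℝ, ℝ) g x := hg.mdifferentiableAt (by simp)
  exact congrArg (fun T : E3 →L[ℝ] ℝ => T v) (h1.hasMFDerivAt.mul h2.hasMFDerivAt).mfderiv

theorem realD_congr {x : S} (hfg : f =ᶠ[𝓝 x] g) (v : TangentSpace (𝓡 3) x) :
    realD f x v = realD g x v :=
  congrArg (fun T : E3 →L[ℝ] ℝ => T v) hfg.mfderiv_eq

theorem contMDiff_mul (hf : ContMDiff (𝓡 3) 𝓘(ℝ, ℝ) ∞ f) (hg : ContMDiff (𝓡 3) 𝓘(ℝ, ℝ) ∞ g) :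
    ContMDiff (𝓡 3) 𝓘(ℝ, ℝ) ∞ fun y => f y * g y :=
  hf.mul hg

theorem contMDiff_const_mul (a : ℝ) (hf : ContMDiff (𝓡 3) 𝓘(ℝ, ℝ) ∞ f) :
    ContMDiff (𝓡 3) 𝓘(ℝ, ℝ) ∞ fun y => a * f y :=
  contMDiff_const.mul hf

theorem realD_const_mul {x : S} (a : ℝ) (hf : ContMDiff (𝓡 3) 𝓘(ℝ, ℝ) ∞ f)
    (v : TangentSpace (𝓡 3) x) : realD (fun y => a * f y) x v = a * realD f x v := by
  have := realD_comp (F := fun t => a * t) (F' := a * 1) hf ((hasDerivAt_id (f x)).const_mul a) v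
  rwa [mul_one] at this

theorem IsShort.neg (hf : IsShort h f) : IsShort h fun x => -f x := by
  have h1 := contMDiff_const_mul (-1) hf.contMDiff
  simp only [neg_one_mul] at h1
  refine ⟨h1, fun x v => ?_⟩
  have h2 := realD_const_mul (-1) hf.contMDiff v
  simp only [neg_one_mul] at h2
  rw [h2, neg_sq]
  exact hf.sq_le x v

variable [T2Space S]

theorem exists_bump {c : S} {O : Set S} (hO : O ∈ 𝓝 c) : ∃ χ : S → ℝ,
    ContMDiff (𝓡 3) 𝓘(ℝ, ℝ) ∞ χ ∧ (∀ x, 0 ≤ χ x) ∧ (∀ x, χ x ≤ 1) ∧ (∀ x ∉ O, χ x = 0) ∧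
      χ =ᶠ[𝓝 c] fun _ => 1 := by
  obtain ⟨χ, -, hχ⟩ := (SmoothBumpFunction.nhds_basis_tsupport (I := 𝓡 3) c).mem_iff.1 hO
  refine ⟨χ, χ.contMDiff, fun x => χ.nonneg, fun x => χ.le_one, fun x hx => ?_, χ.eventuallyEq_one⟩
  by_contra h0
  exact hx (hχ (subset_tsupport _ h0))

/-- Coordinate functions extend from a neighbourhood of a point. -/
theorem exists_extend_chart (c : S) (β : E3 →L[ℝ] ℝ) : ∃ f : S → ℝ,
    ContMDiff (𝓡 3) 𝓘(ℝ, ℝ) ∞ f ∧ f =ᶠ[𝓝 c] fun x => β (extChartAt (𝓡 3) c x) := by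
  obtain ⟨χ⟩ : Nonempty (SmoothBumpFunction (𝓡 3) c) := inferInstance
  have h1 : ContMDiffOn (𝓡 3) 𝓘(ℝ, ℝ) ∞ (fun x => β (extChartAt (𝓡 3) c x))
      (chartAt E3 c).source := β.contMDiff.comp_contMDiffOn contMDiffOn_extChartAt
  refine ⟨fun x => χ x • β (extChartAt (𝓡 3) c x), χ.contMDiff_smul h1, ?_⟩
  filter_upwards [χ.eventuallyEq_one] with x hx
  simp [hx]

/-- The inverse of the chart's differential turns the covector into a linear function of the
coordinates, which is extended from a neighbourhood and normalised at `c`. -/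
theorem exists_realD_eq (c : S) (α : TangentSpace (𝓡 3) c →L[ℝ] ℝ) : ∃ f : S → ℝ,
    ContMDiff (𝓡 3) 𝓘(ℝ, ℝ) ∞ f ∧ f c = 0 ∧ ∀ v, realD f c v = α v := by
  obtain ⟨L, hL⟩ := isInvertible_mfderiv_extChartAt (I := 𝓡 3) (mem_extChartAt_source (I := 𝓡 3) c)
  set L' : E3 ≃L[ℝ] E3 := L
  set α' : E3 →L[ℝ] ℝ := α
  set β : E3 →L[ℝ] ℝ := α'.comp (L'.symm : E3 →L[ℝ] E3) with hβ
  obtain ⟨f, hf, hfe⟩ := exists_extend_chart c β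
  refine ⟨fun x => f x - f c, hf.sub contMDiff_const, sub_self _, fun v => ?_⟩
  have h1 := realD_comp (F := fun t => t - f c) (x := c) hf ((hasDerivAt_id (f c)).sub_const (f c)) v
  rw [one_mul] at h1
  refine h1.trans ((realD_congr hfe v).trans ?_)
  have h2 : MDifferentiableAt (𝓡 3) 𝓘(ℝ, E3) (extChartAt (𝓡 3) c) c :=
    mdifferentiableAt_extChartAt (mem_chart_source E3 c)
  have h3 := (β.hasMFDerivAt (x := extChartAt (𝓡 3) c c)).comp c h2.hasMFDerivAt
  refine (congrArg (fun T : E3 →L[ℝ] ℝ => T v) h3.mfderiv).trans ?_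
  change β ((mfderiv (𝓡 3) 𝓘(ℝ, E3) (extChartAt (𝓡 3) c) c : E3 →L[ℝ] E3) v) = α v
  have h4 : (mfderiv (𝓡 3) 𝓘(ℝ, E3) (extChartAt (𝓡 3) c) c : E3 →L[ℝ] E3) v = L' v :=
    congrArg (fun T : E3 →L[ℝ] E3 => T v) hL.symm
  rw [h4]
  exact congrArg α' (L'.symm_apply_apply v)

variable [CompactSpace S]

theorem exists_pos_abs_realD_le (h : C11Metric S) (hf : ContMDiff (𝓡 3) 𝓘(ℝ, ℝ) ∞ f) :
    ∃ C, 0 < C ∧ ∀ x v, |realD f x v| ≤ C * tangentNorm h x v := by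
  obtain ⟨C, hC⟩ := (isCompact_range (continuous_slopeSq h hf)).bddAbove
  refine ⟨√(max C 1), by positivity, fun x v => (abs_realD_le (h := h) f x v).trans ?_⟩
  exact mul_le_mul_of_nonneg_right
    (Real.sqrt_le_sqrt ((hC ⟨x, rfl⟩).trans (le_max_left _ _))) (tangentNorm_nonneg x v)

/-- Compactness bounds the differential. Bump functions and coordinate functions thereby become
short after scaling. -/
theorem exists_isShort_smul (h : C11Metric S) (hf : ContMDiff (𝓡 3) 𝓘(ℝ, ℝ) ∞ f) :
    ∃ a, 0 < a ∧ IsShort h fun x => a * f x := by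
  obtain ⟨C, hC, hle⟩ := exists_pos_abs_realD_le h hf
  refine ⟨C⁻¹, by positivity, .of_abs_le (contMDiff_const_mul _ hf) fun x v => ?_⟩
  rw [realD_const_mul _ hf, abs_mul, abs_of_pos (by positivity), inv_mul_le_iff₀ hC]
  exact hle x v

theorem exists_isShort_ne (h : C11Metric S) {x y : S} (hxy : x ≠ y) :
    ∃ f, IsShort h f ∧ f x ≠ f y := by
  obtain ⟨χ, hχ, -, -, h0, h1⟩ := exists_bump (isOpen_compl_singleton.mem_nhds hxy)
  obtain ⟨a, ha, hs⟩ := exists_isShort_smul h hχ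
  refine ⟨_, hs, ?_⟩
  simp [h0 y (by simp), h1.eq_of_nhds, ha.ne']

/-- A short function whose differential at a point is a given covector of norm less than `1`. -/
theorem exists_isShort_realD_eq (hf : ContMDiff (𝓡 3) 𝓘(ℝ, ℝ) ∞ f) {c : S} (hfc : f c = 0)
    (hs : slopeSq h f c < 1) : ∃ ψ, IsShort h ψ ∧ ∀ v, realD ψ c v = realD f c v := by
  obtain ⟨θ, hθ0, hθ1⟩ := exists_between hs
  have hO : {x | slopeSq h f x < θ} ∈ 𝓝 c :=
    (isOpen_lt (continuous_slopeSq h hf) continuous_const).mem_nhds hθ0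
  obtain ⟨χ, hχ, hχ0, hχ1, hχO, hχc⟩ := exists_bump hO
  obtain ⟨C, hC, hle⟩ := exists_pos_abs_realD_le h hχ
  have hθ : √θ < 1 := by
    rw [Real.sqrt_lt' one_pos]; simpa using hθ1
  -- `δ sin(·/δ)` has slope at most `1`, slope `1` at zero, and size at most `δ`. Where the cutoff
  -- lives, `f` has slope at most `√θ`, and the remaining `1 - √θ` pays for the cutoff's own slope,
  -- at most `C`.
  set δ := (1 - √θ) / C with hδ
  have hδ0 : 0 < δ := div_pos (by linarith) hC
  have hFd : ∀ t, HasDerivAt (fun t => δ * Real.sin (t / δ)) (Real.cos (t / δ)) t := by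
    intro t
    have := (((hasDerivAt_id t).div_const δ).sin).const_mul δ
    simp only [id_eq] at this
    have h2 : Real.cos (t / δ) = δ * (Real.cos (t / δ) * (1 / δ)) := by
      rw [mul_left_comm, mul_one_div_cancel hδ0.ne', mul_one]
    rw [h2]
    exact this
  have hFs : ContMDiff (𝓡 3) 𝓘(ℝ, ℝ) ∞ fun x => δ * Real.sin (f x / δ) := by
    have : ContDiff ℝ ∞ fun t => δ * Real.sin (t / δ) := by fun_prop
    exact this.contMDiff.comp hf
  have hd : ∀ x v, realD (fun x => χ x * (δ * Real.sin (f x / δ))) x v =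
      χ x * (Real.cos (f x / δ) * realD f x v) + δ * Real.sin (f x / δ) * realD χ x v := by
    intro x v
    rw [realD_mul hχ hFs, realD_comp hf (hFd (f x))]
  refine ⟨fun x => χ x * (δ * Real.sin (f x / δ)), .of_abs_le (contMDiff_mul hχ hFs)
    fun x v => ?_, fun v => ?_⟩
  · have hn := tangentNorm_nonneg (h := h) x v
    have h1 : |χ x * (Real.cos (f x / δ) * realD f x v)| ≤ √θ * tangentNorm h x v := by
      by_cases hx : slopeSq h f x < θ
      · rw [abs_mul, abs_mul, abs_of_nonneg (hχ0 x)]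
        have h2 : |realD f x v| ≤ √θ * tangentNorm h x v := (abs_realD_le f x v).trans
          (mul_le_mul_of_nonneg_right (Real.sqrt_le_sqrt hx.le) hn)
        calc _ ≤ 1 * (1 * (√θ * tangentNorm h x v)) := by
              gcongr
              · exact hχ1 x
              · exact Real.abs_cos_le_one _
          _ = _ := by ring
      · rw [hχO x hx, zero_mul, abs_zero]
        positivity
    have h2 : |δ * Real.sin (f x / δ) * realD χ x v| ≤ (1 - √θ) * tangentNorm h x v := by
      rw [abs_mul, abs_mul, abs_of_pos hδ0]
      calc _ ≤ δ * 1 * (C * tangentNorm h x v) := by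
            gcongr
            · exact Real.abs_sin_le_one _
            · exact hle x v
        _ = δ * C * tangentNorm h x v := by ring
        _ = _ := by rw [hδ, div_mul_cancel₀ _ hC.ne']
    rw [hd]
    refine (abs_add_le _ _).trans ?_
    linarith
  · rw [hd, hfc, hχc.eq_of_nhds]
    simp

end ShortFunctions

/-! ### Curves along which short functions are Lipschitz are causal. -/

section CausalCurves

variable {S : Type*} [TopologicalSpace S] [ChartedSpace E3 S] [IsManifold (𝓡 3) ∞ S]
  [T2Space S] [CompactSpace S] {h : C11Metric S}

variable (h) in
/-- The curves along which all short functions are `1`-Lipschitz. -/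
def IsShortCurve (γ : ℝ → S) : Prop :=
  ∀ ψ, IsShort h ψ → ∀ s t, |ψ (γ s) - ψ (γ t)| ≤ |s - t|

variable {γ : ℝ → S}

/-- In a compact space it suffices that `γ s` is the only cluster point of `γ` at `s`, and short
functions, continuous along `γ`, separate points. -/
theorem IsShortCurve.continuous (hγ : IsShortCurve h γ) : Continuous γ := by
  rw [continuous_iff_continuousAt]
  intro s
  refine le_nhds_of_unique_clusterPt fun x hx => ?_
  by_contra hne
  obtain ⟨ψ, hψ, hψne⟩ := exists_isShort_ne h hne
  have h1 : Tendsto (fun t => ψ (γ t)) (𝓝 s) (𝓝 (ψ (γ s))) := by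
    rw [tendsto_iff_dist_tendsto_zero]
    refine squeeze_zero (fun t => dist_nonneg) (fun t => hγ ψ hψ t s) ?_
    have : Continuous fun t : ℝ => |t - s| := by fun_prop
    simpa using this.tendsto s
  have h2 : ClusterPt (ψ x) (map ψ (map γ (𝓝 s))) :=
    hx.map hψ.contMDiff.continuous.continuousAt tendsto_map
  have h3 : ClusterPt (ψ x) (𝓝 (ψ (γ s))) := h2.mono h1
  exact hψne (eq_of_nhds_neBot h3)

/-- Near `γ s` each coordinate agrees with a smooth function, a multiple of which is short. -/
theorem IsShortCurve.exists_lipschitz (hγ : IsShortCurve h γ) (s : ℝ) : ∃ K, ∃ u, IsOpen u ∧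
    s ∈ u ∧ (∀ t ∈ u, γ t ∈ (extChartAt (𝓡 3) (γ s)).source) ∧
      LipschitzOnWith K (extChartAt (𝓡 3) (γ s) ∘ γ) u := by
  have hcoord : ∀ i : Fin 3, ∃ a : ℝ, 0 < a ∧ ∃ O ∈ 𝓝 (γ s), ∀ x ∈ O, ∀ y ∈ O, ∀ t t', γ t = x →
      γ t' = y → |extChartAt (𝓡 3) (γ s) x i - extChartAt (𝓡 3) (γ s) y i| ≤ a * |t - t'| := by
    intro i
    obtain ⟨f, hf, hfe⟩ := exists_extend_chart (γ s) (EuclideanSpace.proj i : E3 →L[ℝ] ℝ)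
    obtain ⟨a, ha, hs⟩ := exists_isShort_smul h hf
    refine ⟨a⁻¹, by positivity, _, hfe, ?_⟩
    rintro _ hx _ hy t t' rfl rfl
    have hx' : f (γ t) = extChartAt (𝓡 3) (γ s) (γ t) i := hx
    have hy' : f (γ t') = extChartAt (𝓡 3) (γ s) (γ t') i := hy
    have h1 := hγ _ hs t t'
    rw [← mul_sub, abs_mul, abs_of_pos ha] at h1
    rw [← hx', ← hy', inv_mul_eq_div, le_div_iff₀' ha]
    exact h1
  choose a ha O hO hlip using hcoord
  have hV : (⋂ i, O i) ∩ (extChartAt (𝓡 3) (γ s)).source ∈ 𝓝 (γ s) :=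
    inter_mem (iInter_mem.2 hO) (extChartAt_source_mem_nhds (γ s))
  obtain ⟨u, hu, huo, hsu⟩ := mem_nhds_iff.1 (hγ.continuous.continuousAt hV)
  have ha0 : 0 ≤ ∑ i, a i := Finset.sum_nonneg fun i _ => (ha i).le
  refine ⟨Real.toNNReal (∑ i, a i), u, huo, hsu,
    fun t ht => (hu ht).2, LipschitzOnWith.of_dist_le_mul fun t ht t' ht' => ?_⟩
  rw [dist_eq_norm, EuclideanSpace.norm_eq, Real.coe_toNNReal _ ha0]
  have hb : ∀ i, |(extChartAt (𝓡 3) (γ s) (γ t) - extChartAt (𝓡 3) (γ s) (γ t')) i| ≤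
      a i * |t - t'| := fun i =>
    hlip i _ (mem_iInter.1 (hu ht).1 i) _ (mem_iInter.1 (hu ht').1 i) t t' rfl rfl
  rw [Real.sqrt_le_left (mul_nonneg ha0 dist_nonneg)]
  calc _ ≤ ∑ i, (a i * |t - t'|) ^ 2 := by
        refine Finset.sum_le_sum fun i _ => ?_
        exact pow_le_pow_left₀ (norm_nonneg _) (hb i) 2
    _ ≤ (∑ i, a i * |t - t'|) ^ 2 :=
        Finset.sum_sq_le_sq_sum_of_nonneg fun i _ => mul_nonneg (ha i).le (abs_nonneg _)
    _ = _ := by rw [← Finset.sum_mul, Real.dist_eq]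

/-- Rademacher's theorem in charts, locally on the line. -/
theorem IsShortCurve.ae_mdifferentiableAt (hγ : IsShortCurve h γ) :
    ∀ᵐ s, MDifferentiableAt 𝓘(ℝ, ℝ) (𝓡 3) γ s := by
  rw [ae_iff]
  refine measure_null_of_locally_null _ fun s _ => ?_
  obtain ⟨K, u, huo, hsu, hsrc, hlip⟩ := hγ.exists_lipschitz s
  refine ⟨{t | ¬MDifferentiableAt 𝓘(ℝ, ℝ) (𝓡 3) γ t} ∩ u,
    inter_mem self_mem_nhdsWithin (mem_nhdsWithin_of_mem_nhds (huo.mem_nhds hsu)), ?_⟩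
  have h1 := hlip.ae_differentiableWithinAt_of_mem (μ := volume)
  rw [ae_iff] at h1
  refine measure_mono_null ?_ h1
  rintro t ⟨ht, htu⟩ hd
  refine ht ?_
  have h2 : DifferentiableAt ℝ (extChartAt (𝓡 3) (γ s) ∘ γ) t :=
    (hd htu).differentiableAt (huo.mem_nhds htu)
  have h3 : MDifferentiableAt 𝓘(ℝ, E3) (𝓡 3) (extChartAt (𝓡 3) (γ s)).symm
      ((extChartAt (𝓡 3) (γ s) ∘ γ) t) := by
    have := mdifferentiableWithinAt_extChartAt_symm (I := 𝓡 3)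
      ((extChartAt (𝓡 3) (γ s)).map_source (hsrc t htu))
    rwa [ModelWithCorners.range_eq_univ, mdifferentiableWithinAt_univ] at this
  refine (h3.comp t h2.mdifferentiableAt).congr_of_eventuallyEq ?_
  filter_upwards [huo.mem_nhds htu] with t' ht'
  exact ((extChartAt (𝓡 3) (γ s)).left_inv (hsrc t' ht')).symm

theorem sq_inner_le (h : C11Metric S) (x : S) (v w : TangentSpace (𝓡 3) x) :
    h.inner x v w ^ 2 ≤ h.inner x v v * h.inner x w w := by
  have h3 : ∀ s : ℝ, 0 ≤ h.inner x w w * (s * s) + 2 * h.inner x v w * s + h.inner x v v := by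
    intro s
    have h4 := inner_self_nonneg_tangent h x (v + s • w)
    have h5 := h.symm x v w
    simp only [map_add, map_smul, _root_.add_apply, _root_.smul_apply, smul_eq_mul] at h4
    rw [← h5] at h4
    linarith
  have := discrim_le_zero h3
  rw [discrim] at this
  nlinarith

/-- If `n = |γ'|² > 1`, the covector `2/(n+1) ⟨γ', ·⟩` has squared norm `4n/(n+1)² < 1` but takes
the value `2n/(n+1) > 1` on `γ'`. A short function with this differential would grow too fast along
`γ`. -/
theorem IsShortCurve.inner_le_one (hγ : IsShortCurve h γ) {s : ℝ}
    (hd : MDifferentiableAt 𝓘(ℝ, ℝ) (𝓡 3) γ s) :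
    h.inner (γ s) (mfderiv 𝓘(ℝ, ℝ) (𝓡 3) γ s (1 : ℝ)) (mfderiv 𝓘(ℝ, ℝ) (𝓡 3) γ s (1 : ℝ)) ≤ 1 := by
  set v : TangentSpace (𝓡 3) (γ s) := mfderiv 𝓘(ℝ, ℝ) (𝓡 3) γ s (1 : ℝ) with hv
  by_contra hN
  push Not at hN
  set n := h.inner (γ s) v v with hn
  obtain ⟨f, hf, hfc, hfd⟩ := exists_realD_eq (γ s) ((2 / (n + 1)) • h.inner (γ s) v)
  have hfd' : ∀ w, realD f (γ s) w = 2 / (n + 1) * h.inner (γ s) v w := hfd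
  have hslope : slopeSq h f (γ s) < 1 := by
    refine (slopeSq_le (L := (2 / (n + 1)) ^ 2 * n) (by positivity) fun w => ?_).trans_lt ?_
    · rw [hfd', mul_pow, mul_assoc]
      gcongr
      exact sq_inner_le h (γ s) v w
    · rw [div_pow, div_mul_eq_mul_div, div_lt_one (by positivity)]
      nlinarith
  obtain ⟨ψ, hψ, hψd⟩ := exists_isShort_realD_eq hf hfc hslope
  have h1 : MDifferentiableAt (𝓡 3) 𝓘(ℝ, ℝ) ψ (γ s) := hψ.contMDiff.mdifferentiableAt (by simp)
  have h2 : HasFDerivAt (ψ ∘ γ) ((realD ψ (γ s) : E3 →L[ℝ] ℝ).comp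
      (mfderiv 𝓘(ℝ, ℝ) (𝓡 3) γ s : ℝ →L[ℝ] E3)) s :=
    (h1.hasMFDerivAt.comp s hd.hasMFDerivAt).hasFDerivAt
  have h3 := h2.hasDerivAt.le_of_lip' (C := 1) zero_le_one (Eventually.of_forall fun t => by
    rw [one_mul]; exact hγ ψ hψ t s)
  have h4 : realD ψ (γ s) v = 2 / (n + 1) * n := (hψd v).trans (hfd' v)
  have h5 : |realD ψ (γ s) v| ≤ 1 := h3
  rw [h4, abs_of_pos (by positivity), div_mul_eq_mul_div, div_le_one (by positivity)] at h5
  linarith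

theorem IsShortCurve.isFutureCausal (hγ : IsShortCurve h γ) (t₀ a b : ℝ) :
    IsFutureCausal h (fun s => (t₀ + s, γ s)) a b := by
  have hc := hγ.continuous
  refine ⟨by fun_prop, fun s _ => ?_, ?_⟩
  · obtain ⟨K, u, huo, hsu, -, hlip⟩ := hγ.exists_lipschitz s
    refine ⟨max 1 K, u, mem_nhdsWithin_of_mem_nhds (huo.mem_nhds hsu), ?_⟩
    have h1 : LipschitzOnWith 1 (fun s : ℝ => t₀ + s) u :=
      (LipschitzWith.of_dist_le_mul fun x y => by simp).lipschitzOnWith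
    have h2 := h1.prodMk hlip
    exact h2
  · filter_upwards [hγ.ae_mdifferentiableAt] with s hs _
    have h1 : HasDerivAt (fun s : ℝ => t₀ + s) 1 s := (hasDerivAt_id s).const_add t₀
    have h2 : MDifferentiableAt 𝓘(ℝ, ℝ) 𝓘(ℝ, ℝ) (fun s : ℝ => t₀ + s) s :=
      h1.differentiableAt.mdifferentiableAt
    have h3 : velocity (fun s => (t₀ + s, γ s)) s =
        ((1 : ℝ), (mfderiv 𝓘(ℝ, ℝ) (𝓡 3) γ s (1 : ℝ) : E3)) := by
      refine (congrArg (fun T : ℝ →L[ℝ] ℝ × E3 => T 1) (mfderiv_prodMk h2 hs)).trans ?_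
      refine Prod.ext ?_ rfl
      have := h1.hasFDerivAt.hasMFDerivAt.mfderiv
      refine (congrArg (fun T : ℝ →L[ℝ] ℝ => T 1) this).trans ?_
      simp
    refine ⟨h2.prodMk hs, ?_, ?_⟩
    · rw [h3]
      have h4 := hγ.inner_le_one hs
      change 0 ≤ (1 : ℝ) * 1 - h.inner (γ s) (mfderiv 𝓘(ℝ, ℝ) (𝓡 3) γ s (1 : ℝ))
        (mfderiv 𝓘(ℝ, ℝ) (𝓡 3) γ s (1 : ℝ))
      linarith
    · rw [h3]
      exact one_pos

end CausalCurves

/-! ### Mollification in `ℝ³`. -/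

section Mollify

/-- Convolution with a probability density averages the differences `g (a - t) - g (b - t)`, all
bounded by `N (a - b)`, so the bound survives without loss. The radius of the density is at most
`r/2`, to stay in the ball, and so small that `N < ξ` on its support. -/
theorem exists_contDiff_approx {g N : E3 → ℝ} (hN : Continuous N) (hN0 : N 0 = 0) {z₀ : E3} {r : ℝ}
    (hr : 0 < r) (hg : ∀ a ∈ Metric.ball z₀ r, ∀ b ∈ Metric.ball z₀ r, |g a - g b| ≤ N (a - b))
    {ξ : ℝ} (hξ : 0 < ξ) : ∃ f : E3 → ℝ, ContDiff ℝ ∞ f ∧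
      (∀ a ∈ Metric.ball z₀ (r / 2), |f a - g a| ≤ ξ) ∧
      ∀ a ∈ Metric.ball z₀ (r / 2), ∀ b ∈ Metric.ball z₀ (r / 2), |f a - f b| ≤ N (a - b) := by
  set B := Metric.ball z₀ r
  have hcont : ContinuousOn g B := by
    intro b hb
    have h1 : Tendsto (fun a => N (a - b)) (𝓝[B] b) (𝓝 0) := by
      have : Tendsto (fun a => N (a - b)) (𝓝 b) (𝓝 (N (b - b))) :=
        (by fun_prop : Continuous fun a => N (a - b)).tendsto b
      rw [sub_self, hN0] at this
      exact this.mono_left nhdsWithin_le_nhds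
    refine tendsto_iff_dist_tendsto_zero.2 (squeeze_zero' (.of_forall fun _ => dist_nonneg) ?_ h1)
    filter_upwards [self_mem_nhdsWithin] with a ha
    exact hg a ha b hb
  set G : E3 → ℝ := B.indicator g with hGdef
  have hGB : ∀ a ∈ B, G a = g a := fun a ha => indicator_of_mem ha g
  have hGint : Integrable G := by
    rw [hGdef, integrable_indicator_iff Metric.isOpen_ball.measurableSet]
    obtain ⟨C, hC⟩ := (((isCompact_closedBall z₀ r).image
      (by fun_prop : Continuous fun a => N (a - z₀))).bddAbove)
    refine Integrable.mono' (integrableOn_const (C := C + |g z₀|) measure_ball_lt_top.ne)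
      (hcont.aestronglyMeasurable Metric.isOpen_ball.measurableSet)
      ((ae_restrict_iff' Metric.isOpen_ball.measurableSet).2 (ae_of_all _ fun a ha => ?_))
    have h1 := hg a ha z₀ (Metric.mem_ball_self hr)
    have h2 := hC ⟨a, Metric.ball_subset_closedBall ha, rfl⟩
    have h3 := abs_sub_abs_le_abs_sub (g a) (g z₀)
    rw [Real.norm_eq_abs]
    linarith
  obtain ⟨δ, hδ, hNδ⟩ : ∃ δ > 0, ∀ w : E3, ‖w‖ < δ → N w < ξ := by
    have h1 : ∀ᶠ w in 𝓝 (0 : E3), N w < ξ :=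
      hN.continuousAt.eventually (by rw [hN0]; exact eventually_lt_nhds hξ)
    obtain ⟨δ, hδ, h2⟩ := Metric.eventually_nhds_iff.1 h1
    exact ⟨δ, hδ, fun w hw => h2 (by simpa using hw)⟩
  set R := min δ (r / 2)
  have hR : 0 < R := lt_min hδ (by linarith)
  let ρ : ContDiffBump (0 : E3) := ⟨R / 2, R, by linarith, by linarith⟩
  have hin : ∀ a ∈ Metric.ball z₀ (r / 2), ∀ t, ρ.normed volume t ≠ 0 → a - t ∈ B := by
    intro a ha t ht
    have h1 : t ∈ Metric.ball (0 : E3) R := by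
      have : t ∈ Function.support (ρ.normed volume) := ht
      rwa [ρ.support_normed_eq] at this
    rw [mem_ball_zero_iff] at h1
    rw [Metric.mem_ball, dist_eq_norm] at ha ⊢
    have h2 : ‖a - t - z₀‖ ≤ ‖a - z₀‖ + ‖t‖ := by
      rw [sub_right_comm]; exact norm_sub_le _ _
    have h3 : R ≤ r / 2 := min_le_right _ _
    linarith
  have hex : ConvolutionExists (ρ.normed volume) G (ContinuousLinearMap.lsmul ℝ ℝ) volume :=
    ρ.hasCompactSupport_normed.convolutionExists_left _ ρ.continuous_normed hGint.locallyIntegrable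
  refine ⟨convolution (ρ.normed volume) G (ContinuousLinearMap.lsmul ℝ ℝ) volume,
    ρ.hasCompactSupport_normed.contDiff_convolution_left _ ρ.contDiff_normed
      hGint.locallyIntegrable, fun a ha => ?_, fun a ha b hb => ?_⟩
  · have haB : a ∈ B := Metric.ball_subset_ball (by linarith) ha
    rw [← hGB a haB, ← Real.dist_eq]
    refine ρ.dist_normed_convolution_le hGint.aestronglyMeasurable fun x hx => ?_
    have hxR : ‖x - a‖ < R := by simpa [dist_eq_norm] using hx
    have hxB : x ∈ B := by
      rw [Metric.mem_ball, dist_eq_norm] at ha ⊢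
      have h3 : R ≤ r / 2 := min_le_right _ _
      have h2 : ‖x - z₀‖ ≤ ‖x - a‖ + ‖a - z₀‖ := by
        rw [← sub_add_sub_cancel x a z₀]; exact norm_add_le _ _
      linarith
    rw [hGB x hxB, hGB a haB, Real.dist_eq]
    exact (hg x hxB a haB).trans (hNδ _ (hxR.trans_le (min_le_left _ _))).le
  · have h1 : convolution (ρ.normed volume) G (ContinuousLinearMap.lsmul ℝ ℝ) volume a -
        convolution (ρ.normed volume) G (ContinuousLinearMap.lsmul ℝ ℝ) volume b =
        ∫ t, ρ.normed volume t * (G (a - t) - G (b - t)) := by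
      rw [convolution_def, convolution_def, ← integral_sub (hex a) (hex b)]
      refine integral_congr_ae (ae_of_all _ fun t => ?_)
      simp [mul_sub]
    rw [h1]
    calc _ ≤ ∫ t, ρ.normed volume t * N (a - b) := by
          rw [← Real.norm_eq_abs]
          refine norm_integral_le_of_norm_le (ρ.integrable_normed.mul_const _)
            (ae_of_all _ fun t => ?_)
          rw [norm_mul, Real.norm_of_nonneg (ρ.nonneg_normed t), Real.norm_eq_abs]
          by_cases ht : ρ.normed volume t = 0
          · simp [ht]
          · have h2 := hin a ha t ht
            have h3 := hin b hb t ht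
            refine mul_le_mul_of_nonneg_left ?_ (ρ.nonneg_normed t)
            rw [hGB _ h2, hGB _ h3]
            have h4 := hg _ h2 _ h3
            rwa [sub_sub_sub_cancel_right] at h4
      _ = N (a - b) := by rw [integral_mul_const, ρ.integral_normed, one_mul]

theorem abs_fderiv_le {f N : E3 → ℝ} (hN : ∀ (a : ℝ) v, N (a • v) = |a| * N v)
    (hN0 : ∀ v, 0 ≤ N v) {z : E3} {U : Set E3} (hU : U ∈ 𝓝 z) (hf : DifferentiableAt ℝ f z)
    (hlip : ∀ a ∈ U, ∀ b ∈ U, |f a - f b| ≤ N (a - b)) (v : E3) : |fderiv ℝ f z v| ≤ N v := by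
  have h1 : HasDerivAt (fun s : ℝ => z + s • v) v 0 := by
    simpa using ((hasDerivAt_id (0 : ℝ)).smul_const v).const_add z
  have h0 : z + (0 : ℝ) • v = z := by simp
  have h2 : HasFDerivAt f (fderiv ℝ f z) (z + (0 : ℝ) • v) := by rw [h0]; exact hf.hasFDerivAt
  have h3 := h2.comp_hasDerivAt (0 : ℝ) h1
  refine h3.le_of_lip' (hN0 v) ?_
  have h4 : ∀ᶠ s in 𝓝 (0 : ℝ), z + s • v ∈ U := h1.continuousAt.eventually (by beta_reduce; rwa [h0])
  filter_upwards [h4] with s hs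
  have h5 := hlip _ hs z (mem_of_mem_nhds hU)
  rw [add_sub_cancel_left, hN] at h5
  simpa [mul_comm] using h5

/-- A continuous family of norms varies little, relative to its value at a point. -/
theorem eventually_norm_le_mul {Q : E3 → E3 → ℝ} {z₀ : E3}
    (hQ : ∀ v, ContinuousAt (fun p : E3 × E3 => Q p.1 p.2) (z₀, v))
    (hhom : ∀ z (a : ℝ) v, Q z (a • v) = |a| * Q z v) (hpos : ∀ v, v ≠ 0 → 0 < Q z₀ v)
    {κ : ℝ} (hκ : 1 < κ) : ∀ᶠ z in 𝓝 z₀, ∀ v, Q z v ≤ κ * Q z₀ v ∧ Q z₀ v ≤ κ * Q z v := by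
  -- By homogeneity unit vectors suffice, and compactness of the sphere makes the neighbourhood of
  -- `z₀` uniform in `v`.
  have h1 : ∀ᶠ z in 𝓝 z₀, ∀ v ∈ Metric.sphere (0 : E3) 1, Q z v ≤ κ * Q z₀ v ∧ Q z₀ v ≤ κ * Q z v := by
    refine (isCompact_sphere (0 : E3) 1).eventually_forall_of_forall_eventually fun v hv => ?_
    have hv0 : v ≠ 0 := by
      rintro rfl; simp at hv
    have h2 : ContinuousAt (fun p : E3 × E3 => Q z₀ p.2) (z₀, v) :=
      ContinuousAt.comp (g := fun p : E3 × E3 => Q p.1 p.2) (f := fun p : E3 × E3 => (z₀, p.2))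
        (hQ v) (by fun_prop)
    have h3 := hpos v hv0
    have h4 : ∀ᶠ p : E3 × E3 in 𝓝 (z₀, v), Q p.1 p.2 < κ * Q z₀ p.2 :=
      (hQ v).eventually_lt (continuousAt_const.mul h2) (by nlinarith)
    have h5 : ∀ᶠ p : E3 × E3 in 𝓝 (z₀, v), Q z₀ p.2 < κ * Q p.1 p.2 :=
      h2.eventually_lt (continuousAt_const.mul (hQ v)) (by nlinarith)
    filter_upwards [h4, h5] with p hp hp'
    exact ⟨hp.le, hp'.le⟩
  filter_upwards [h1] with z hz v
  rcases eq_or_ne v 0 with rfl | hv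
  · have h0 : ∀ z, Q z 0 = 0 := fun z => by simpa using hhom z 0 0
    simp [h0]
  · have h2 := hz (‖v‖⁻¹ • v) (by simp [norm_smul, norm_ne_zero_iff.2 hv])
    have hn : 0 < |‖v‖⁻¹| := by positivity
    rw [hhom, hhom, mul_left_comm, mul_left_comm κ] at h2
    exact ⟨le_of_mul_le_mul_left h2.1 hn, le_of_mul_le_mul_left h2.2 hn⟩

end Mollify

/-! ### The metric in a chart. -/

section ChartNorm

variable {S : Type*} [TopologicalSpace S] [ChartedSpace E3 S] [IsManifold (𝓡 3) ∞ S]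
  {h : C11Metric S} {c : S} {z : E3}

theorem mdifferentiableAt_chart_symm (hz : z ∈ (extChartAt (𝓡 3) c).target) :
    MDifferentiableAt 𝓘(ℝ, E3) (𝓡 3) (extChartAt (𝓡 3) c).symm z := by
  have := mdifferentiableWithinAt_extChartAt_symm (I := 𝓡 3) hz
  rwa [ModelWithCorners.range_eq_univ, mdifferentiableWithinAt_univ] at this

/-- The differential of the inverse of a chart. -/
noncomputable def chartD (c : S) (z : E3) :
    E3 →L[ℝ] TangentSpace (𝓡 3) ((extChartAt (𝓡 3) c).symm z) :=
  mfderiv 𝓘(ℝ, E3) (𝓡 3) (extChartAt (𝓡 3) c).symm z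

theorem exists_equiv_eq_chartD (hz : z ∈ (extChartAt (𝓡 3) c).target) :
    ∃ L : E3 ≃L[ℝ] E3, ∀ v, L v = chartD c z v := by
  obtain ⟨L, hL⟩ := isInvertible_mfderivWithin_extChartAt_symm (I := 𝓡 3) hz
  rw [ModelWithCorners.range_eq_univ, mfderivWithin_univ] at hL
  exact ⟨L, fun v => congrArg (fun T : E3 →L[ℝ] E3 => T v) hL⟩

/-- The length of a vector in the coordinates given by a chart. -/
noncomputable def chartNorm (h : C11Metric S) (c : S) (z v : E3) : ℝ :=
  tangentNorm h ((extChartAt (𝓡 3) c).symm z) (chartD c z v)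

theorem chartNorm_eq (h : C11Metric S) (c : S) (z v : E3) : chartNorm h c z v =
    √(v.ofLp ⬝ᵥ (coordMatrix h.toContinuousRiemannianMetric c z).mulVec v.ofLp) := by
  have hv : (v : E3) = ∑ i, v i • e3 i := by
    ext j; rw [sum_smul_e3]
  have key : ∀ (B : E3 →L[ℝ] E3 →L[ℝ] ℝ) (L : E3 →L[ℝ] E3), B (L v) (L v) =
      v.ofLp ⬝ᵥ (Matrix.of fun i j => B (L (e3 i)) (L (e3 j))).mulVec v.ofLp := by
    intro B L
    conv_lhs => rw [hv]
    simp only [map_sum, map_smul, _root_.sum_apply, _root_.smul_apply, smul_eq_mul, dotProduct,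
      Matrix.mulVec, Matrix.of_apply, Finset.mul_sum]
    rw [Finset.sum_comm]
    exact Finset.sum_congr rfl fun i _ => Finset.sum_congr rfl fun j _ => by ring
  exact congrArg Real.sqrt (key (h.inner _) (chartD c z))

theorem chartNorm_nonneg (v : E3) : 0 ≤ chartNorm h c z v := tangentNorm_nonneg _ _

theorem chartNorm_smul (a : ℝ) (v : E3) : chartNorm h c z (a • v) = |a| * chartNorm h c z v := by
  rw [chartNorm_eq, chartNorm_eq, WithLp.ofLp_smul, Matrix.mulVec_smul, dotProduct_smul,
    smul_dotProduct, smul_smul, smul_eq_mul, Real.sqrt_mul (mul_self_nonneg a),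
    Real.sqrt_mul_self_eq_abs]

theorem chartNorm_pos (hz : z ∈ (extChartAt (𝓡 3) c).target) {v : E3} (hv : v ≠ 0) :
    0 < chartNorm h c z v := by
  obtain ⟨L, hL⟩ := exists_equiv_eq_chartD hz
  refine Real.sqrt_pos.2 (h.pos _ _ fun h0 => hv ?_)
  exact L.map_eq_zero_iff.1 ((hL v).trans h0)

theorem continuousAt_chartNorm (h : C11Metric S) (hz : z ∈ (extChartAt (𝓡 3) c).target) (v : E3) :
    ContinuousAt (fun p : E3 × E3 => chartNorm h c p.1 p.2) (z, v) := by
  simp only [chartNorm_eq, dotProduct, Matrix.mulVec]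
  have h1 : ∀ i j, ContinuousAt (fun p : E3 × E3 =>
      coordMatrix h.toContinuousRiemannianMetric c p.1 i j) (z, v) := fun i j =>
    ContinuousAt.comp (g := fun z => coordMatrix h.toContinuousRiemannianMetric c z i j)
      (f := fun p : E3 × E3 => p.1)
      ((h.contDiffOn_coord c i j).continuousOn.continuousAt
        ((isOpen_extChartAt_target c).mem_nhds hz)) continuousAt_fst
  have h2 : ∀ i, ContinuousAt (fun p : E3 × E3 => p.2 i) (z, v) := fun i =>
    Continuous.continuousAt (by fun_prop)
  refine Real.continuous_sqrt.continuousAt.comp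
    (f := fun p : E3 × E3 => ∑ i, p.2 i * ∑ j,
      coordMatrix h.toContinuousRiemannianMetric c p.1 i j * p.2 j) ?_
  exact tendsto_finsetSum _ fun i _ => (h2 i).mul
    (tendsto_finsetSum _ fun j _ => (h1 i j).mul (h2 j))

theorem hasFDerivAt_comp_chart_symm {f : S → ℝ} (hf : ContMDiff (𝓡 3) 𝓘(ℝ, ℝ) ∞ f)
    (hz : z ∈ (extChartAt (𝓡 3) c).target) :
    HasFDerivAt (fun z => f ((extChartAt (𝓡 3) c).symm z))
      ((realD f ((extChartAt (𝓡 3) c).symm z) : E3 →L[ℝ] ℝ).comp (chartD c z : E3 →L[ℝ] E3)) z := by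
  have h1 : MDifferentiableAt (𝓡 3) 𝓘(ℝ, ℝ) f ((extChartAt (𝓡 3) c).symm z) :=
    hf.mdifferentiableAt (by simp)
  exact (h1.hasMFDerivAt.comp z (mdifferentiableAt_chart_symm hz).hasMFDerivAt).hasFDerivAt

/-- Short functions are Lipschitz in a chart, for the norm at the centre of a small ball. -/
theorem IsShort.abs_sub_le_chartNorm {ψ : S → ℝ} (hψ : IsShort h ψ) {z₀ : E3} {r κ : ℝ}
    (htarget : Metric.ball z₀ r ⊆ (extChartAt (𝓡 3) c).target)
    (hκ : ∀ z ∈ Metric.ball z₀ r, ∀ v, chartNorm h c z v ≤ κ * chartNorm h c z₀ v)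
    {a b : E3} (ha : a ∈ Metric.ball z₀ r) (hb : b ∈ Metric.ball z₀ r) :
    |ψ ((extChartAt (𝓡 3) c).symm a) - ψ ((extChartAt (𝓡 3) c).symm b)| ≤
      κ * chartNorm h c z₀ (a - b) := by
  have hmem : ∀ s ∈ Icc (0 : ℝ) 1, b + s • (a - b) ∈ Metric.ball z₀ r := fun s hs =>
    (convex_ball z₀ r).add_smul_sub_mem hb ha hs
  have hd : ∀ s : ℝ, HasDerivAt (fun s : ℝ => b + s • (a - b)) (a - b) s := fun s => by
    simpa using ((hasDerivAt_id s).smul_const (a - b)).const_add b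
  have hderiv : ∀ s ∈ Icc (0 : ℝ) 1, HasDerivAt
      (fun s : ℝ => ψ ((extChartAt (𝓡 3) c).symm (b + s • (a - b))))
      ((realD ψ ((extChartAt (𝓡 3) c).symm (b + s • (a - b))) : E3 →L[ℝ] ℝ)
        ((chartD c (b + s • (a - b)) : E3 →L[ℝ] E3) (a - b))) s := by
    intro s hs
    have h1 := hasFDerivAt_comp_chart_symm hψ.contMDiff (htarget (hmem s hs))
    have h2 := h1.comp_hasDerivAt s (hd s)
    exact h2
  have hbound : ∀ s ∈ Icc (0 : ℝ) 1,
      ‖(realD ψ ((extChartAt (𝓡 3) c).symm (b + s • (a - b))) : E3 →L[ℝ] ℝ)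
        ((chartD c (b + s • (a - b)) : E3 →L[ℝ] E3) (a - b))‖ ≤ κ * chartNorm h c z₀ (a - b) :=
    fun s hs => (hψ.abs_realD_le _ _).trans (hκ _ (hmem s hs) (a - b))
  -- Mean value inequality along the segment, which stays in the ball by convexity.
  have h1 := norm_image_sub_le_of_norm_deriv_le_segment_01'
    (fun s hs => (hderiv s hs).hasDerivWithinAt) fun s hs => hbound s (Ico_subset_Icc_self hs)
  have h2 : b + (1 : ℝ) • (a - b) = a := by simp
  have h3 : b + (0 : ℝ) • (a - b) = b := by simp
  rw [h2, h3] at h1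
  exact h1

end ChartNorm

/-! ### Smoothing of locally short functions. -/

section Smoothing

variable {S : Type*} [TopologicalSpace S] [ChartedSpace E3 S] [IsManifold (𝓡 3) ∞ S]
  [T2Space S] {h : C11Metric S} {ψ₀ : S → ℝ} {ε : ℝ}

variable (h) in
/-- Functions that are `1`-Lipschitz at scales less than `ε`, for the distance defined by the short
functions. -/
def IsLocallyShort (ε : ℝ) (ψ₀ : S → ℝ) : Prop :=
  ∀ a b δ, 0 ≤ δ → δ ≤ ε → (∀ ψ, IsShort h ψ → |ψ a - ψ b| ≤ δ) → |ψ₀ a - ψ₀ b| ≤ δ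

/-- Freezing the metric at `c` costs a factor `κ`: then `ψ₀` is Lipschitz for a fixed norm, which
mollification respects. Returning to the metric at `x` costs a second `κ`. The neighbourhood does
not depend on `ξ`, since gluing fixes the partition of unity before the accuracy. -/
theorem IsLocallyShort.exists_approx_near (hψ₀ : IsLocallyShort h ε ψ₀) (hε : 0 < ε) (c : S)
    {κ : ℝ} (hκ : 1 < κ) : ∃ O ∈ 𝓝 c, ∀ ξ > 0, ∃ F : S → ℝ, ContMDiff (𝓡 3) 𝓘(ℝ, ℝ) ∞ F ∧
      ∀ x ∈ O, |F x - ψ₀ x| ≤ ξ ∧ ∀ v, |realD F x v| ≤ κ ^ 2 * tangentNorm h x v := by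
  set φ := extChartAt (𝓡 3) c with hφ
  set z₀ := φ c with hz₀
  have hz₀t : z₀ ∈ φ.target := mem_extChartAt_target c
  set N : E3 → ℝ := fun v => κ * chartNorm h c z₀ v with hNdef
  have hNc : Continuous N := by
    refine continuous_const.mul (continuous_iff_continuousAt.2 fun v => ?_)
    exact ContinuousAt.comp (g := fun p : E3 × E3 => chartNorm h c p.1 p.2)
      (f := fun v : E3 => (z₀, v)) (continuousAt_chartNorm h hz₀t v) (by fun_prop)
  have hNhom : ∀ (a : ℝ) v, N (a • v) = |a| * N v := fun a v => by
    simp only [hNdef, chartNorm_smul]; ring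
  have hN0 : N 0 = 0 := by simpa using hNhom 0 0
  have hNnn : ∀ v, 0 ≤ N v := fun v => mul_nonneg (by linarith) (chartNorm_nonneg v)
  obtain ⟨r, hr, hball, hcomp, hNε⟩ : ∃ r > 0, Metric.ball z₀ r ⊆ φ.target ∧
      (∀ z ∈ Metric.ball z₀ r, ∀ v, chartNorm h c z v ≤ κ * chartNorm h c z₀ v ∧
        chartNorm h c z₀ v ≤ κ * chartNorm h c z v) ∧
      ∀ a ∈ Metric.ball z₀ r, ∀ b ∈ Metric.ball z₀ r, N (a - b) ≤ ε := by
    have h1 := eventually_norm_le_mul (Q := chartNorm h c) (continuousAt_chartNorm h hz₀t)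
      (fun z a v => chartNorm_smul a v) (fun v hv => chartNorm_pos hz₀t hv) hκ
    obtain ⟨r₁, hr₁, h2⟩ := Metric.eventually_nhds_iff_ball.1
      (h1.and ((isOpen_extChartAt_target c).mem_nhds hz₀t))
    have h3 : ∀ᶠ w in 𝓝 (0 : E3), N w < ε :=
      hNc.continuousAt.eventually (by rw [hN0]; exact eventually_lt_nhds hε)
    obtain ⟨r₂, hr₂, h4⟩ := Metric.eventually_nhds_iff.1 h3
    refine ⟨min r₁ (r₂ / 2), by positivity, fun z hz => ?_, fun z hz => ?_, fun a ha b hb => ?_⟩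
    · exact (h2 z (Metric.ball_subset_ball (min_le_left _ _) hz)).2
    · exact (h2 z (Metric.ball_subset_ball (min_le_left _ _) hz)).1
    · refine (h4 ?_).le
      have h5 := (Metric.mem_ball.1 ha).trans_le (min_le_right _ _)
      have h6 := (Metric.mem_ball.1 hb).trans_le (min_le_right _ _)
      rw [dist_zero_right, ← dist_eq_norm]
      have := dist_triangle_right a b z₀
      linarith
  have hg : ∀ a ∈ Metric.ball z₀ r, ∀ b ∈ Metric.ball z₀ r,
      |ψ₀ (φ.symm a) - ψ₀ (φ.symm b)| ≤ N (a - b) := fun a ha b hb =>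
    hψ₀ _ _ _ (hNnn _) (hNε a ha b hb) fun ψ hψ =>
      hψ.abs_sub_le_chartNorm hball (fun z hz v => (hcomp z hz v).1) ha hb
  obtain ⟨χ⟩ : Nonempty (SmoothBumpFunction (𝓡 3) c) := inferInstance
  have hO : {x | (χ =ᶠ[𝓝 x] 1) ∧ x ∈ φ.source ∧ φ x ∈ Metric.ball z₀ (r / 2)} ∈ 𝓝 c := by
    filter_upwards [eventually_eventuallyEq_nhds.2 χ.eventuallyEq_one,
      extChartAt_source_mem_nhds (I := 𝓡 3) c, (continuousAt_extChartAt (I := 𝓡 3) c).preimage_mem_nhds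
        (Metric.ball_mem_nhds _ (half_pos hr))] with x h1 h2 h3
    exact ⟨h1, h2, h3⟩
  refine ⟨_, hO, fun ξ hξ => ?_⟩
  obtain ⟨f, hf, hfg, hflip⟩ := exists_contDiff_approx hNc hN0 hr hg hξ
  have hFs : ContMDiff (𝓡 3) 𝓘(ℝ, ℝ) ∞ fun x => χ x • f (φ x) :=
    χ.contMDiff_smul (hf.contMDiff.comp_contMDiffOn contMDiffOn_extChartAt)
  refine ⟨fun x => χ x • f (φ x), hFs, ?_⟩
  rintro x ⟨hχx, hxs, hxb⟩
  obtain ⟨z, hz, rfl⟩ : ∃ z ∈ φ.target, φ.symm z = x := ⟨φ x, φ.map_source hxs, φ.left_inv hxs⟩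
  rw [φ.right_inv hz] at hxb
  have hzr : z ∈ Metric.ball z₀ r := Metric.ball_subset_ball (by linarith) hxb
  constructor
  · have h1 := hχx.eq_of_nhds
    simp only [h1, φ.right_inv hz, Pi.one_apply, one_smul]
    exact hfg z hxb
  · intro v
    obtain ⟨L, hL⟩ := exists_equiv_eq_chartD hz
    obtain ⟨w, rfl⟩ : ∃ w, chartD c z w = v := ⟨L.symm v, (hL _).symm.trans (L.apply_symm_apply v)⟩
    have h1 := hasFDerivAt_comp_chart_symm hFs hz
    have h2 : (fun z => χ (φ.symm z) • f (φ (φ.symm z))) =ᶠ[𝓝 z] f := by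
      have hcont : Tendsto φ.symm (𝓝 z) (𝓝 (φ.symm z)) :=
        (mdifferentiableAt_chart_symm hz).continuousAt
      filter_upwards [(isOpen_extChartAt_target c).mem_nhds hz, hcont.eventually hχx] with z' hz' h3
      rw [h3, φ.right_inv hz', Pi.one_apply, one_smul]
    have h3 := congrArg (fun T : E3 →L[ℝ] ℝ => T w) (h1.congr_of_eventuallyEq h2.symm).fderiv
    have h4 := abs_fderiv_le hNhom hNnn (Metric.isOpen_ball.mem_nhds hxb)
      (hf.differentiable (by simp) z) hflip w
    have h5 : |realD (fun x => χ x • f (φ x)) (φ.symm z) (chartD c z w)| ≤ N w :=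
      (congrArg abs h3).ge.trans h4
    refine h5.trans ?_
    have h6 := (hcomp z hzr w).2
    calc N w ≤ κ * (κ * chartNorm h c z w) := by
          simp only [hNdef]; gcongr
      _ = κ ^ 2 * chartNorm h c z w := by ring

theorem realD_sum {ι : Type*} (s : Finset ι) {f : ι → S → ℝ}
    (hf : ∀ i, ContMDiff (𝓡 3) 𝓘(ℝ, ℝ) ∞ (f i)) (x : S) (v : TangentSpace (𝓡 3) x) :
    realD (fun y => ∑ i ∈ s, f i y) x v = ∑ i ∈ s, realD (f i) x v := by
  classical
  induction s using Finset.induction_on with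
  | empty =>
    simp only [Finset.sum_empty]
    exact congrArg (fun T : E3 →L[ℝ] ℝ => T v) (mfderiv_const (c := (0 : ℝ)))
  | insert i s hi ih =>
    simp only [Finset.sum_insert hi]
    have h1 : ContMDiff (𝓡 3) 𝓘(ℝ, ℝ) ∞ fun y => ∑ i ∈ s, f i y :=
      contMDiff_finsetSum fun i _ => hf i
    rw [← ih]
    exact congrArg (fun T : E3 →L[ℝ] ℝ => T v) (mfderiv_add ((hf i).mdifferentiableAt (by simp))
      (h1.mdifferentiableAt (by simp)))

variable [CompactSpace S]

/-- Locally short functions are uniform limits of smooth functions that are almost short. -/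
theorem IsLocallyShort.exists_approx (hψ₀ : IsLocallyShort h ε ψ₀) (hε : 0 < ε) {η : ℝ}
    (hη : 0 < η) : ∃ f : S → ℝ, ContMDiff (𝓡 3) 𝓘(ℝ, ℝ) ∞ f ∧ (∀ x, |f x - ψ₀ x| ≤ η) ∧
      ∀ x v, |realD f x v| ≤ (1 + η) * tangentNorm h x v := by
  obtain ⟨κ, hκ, hκη⟩ : ∃ κ : ℝ, 1 < κ ∧ κ ^ 2 ≤ 1 + η / 2 := by
    refine ⟨√(1 + η / 2), ?_, (Real.sq_sqrt (by positivity)).le⟩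
    rw [Real.lt_sqrt one_pos.le]
    linarith
  choose O hO happ using fun c => hψ₀.exists_approx_near hε c hκ
  obtain ⟨t, ht⟩ := CompactSpace.elim_nhds_subcover (fun c => interior (O c))
    fun c => interior_mem_nhds.2 (hO c)
  obtain ⟨χ, hχ⟩ := SmoothPartitionOfUnity.exists_isSubordinate (𝓡 3) isClosed_univ
    (fun i : t => interior (O i)) (fun _ => isOpen_interior) (by
      intro x _
      have : x ∈ ⋃ c ∈ t, interior (O c) := by rw [ht]; trivial
      obtain ⟨c, hc, hx⟩ := mem_iUnion₂.1 this
      exact mem_iUnion.2 ⟨⟨c, hc⟩, hx⟩)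
  have hχs : ∀ i, ContMDiff (𝓡 3) 𝓘(ℝ, ℝ) ∞ (χ i) := fun i => (χ i).contMDiff
  have hχ1 : ∀ x, ∑ i, χ i x = 1 := fun x => by
    rw [← finsum_eq_sum_of_fintype]; exact χ.sum_eq_one (mem_univ x)
  choose C hC hCle using fun i => exists_pos_abs_realD_le h (hχs i)
  have hCs : 0 ≤ ∑ i, C i := Finset.sum_nonneg fun i _ => (hC i).le
  -- Small against the total slope of the partition of unity, so that its derivatives cost at most
  -- `η/2`; the other `η/2` is spent by `κ²`.
  set ξ := min η (η / 2 / (∑ i, C i + 1)) with hξdef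
  have hξ : 0 < ξ := lt_min hη (by positivity)
  have hξC : ξ * ∑ i, C i ≤ η / 2 := by
    have h1 : ξ ≤ η / 2 / (∑ i, C i + 1) := min_le_right _ _
    rw [le_div_iff₀ (by positivity)] at h1
    nlinarith
  choose F hF hFO using fun i : t => happ i ξ hξ
  have hmem : ∀ i x, χ i x ≠ 0 → x ∈ O i := fun i x hx =>
    interior_subset (hχ i (subset_tsupport _ hx))
  have hmem' : ∀ i x v, realD (χ i) x v ≠ 0 → x ∈ O i := by
    intro i x v hx
    refine interior_subset (hχ i ?_)
    by_contra hxt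
    refine hx ((realD_congr (g := fun _ => 0) (notMem_tsupport_iff_eventuallyEq.1 hxt) v).trans ?_)
    exact congrArg (fun T : E3 →L[ℝ] ℝ => T v) (mfderiv_const (c := (0 : ℝ)))
  have hsm : ∀ i, ContMDiff (𝓡 3) 𝓘(ℝ, ℝ) ∞ fun x => χ i x * F i x := fun i =>
    contMDiff_mul (hχs i) (hF i)
  refine ⟨fun x => ∑ i, χ i x * F i x, contMDiff_finsetSum fun i _ => hsm i, fun x => ?_,
    fun x v => ?_⟩
  · have h1 : ∑ i, χ i x * F i x - ψ₀ x = ∑ i, χ i x * (F i x - ψ₀ x) := by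
      simp only [mul_sub, Finset.sum_sub_distrib, ← Finset.sum_mul, hχ1, one_mul]
    rw [h1]
    calc _ ≤ ∑ i, χ i x * ξ := by
          refine (Finset.abs_sum_le_sum_abs _ _).trans (Finset.sum_le_sum fun i _ => ?_)
          rw [abs_mul, abs_of_nonneg (χ.nonneg i x)]
          by_cases hx : χ i x = 0
          · simp [hx]
          · exact mul_le_mul_of_nonneg_left (hFO i x (hmem i x hx)).1 (χ.nonneg i x)
      _ = ξ := by rw [← Finset.sum_mul, hχ1, one_mul]
      _ ≤ η := min_le_left _ _
  · have hn := tangentNorm_nonneg (h := h) x v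
    -- This permits subtracting the number `ψ₀ x` from each `F i x` in front of `dχᵢ`; no
    -- differentiability of `ψ₀` is involved.
    have h0 : ∑ i, realD (χ i) x v = 0 := by
      rw [← realD_sum _ hχs]
      have : (fun y => ∑ i, χ i y) = fun _ => (1 : ℝ) := funext hχ1
      rw [this]
      exact congrArg (fun T : E3 →L[ℝ] ℝ => T v) (mfderiv_const (c := (1 : ℝ)))
    have h1 : realD (fun x => ∑ i, χ i x * F i x) x v =
        ∑ i, (χ i x * realD (F i) x v + (F i x - ψ₀ x) * realD (χ i) x v) := by
      rw [realD_sum _ hsm, Finset.sum_add_distrib]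
      simp only [realD_mul (hχs _) (hF _), sub_mul, Finset.sum_sub_distrib, ← Finset.mul_sum, h0,
        Finset.sum_add_distrib]
      ring
    rw [h1]
    calc _ ≤ ∑ i, (χ i x * (κ ^ 2 * tangentNorm h x v) + ξ * (C i * tangentNorm h x v)) := by
          refine (Finset.abs_sum_le_sum_abs _ _).trans (Finset.sum_le_sum fun i _ => ?_)
          refine (abs_add_le _ _).trans (add_le_add ?_ ?_)
          · rw [abs_mul, abs_of_nonneg (χ.nonneg i x)]
            by_cases hx : χ i x = 0
            · simp [hx]
            · exact mul_le_mul_of_nonneg_left ((hFO i x (hmem i x hx)).2 v) (χ.nonneg i x)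
          · rw [abs_mul]
            by_cases hx : realD (χ i) x v = 0
            · have := hC i
              rw [hx, abs_zero, mul_zero]
              positivity
            · exact mul_le_mul (hFO i x (hmem' i x v hx)).1 (hCle i x v) (abs_nonneg _) hξ.le
      _ = (κ ^ 2 + ξ * ∑ i, C i) * tangentNorm h x v := by
          rw [Finset.sum_add_distrib, ← Finset.sum_mul, hχ1, ← Finset.mul_sum, ← Finset.sum_mul]
          ring
      _ ≤ _ := mul_le_mul_of_nonneg_right (by linarith) hn

end Smoothing

/-! ### From chains of small jumps to causal curves. -/

section Chains

variable {S : Type*} [TopologicalSpace S] [ChartedSpace E3 S] [IsManifold (𝓡 3) ∞ S]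
  {h : C11Metric S} {ε : ℝ} {x y : S}

variable (h) in
/-- The point can be reached from `y` by jumps of size at most `ε` and of the given total size, the
size of a jump being an upper bound on the increments of the short functions. -/
inductive Chain (ε : ℝ) (y : S) : S → ℝ → Prop
  | refl : Chain ε y y 0
  | step {x x' : S} {c δ : ℝ} : Chain ε y x c → 0 ≤ δ → δ ≤ ε →
      (∀ ψ, IsShort h ψ → |ψ x - ψ x'| ≤ δ) → Chain ε y x' (c + δ)

theorem Chain.nonneg {c : ℝ} (hc : Chain h ε y x c) : 0 ≤ c := by
  induction hc with
  | refl => exact le_rfl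
  | step _ hδ _ _ ih => exact add_nonneg ih hδ

/-- The step function through the points of a chain. -/
theorem Chain.exists_stepFun (hε : 0 ≤ ε) {c : ℝ} (hc : Chain h ε y x c) : ∃ γ : ℝ → S,
    (∀ s < 0, γ s = y) ∧ (∀ s, c ≤ s → γ s = x) ∧
      (∀ ψ, IsShort h ψ → ∀ s, |ψ (γ s) - ψ x| ≤ max (c - s) 0 + ε) ∧
      ∀ ψ, IsShort h ψ → ∀ s t, |ψ (γ s) - ψ (γ t)| ≤ |s - t| + 2 * ε := by
  induction hc with
  | refl =>
    refine ⟨fun _ => y, fun _ _ => rfl, fun _ _ => rfl, fun ψ _ s => ?_, fun ψ _ s t => ?_⟩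
    · rw [sub_self, abs_zero]; positivity
    · rw [sub_self, abs_zero]; positivity
  | @step x x' c δ hch hδ hδε hjump ih =>
    obtain ⟨γ, hneg, hge, hx, hlip⟩ := ih
    have hc := hch.nonneg
    -- The third clause of the induction exists for this: before the new jump, the increment to the
    -- endpoint is bounded by the remaining time plus one jump.
    have hx' : ∀ ψ, IsShort h ψ → ∀ s < c + δ, |ψ (γ s) - ψ x'| ≤ c + δ - s + ε := by
      intro ψ hψ s hs
      rcases lt_or_ge s c with hsc | hsc
      · have h1 := hx ψ hψ s
        rw [max_eq_left (by linarith)] at h1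
        have h2 := hjump ψ hψ
        have h3 := abs_sub_le (ψ (γ s)) (ψ x) (ψ x')
        linarith
      · rw [hge s hsc]
        have := hjump ψ hψ
        linarith
    refine ⟨fun s => if s < c + δ then γ s else x', fun s hs => ?_, fun s hs => ?_,
      fun ψ hψ s => ?_, fun ψ hψ s t => ?_⟩
    · exact (if_pos (by linarith)).trans (hneg s hs)
    · exact if_neg hs.not_gt
    · beta_reduce
      split_ifs with hs
      · exact (hx' ψ hψ s hs).trans (add_le_add_left (le_max_left _ _) _)
      · rw [sub_self, abs_zero]; positivity
    · beta_reduce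
      split_ifs with hs ht ht
      · exact hlip ψ hψ s t
      · have := hx' ψ hψ s hs
        have h2 := neg_abs_le (s - t)
        linarith
      · have := hx' ψ hψ t ht
        rw [abs_sub_comm] at this
        have h2 := le_abs_self (s - t)
        linarith
      · rw [sub_self, abs_zero]; positivity

/-- The least total size of a chain, cut off at `R`. -/
noncomputable def chainDist (h : C11Metric S) (ε R : ℝ) (y x : S) : ℝ :=
  sInf {c | Chain h ε y x c ∨ c = R}

theorem bddBelow_chain (R : ℝ) : BddBelow {c | Chain h ε y x c ∨ c = R} := by
  refine ⟨min 0 R, ?_⟩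
  rintro c (hc | rfl)
  · exact (min_le_left _ _).trans hc.nonneg
  · exact min_le_right _ _

/-- A jump of size `δ ≤ ε` prolongs every chain, so the infimum grows by at most `δ`. The cutoff `R`
keeps the set nonempty when no chain exists, and does not spoil the estimate. -/
theorem isLocallyShort_chainDist (R : ℝ) : IsLocallyShort h ε (chainDist h ε R y) := by
  have key : ∀ a b δ, 0 ≤ δ → δ ≤ ε → (∀ ψ, IsShort h ψ → |ψ a - ψ b| ≤ δ) →
      chainDist h ε R y b - chainDist h ε R y a ≤ δ := by
    intro a b δ hδ hδε hab
    rw [sub_le_comm]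
    refine le_csInf ⟨R, .inr rfl⟩ ?_
    rintro c (hc | rfl)
    · have h1 : chainDist h ε R y b ≤ c + δ :=
        csInf_le (bddBelow_chain R) (.inl (hc.step hδ hδε hab))
      linarith
    · have h1 : chainDist h ε c y b ≤ c := csInf_le (bddBelow_chain c) (.inr rfl)
      linarith
  intro a b δ hδ hδε hab
  rw [abs_sub_le_iff]
  refine ⟨key b a δ hδ hδε fun ψ hψ => ?_, key a b δ hδ hδε hab⟩
  rw [abs_sub_comm]
  exact hab ψ hψ

variable [T2Space S] [CompactSpace S]

/-- If `f` is `η`-close to the chain distance and has slope at most `1 + η`, then `f / (1 + η)` is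
short, so the chain distance at `x` is at most `(1 + η) T + 2η = T + η (T + 2)`. The choice of `η`
puts this below the cutoff `T + ε`, and only genuine chains lie there. -/
theorem exists_chain {T : ℝ} (hT : 0 ≤ T) (hε : 0 < ε)
    (hxy : ∀ ψ, IsShort h ψ → |ψ x - ψ y| ≤ T) : ∃ c < T + ε, Chain h ε y x c := by
  set ψ₀ := chainDist h ε (T + ε) y with hψ₀
  have hy : ψ₀ y ≤ 0 := csInf_le (bddBelow_chain _) (.inl .refl)
  set η := ε / (T + 3) with hηdef
  have hη : 0 < η := by positivity
  have hηε : η * (T + 2) < ε := by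
    have : η * (T + 3) = ε := div_mul_cancel₀ _ (by positivity)
    linarith
  obtain ⟨f, hf, hfψ, hfd⟩ := (isLocallyShort_chainDist (h := h) (ε := ε) (y := y)
    (T + ε)).exists_approx hε hη
  have hs : IsShort h fun z => (1 + η)⁻¹ * f z := by
    refine .of_abs_le (contMDiff_const_mul _ hf) fun z v => ?_
    rw [realD_const_mul _ hf, abs_mul, abs_of_pos (by positivity), inv_mul_le_iff₀ (by positivity)]
    exact hfd z v
  have h1 := hxy _ hs
  rw [← mul_sub, abs_mul, abs_of_pos (by positivity), inv_mul_le_iff₀ (by positivity)] at h1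
  have h2 := abs_le.1 (hfψ x)
  have h3 := abs_le.1 (hfψ y)
  have h4 := abs_le.1 h1
  have h5 : ψ₀ x < T + ε := by
    rw [← hψ₀] at h2 h3
    linarith
  obtain ⟨c, hc | rfl, hcT⟩ := (csInf_lt_iff (bddBelow_chain _) ⟨_, .inr rfl⟩).1 h5
  · exact ⟨c, hcT, hc⟩
  · exact absurd hcT (lt_irrefl _)

theorem exists_almost_isShortCurve {T : ℝ} (hT : 0 < T) (hε : 0 < ε)
    (hxy : ∀ ψ, IsShort h ψ → |ψ x - ψ y| ≤ T) : ∃ γ : ℝ → S, γ 0 = y ∧ γ T = x ∧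
      ∀ ψ, IsShort h ψ → ∀ s t, |ψ (γ s) - ψ (γ t)| ≤ |s - t| + 4 * ε := by
  obtain ⟨c, hcT, hc⟩ := exists_chain hT.le hε hxy
  obtain ⟨γ, hneg, hge, -, hlip⟩ := hc.exists_stepFun hε.le
  -- The step function is certain to be at `y` only at negative times, and at `x` from time `c < T +
  -- ε` on. Shifting the two half-lines apart pins the endpoints at `0` and `T`, at the price of
  -- `2ε`.
  set σ : ℝ → ℝ := fun s => if s ≤ 0 then s - ε else s + ε with hσ
  have hσlip : ∀ s t, |σ s - σ t| ≤ |s - t| + 2 * ε := by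
    intro s t
    simp only [hσ]
    have h1 := le_abs_self (s - t)
    have h2 := neg_abs_le (s - t)
    split_ifs <;> rw [abs_le] <;> constructor <;> linarith
  refine ⟨γ ∘ σ, hneg _ ?_, hge _ ?_, fun ψ hψ s t => ?_⟩
  · simp [hσ, hε]
  · simp only [hσ, if_neg hT.not_ge]
    exact hcT.le
  · have h1 := hlip ψ hψ (σ s) (σ t)
    have h2 := hσlip s t
    simp only [Function.comp_apply]
    linarith

/-- Points at distance at most `T` are joined by a curve of length at most `T`. -/
theorem exists_isShortCurve {T : ℝ} (hT : 0 < T) (hxy : ∀ ψ, IsShort h ψ → |ψ x - ψ y| ≤ T) :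
    ∃ γ : ℝ → S, IsShortCurve h γ ∧ γ 0 = y ∧ γ T = x := by
  -- No continuity is asked of these maps, so the sets are closed for pointwise convergence. By
  -- Tychonoff's theorem `ℝ → S` is compact, and the decreasing sets have a common element, for
  -- which the error disappears.
  set K : ℕ → Set (ℝ → S) := fun n => {γ | γ 0 = y ∧ γ T = x ∧
    ∀ ψ, IsShort h ψ → ∀ s t, |ψ (γ s) - ψ (γ t)| ≤ |s - t| + 1 / ((n : ℝ) + 1)} with hK
  have hclosed : ∀ n, IsClosed (K n) := by
    intro n
    have h3 : IsClosed {γ : ℝ → S | ∀ ψ, IsShort h ψ → ∀ s t,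
        |ψ (γ s) - ψ (γ t)| ≤ |s - t| + 1 / ((n : ℝ) + 1)} := by
      simp only [ofPred_forall]
      refine isClosed_iInter fun ψ => isClosed_iInter fun hψ => isClosed_iInter fun s =>
        isClosed_iInter fun t => isClosed_le ?_ continuous_const
      have hc := hψ.contMDiff.continuous
      fun_prop
    exact (isClosed_eq (continuous_apply 0) continuous_const).inter
      ((isClosed_eq (continuous_apply T) continuous_const).inter h3)
  obtain ⟨γ, hγ⟩ := IsCompact.nonempty_iInter_of_sequence_nonempty_isCompact_isClosed K
    (fun n γ hγ => ⟨hγ.1, hγ.2.1, fun ψ hψ s t => (hγ.2.2 ψ hψ s t).trans (by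
      have : 1 / (((n + 1 : ℕ) : ℝ) + 1) ≤ 1 / ((n : ℝ) + 1) := by
        gcongr
        simp
      linarith)⟩)
    (fun n => by
      obtain ⟨γ, h0, hT', hlip⟩ := exists_almost_isShortCurve hT
        (ε := 1 / ((n : ℝ) + 1) / 4) (by positivity) hxy
      exact ⟨γ, h0, hT', fun ψ hψ s t => (hlip ψ hψ s t).trans (by linarith)⟩)
    (hclosed 0).isCompact hclosed
  rw [mem_iInter] at hγ
  refine ⟨γ, fun ψ hψ s t => ?_, (hγ 0).1, (hγ 0).2.1⟩
  have h1 : Tendsto (fun n : ℕ => |s - t| + 1 / ((n : ℝ) + 1)) atTop (𝓝 (|s - t| + 0)) :=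
    tendsto_const_nhds.add tendsto_one_div_add_atTop_nhds_zero_nat
  rw [add_zero] at h1
  exact ge_of_tendsto' h1 fun n => (hγ n).2.2 ψ hψ s t

theorem mem_causalFuture_of_short {p q : ℝ × S} (hpq : q.1 < p.1)
    (hle : ∀ ψ, IsShort h ψ → |ψ p.2 - ψ q.2| ≤ p.1 - q.1) : p ∈ causalFuture h q := by
  obtain ⟨γ, hγ, h0, hT⟩ := exists_isShortCurve (sub_pos.2 hpq) hle
  refine .inr ⟨_, 0, p.1 - q.1, sub_pos.2 hpq, hγ.isFutureCausal q.1 0 (p.1 - q.1), ?_, ?_⟩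
  · simp [h0]
  · simp [hT]

/-- Points that are not causally related are separated by a short function. -/
theorem exists_isShort_of_notMem_causalJ {p q : ℝ × S} (hpq : p ∉ causalJ h q) :
    ∃ ψ, IsShort h ψ ∧ |p.1 - q.1| < ψ p.2 - ψ q.2 := by
  by_contra! hcon
  have hle : ∀ ψ, IsShort h ψ → |ψ p.2 - ψ q.2| ≤ |p.1 - q.1| := fun ψ hψ => by
    refine abs_le'.2 ⟨hcon ψ hψ, ?_⟩
    have := hcon _ hψ.neg
    linarith
  refine hpq ?_
  rcases lt_trichotomy p.1 q.1 with hlt | heq | hgt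
  · refine .inr (mem_causalFuture_of_short hlt fun ψ hψ => ?_)
    rw [abs_sub_comm, ← abs_of_pos (sub_pos.2 hlt), abs_sub_comm q.1]
    exact hle ψ hψ
  -- At equal times no short function may differ at the two points; as short functions separate
  -- points, `p = q`.
  · refine .inl (.inl (Prod.ext heq ?_))
    by_contra hne
    obtain ⟨ψ, hψ, hψne⟩ := exists_isShort_ne h hne
    have h1 := hle ψ hψ
    rw [heq, sub_self, abs_zero, abs_nonpos_iff, sub_eq_zero] at h1
    exact hψne h1
  · refine .inl (mem_causalFuture_of_short hgt fun ψ hψ => ?_)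
    rw [← abs_of_pos (sub_pos.2 hgt)]
    exact hle ψ hψ

end Chains

end Ultrastatic

theorem lemma5p1 {S : Type*} [TopologicalSpace S] [ChartedSpace Ultrastatic.E3 S]
    [IsManifold (𝓡 3) ∞ S] [T2Space S] [CompactSpace S] [MeasurableSpace S] [BorelSpace S]
    (h : Ultrastatic.C11Metric S) {m : ℝ} (hm : 0 < m)
    {ι : Type*} (b : HilbertBasis ι ℂ (Ultrastatic.L2 h))
    (p q : ℝ × S) (hpq : p ∉ Ultrastatic.causalJ h q) :
    (p, q) ∉ Ultrastatic.distSupport (Ultrastatic.IM.prod Ultrastatic.IM)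
      (Ultrastatic.causalKernel h hm b) := by
  obtain ⟨ψ, hψ, hlt⟩ := Ultrastatic.exists_isShort_of_notMem_causalJ hpq
  exact Ultrastatic.notMem_distSupport_of_isShort h hm b hψ hlt
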